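/- For every dimension $d\ge 3$ there are constants $\eta=\eta(d)>0$ and $c=c(d)>0$ such that the following holds for every integer $N\ge 1$ and every set $\mathcal A_N\subset[0,1]^d$ of exactly $N$ points. Let $$D_N(x)=\sharp\bigl(\mathcal A_N\cap[\vec 0,\vec x)\bigr)-N\,\bigl|[\vec 0,\vec x)\bigr|,\qquad x\in[0,1]^d,\qquad [\vec 0,\vec x)=\prod_{j=1}^d[0,x_j),$$ be the discrepancy function of $\mathcal A_N$, where $|\cdot|$ denotes Lebesgue measure. Then $$\|D_N\|_{L^\infty([0,1]^d)}\ \ge\ c\,(\log N)^{\frac{d-1}{2}+\eta}.$$ -/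

import Mathlib

open MeasureTheory

/-- The unit cube `[0,1]^d`. -/
def unitCube (d : ℕ) : Set (Fin d → ℝ) :=
  Set.Icc 0 1

/-- The half-open box `[0,x) = ∏ j, [0, x_j)` anchored at the origin. -/
def anchoredBox {d : ℕ} (x : Fin d → ℝ) : Set (Fin d → ℝ) :=
  Set.univ.pi fun j => Set.Ico 0 (x j)

/-- The discrepancy function of a finite set `A` of points, with `N = A.card`:
`D_N(x) = #(A ∩ [0,x)) - N * |[0,x)|`. -/
noncomputable def discrepancyFunction {d : ℕ} (A : Finset (Fin d → ℝ))
    (x : Fin d → ℝ) : ℝ :=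
  (((A : Set (Fin d → ℝ)) ∩ anchoredBox x).ncard : ℝ)
    - (A.card : ℝ) * volume.real (anchoredBox x)

/-!
The cube is replaced by a finite model. Each coordinate is given by `m = n + 1` binary digits, where
`2 ^ n` is between two and four times the number of points, and the corresponding dyadic grid is
translated so that the almost everywhere bound `B` on the discrepancy function holds at every grid
point (`exists_shift`). It then suffices to show that `B` is at least a multiple of
`m ^ ((d - 1) / 2 + η)`.

The bound comes from duality: a test function of bounded `L¹`-norm is constructed whose inner product
with the discrepancy function `D` is large. For a level vector `r` with coordinate sum `n`, let `f r`
be the signed sum of the Haar functions on the boxes of side lengths `2 ^ (- r j)`, the signs being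
those of the Haar coefficients of `D`. At least half of these boxes contain no point, which makes the
inner product of `D` with `f r` at least a positive constant (`le_avg_digDisc_mul_signedHaar`); on the
other hand `D` is nearly orthogonal to all functions oscillating with total frequency well above `n`
(`abs_avg_digDisc_mul_le`). There are about `m ^ (d - 1)` level vectors (`le_card_levels`).

Let `v` be one of the coordinates. Its levels are divided into `q` separated blocks, and `H t` denotes
the sum of the `f r` over the level vectors of sum `n` whose level in `v` lies in the block `t`. The
test function is, up to a correction, the Riesz product `∏ t, (1 + τ * H t)`, minus one. Its linear
part has inner product about `τ * m ^ (d - 1)` with `D`, and `τ` may be taken as large as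
`κ * (m ^ (d - 1) / q) ^ (-1 / 2)` with a small `κ`. If `κ = 1 / w` and `q = w ^ 3`, this gains a
factor `√w` over `m ^ ((d - 1) / 2)`, and `w` may be chosen as a small power of `m`
(`exists_growth_bound`). Two facts about the product are needed.

First, its `L¹`-norm is at most two (`avg_abs_riesz_le_two`). The product has mean one, and it is
negative only where some `τ * H t` is less than `-1`. As functions of the digits of the coordinate
`v`, the `H t` are dyadic martingales, so their distribution is governed by their square functions, and
these are close to their diagonal part outside an exceptional set of tiny measure
(`exists_owp_sum_sq_hyp_le`).

Secondly, the terms of higher order should not contribute to the inner product with `D`. A product of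
several of the functions `f r` oscillates with a total frequency well above `n` if in each coordinate
the largest of the levels occurs only once, since the blocks are separated in the coordinate `v`
(`exists_anti_of_not_tie`, `le_avg_mul_tieFree_sub_one`). The terms with a tie in some coordinate other
than `v` have to be removed without changing the `L¹`-norm much. By inclusion and exclusion, according
to the largest level in each coordinate and the set of factors attaining it, the part removed is a sum
of products of the same kind with prescribed levels in some coordinates. Those again contain Riesz
products, multiplied by factors with a prescribed common level (`avg_abs_tieFree_sub_le`).

Both facts rest on the estimate that prescribing a coincidence of levels saves more than the size of
the index set suggests (`gainBound_and_halfBound`, `exists_owp_pair_le_of`). This is proved by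
induction on the number of free coordinates. The levels of a free coordinate are equal in both
factors, or one of them is larger. In the latter case the sum over the larger level is a dyadic
martingale, to which the subgaussian inequality `owp_abs_sum_le` applies; expanding its square function
leads back to a coincidence with fewer free coordinates. The induction starts with the remark that two
level vectors with equal sums never differ in one coordinate only (`hyp_mul_hyp_eq_zero`).
-/


/-! ### Averages over binary digits -/

/-- The finite model of the cube: `m` binary digits in each of `d` coordinates. -/
abbrev Dig (d m : ℕ) := Fin d → Fin m → Bool

/-- Change the `k`-th binary digit of the `j`-th coordinate. -/
def flipDigit {d m : ℕ} (j : Fin d) (k : Fin m) (ω : Dig d m) : Dig d m :=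
  Function.update ω j (Function.update (ω j) k (!ω j k))

/-- The average of a function over all digit configurations. -/
noncomputable def avg {d m : ℕ} (F : Dig d m → ℝ) : ℝ :=
  (∑ ω, F ω) / Fintype.card (Dig d m)

open Classical in
/-- The proportion of digit configurations having a given property. -/
noncomputable def prop {d m : ℕ} (p : Dig d m → Prop) : ℝ :=
  avg fun ω => if p ω then 1 else 0

section Avg

variable {d m : ℕ}

lemma flipDigit_apply_same (j : Fin d) (k : Fin m) (ω : Dig d m) :
    flipDigit j k ω j k = !ω j k := by simp [flipDigit]

lemma flipDigit_apply_of_ne_digit {j i : Fin d} {k l : Fin m} (h : l ≠ k) (ω : Dig d m) :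
    flipDigit j k ω i l = ω i l := by
  unfold flipDigit
  by_cases hi : i = j
  · subst hi; simp [h]
  · simp [hi]

lemma flipDigit_apply_of_ne {j i : Fin d} {k : Fin m} (h : i ≠ j) (ω : Dig d m) :
    flipDigit j k ω i = ω i := by
  simp [flipDigit, h]

lemma flipDigit_flipDigit (j : Fin d) (k : Fin m) (ω : Dig d m) :
    flipDigit j k (flipDigit j k ω) = ω := by
  simp [flipDigit]

lemma sum_flipDigit (j : Fin d) (k : Fin m) (F : Dig d m → ℝ) :
    ∑ ω, F (flipDigit j k ω) = ∑ ω, F ω :=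
  Fintype.sum_equiv (Function.Involutive.toPerm _ (flipDigit_flipDigit j k)) _ _ fun _ => rfl

lemma avg_flipDigit (j : Fin d) (k : Fin m) (F : Dig d m → ℝ) :
    avg (fun ω => F (flipDigit j k ω)) = avg F := by
  simp only [avg, sum_flipDigit]

lemma avg_eq_zero_of_flipDigit (j : Fin d) (k : Fin m) {F : Dig d m → ℝ}
    (h : ∀ ω, F (flipDigit j k ω) = -F ω) : avg F = 0 := by
  have h1 := sum_flipDigit j k F
  simp only [h, Finset.sum_neg_distrib] at h1
  have : ∑ ω, F ω = 0 := by linarith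
  simp [avg, this]

lemma card_dig_pos : (0 : ℝ) < Fintype.card (Dig d m) := by
  exact_mod_cast Fintype.card_pos

lemma avg_add (F G : Dig d m → ℝ) : avg (fun ω => F ω + G ω) = avg F + avg G := by
  simp [avg, Finset.sum_add_distrib, add_div]

lemma avg_sub (F G : Dig d m → ℝ) : avg (fun ω => F ω - G ω) = avg F - avg G := by
  simp [avg, Finset.sum_sub_distrib, sub_div]

lemma avg_const_mul (c : ℝ) (F : Dig d m → ℝ) : avg (fun ω => c * F ω) = c * avg F := by
  simp [avg, ← Finset.mul_sum, mul_div_assoc]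

lemma avg_const (c : ℝ) : avg (fun _ : Dig d m => c) = c := by
  have := card_dig_pos (d := d) (m := m)
  simp only [avg, Finset.sum_const, Finset.card_univ, nsmul_eq_mul]
  field_simp

lemma avg_sum {ι : Type*} (s : Finset ι) (F : ι → Dig d m → ℝ) :
    avg (fun ω => ∑ i ∈ s, F i ω) = ∑ i ∈ s, avg (F i) := by
  simp only [avg]
  rw [Finset.sum_comm, Finset.sum_div]

lemma avg_mono {F G : Dig d m → ℝ} (h : ∀ ω, F ω ≤ G ω) : avg F ≤ avg G :=
  div_le_div_of_nonneg_right (Finset.sum_le_sum fun ω _ => h ω) (Nat.cast_nonneg _)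

lemma avg_nonneg {F : Dig d m → ℝ} (h : ∀ ω, 0 ≤ F ω) : 0 ≤ avg F :=
  div_nonneg (Finset.sum_nonneg fun ω _ => h ω) (Nat.cast_nonneg _)

lemma abs_avg_le (F : Dig d m → ℝ) : |avg F| ≤ avg fun ω => |F ω| := by
  rw [avg, abs_div, Nat.abs_cast]
  exact div_le_div_of_nonneg_right (Finset.abs_sum_le_sum_abs _ _) (Nat.cast_nonneg _)

lemma avg_mul_sq_le (F G : Dig d m → ℝ) :
    (avg fun ω => F ω * G ω) ^ 2 ≤ (avg fun ω => F ω ^ 2) * avg fun ω => G ω ^ 2 := by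
  simp only [avg, div_pow, div_mul_div_comm, ← sq]
  exact div_le_div_of_nonneg_right (Finset.sum_mul_sq_le_sq_mul_sq _ _ _) (by positivity)

lemma prop_nonneg (p : Dig d m → Prop) : 0 ≤ prop p := by
  classical
  exact avg_nonneg fun ω => by split_ifs <;> norm_num

lemma prop_mono {p p' : Dig d m → Prop} (h : ∀ ω, p ω → p' ω) : prop p ≤ prop p' := by
  classical
  refine avg_mono fun ω => ?_
  by_cases h1 : p ω
  · simp [h1, h ω h1]
  · simp only [h1, if_false]; split_ifs <;> norm_num

lemma prop_le_avg {p : Dig d m → Prop} {F : Dig d m → ℝ} (h0 : ∀ ω, 0 ≤ F ω)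
    (h : ∀ ω, p ω → 1 ≤ F ω) : prop p ≤ avg F := by
  classical
  refine avg_mono fun ω => ?_
  split_ifs with hp
  · exact h ω hp
  · exact h0 ω

lemma prop_or_le (p p' : Dig d m → Prop) : prop (fun ω => p ω ∨ p' ω) ≤ prop p + prop p' := by
  classical
  unfold prop
  rw [← avg_add]
  refine avg_mono fun ω => ?_
  by_cases h1 : p ω <;> by_cases h2 : p' ω <;> simp [h1, h2]

lemma prop_exists_le {ι : Type*} (s : Finset ι) (p : ι → Dig d m → Prop) :
    prop (fun ω => ∃ i ∈ s, p i ω) ≤ ∑ i ∈ s, prop (p i) := by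
  classical
  unfold prop
  rw [← avg_sum]
  refine avg_mono fun ω => ?_
  split_ifs with h
  · obtain ⟨i, hi, hp⟩ := h
    refine le_trans ?_ (Finset.single_le_sum (f := fun i => if p i ω then (1 : ℝ) else 0)
      (fun i _ => by positivity) hi)
    simp [hp]
  · exact Finset.sum_nonneg fun i _ => by positivity

open Classical in
/-- Splitting an average according to an exceptional event: outside the event `F` is dominated by
`G ≥ 0`, on the event it is at most the constant `K`. -/
lemma avg_le_of_exceptional {F G : Dig d m → ℝ} {p : Dig d m → Prop} {K : ℝ}
    (hG : ∀ ω, 0 ≤ G ω) (hgood : ∀ ω, p ω → F ω ≤ G ω) (hbad : ∀ ω, F ω ≤ K) :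
    avg F ≤ avg G + K * prop fun ω => ¬ p ω := by
  unfold prop
  rw [← avg_const_mul, ← avg_add]
  refine avg_mono fun ω => ?_
  by_cases h : p ω
  · simpa [h] using hgood ω h
  · simpa [h] using (hbad ω).trans (le_add_of_nonneg_left (hG ω))

/-- An event holds overwhelmingly (with parameter `lam` and exponent `c`) if its complement has
proportion at most `m ^ c * 2 * exp (- lam ^ 2 / 2)`. Only polynomial losses in `m` occur when
polynomially many such events are intersected. -/
def Owp (lam : ℝ) (c : ℕ) (p : Dig d m → Prop) : Prop :=
  prop (fun ω => ¬ p ω) ≤ (m : ℝ) ^ c * (2 * Real.exp (-lam ^ 2 / 2))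

variable {lam : ℝ}

lemma Owp.imp {c : ℕ} {p p' : Dig d m → Prop} (h : Owp lam c p) (hp : ∀ ω, p ω → p' ω) :
    Owp lam c p' :=
  (prop_mono fun ω h1 h2 => h1 (hp ω h2)).trans h

lemma Owp.mono {c c' : ℕ} {p : Dig d m → Prop} (h : Owp lam c p) (hm : 1 ≤ m) (hc : c ≤ c') :
    Owp lam c' p :=
  h.trans (mul_le_mul_of_nonneg_right (pow_le_pow_right₀ (by exact_mod_cast hm) hc)
    (by positivity))

lemma Owp.of_forall {c : ℕ} {p : Dig d m → Prop} (h : ∀ ω, p ω) : Owp lam c p := by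
  unfold Owp prop
  simp only [h, not_true_eq_false, if_false, avg_const]
  positivity

lemma Owp.forall_mem {ι : Type*} {s : Finset ι} {a c : ℕ} {p : ι → Dig d m → Prop}
    (hs : (s.card : ℝ) ≤ (m : ℝ) ^ a) (h : ∀ i ∈ s, Owp lam c (p i)) :
    Owp lam (a + c) fun ω => ∀ i ∈ s, p i ω := by
  unfold Owp
  simp only [not_forall, exists_prop]
  refine (prop_exists_le s _).trans ((Finset.sum_le_sum h).trans ?_)
  rw [Finset.sum_const, nsmul_eq_mul, pow_add, mul_assoc]
  exact mul_le_mul_of_nonneg_right hs (by positivity)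

lemma Owp.and {c c' : ℕ} {p p' : Dig d m → Prop} (hm : 2 ≤ m) (h : Owp lam c p)
    (h' : Owp lam c' p') : Owp lam (max c c' + 1) fun ω => p ω ∧ p' ω := by
  have h1 := h.mono (by omega) (le_max_left c c')
  have h2 := h'.mono (by omega) (le_max_right c c')
  unfold Owp at *
  simp only [not_and_or]
  refine (prop_or_le _ _).trans ((add_le_add h1 h2).trans ?_)
  have hm' : (2 : ℝ) ≤ m := by exact_mod_cast hm
  rw [← two_mul, pow_succ (m : ℝ)]
  have : 0 ≤ (m : ℝ) ^ max c c' * (2 * Real.exp (-lam ^ 2 / 2)) := by positivity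
  nlinarith

/-- `A` behaves like a Haar function of level `c` in the coordinate `j`: it does not depend on
finer digits of that coordinate, and changes sign with the digit `c`. -/
structure IsDiff (j : Fin d) (c : Fin m) (A : Dig d m → ℝ) : Prop where
  anti : ∀ ω, A (flipDigit j c ω) = -A ω
  inv : ∀ k, c < k → ∀ ω, A (flipDigit j k ω) = A ω

/-- `P` is determined by the digits of the coordinate `j` coarser than `c` (and all digits of the
other coordinates). -/
def InvFrom (j : Fin d) (c : Fin m) (P : Dig d m → ℝ) : Prop :=
  ∀ k, c ≤ k → ∀ ω, P (flipDigit j k ω) = P ω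

lemma IsDiff.mul_inv {j : Fin d} {c : Fin m} {A P : Dig d m → ℝ} (hA : IsDiff j c A)
    (hP : InvFrom j c P) : IsDiff j c fun ω => A ω * P ω :=
  ⟨fun ω => by simp [hA.anti, hP c le_rfl], fun k hk ω => by simp [hA.inv k hk, hP k hk.le]⟩

lemma IsDiff.sum {ι : Type*} {j : Fin d} {c : Fin m} {s : Finset ι} {A : ι → Dig d m → ℝ}
    (hA : ∀ i ∈ s, IsDiff j c (A i)) : IsDiff j c fun ω => ∑ i ∈ s, A i ω :=
  ⟨fun ω => by
    rw [← Finset.sum_neg_distrib]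
    exact Finset.sum_congr rfl fun i hi => (hA i hi).anti ω,
   fun k hk ω => Finset.sum_congr rfl fun i hi => (hA i hi).inv k hk ω⟩

lemma InvFrom.sum {ι : Type*} {j : Fin d} {c : Fin m} {s : Finset ι} {A : ι → Dig d m → ℝ}
    (hA : ∀ i ∈ s, InvFrom j c (A i)) : InvFrom j c fun ω => ∑ i ∈ s, A i ω :=
  fun k hk ω => Finset.sum_congr rfl fun i hi => hA i hi k hk ω

lemma InvFrom.prod {ι : Type*} {j : Fin d} {c : Fin m} {s : Finset ι} {A : ι → Dig d m → ℝ}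
    (hA : ∀ i ∈ s, InvFrom j c (A i)) : InvFrom j c fun ω => ∏ i ∈ s, A i ω :=
  fun k hk ω => Finset.prod_congr rfl fun i hi => hA i hi k hk ω

/-- The exponential supermartingale inequality for dyadic martingales: the modulus of each
difference is predictable, so the exponent is compensated by the square function itself. -/
lemma avg_exp_le_one (j : Fin d) (A : Fin m → Dig d m → ℝ) (θ : ℝ) (C : Finset (Fin m))
    (hA : ∀ c ∈ C, IsDiff j c (A c)) :
    avg (fun ω => Real.exp (θ * ∑ c ∈ C, A c ω - θ ^ 2 / 2 * ∑ c ∈ C, A c ω ^ 2)) ≤ 1 := by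
  induction C using Finset.induction_on_max with
  | empty => simp [avg_const]
  | insert a s ha ih =>
    have has : a ∉ s := fun h => lt_irrefl _ (ha a h)
    set G : Dig d m → ℝ := fun ω =>
      Real.exp (θ * ∑ c ∈ s, A c ω - θ ^ 2 / 2 * ∑ c ∈ s, A c ω ^ 2) with hG
    have hs : ∀ c ∈ s, IsDiff j c (A c) := fun c hc => hA c (Finset.mem_insert_of_mem hc)
    have hGinv : ∀ ω, G (flipDigit j a ω) = G ω := by
      intro ω
      have : ∀ c ∈ s, A c (flipDigit j a ω) = A c ω := fun c hc => (hs c hc).inv a (ha c hc) ω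
      simp only [hG]
      have h2 : ∀ c ∈ s, A c (flipDigit j a ω) ^ 2 = A c ω ^ 2 := fun c hc => by rw [this c hc]
      rw [Finset.sum_congr rfl this, Finset.sum_congr rfl h2]
    set F : Dig d m → ℝ := fun ω =>
      Real.exp (θ * ∑ c ∈ insert a s, A c ω - θ ^ 2 / 2 * ∑ c ∈ insert a s, A c ω ^ 2) with hF
    have hFG : ∀ ω, F ω = G ω * Real.exp (θ * A a ω - θ ^ 2 / 2 * A a ω ^ 2) := by
      intro ω
      simp only [hF, hG, Finset.sum_insert has, ← Real.exp_add]
      congr 1; ring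
    have hbound : ∀ ω, F ω + F (flipDigit j a ω) ≤ 2 * G ω := by
      intro ω
      rw [hFG, hFG, hGinv, (hA a (Finset.mem_insert_self _ _)).anti, ← mul_add, mul_comm]
      refine mul_le_mul_of_nonneg_right ?_ (Real.exp_pos _).le
      have h1 := Real.cosh_le_exp_half_sq (θ * A a ω)
      rw [Real.cosh_eq] at h1
      have e1 : Real.exp (θ * A a ω - θ ^ 2 / 2 * A a ω ^ 2)
          = Real.exp (θ * A a ω) * Real.exp (-((θ * A a ω) ^ 2 / 2)) := by
        rw [← Real.exp_add]; congr 1; ring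
      have e2 : Real.exp (θ * -A a ω - θ ^ 2 / 2 * (-A a ω) ^ 2)
          = Real.exp (-(θ * A a ω)) * Real.exp (-((θ * A a ω) ^ 2 / 2)) := by
        rw [← Real.exp_add]; congr 1; ring
      rw [e1, e2, ← add_mul]
      have h2 : Real.exp (θ * A a ω) + Real.exp (-(θ * A a ω))
          ≤ 2 * Real.exp ((θ * A a ω) ^ 2 / 2) := by linarith
      calc _ ≤ 2 * Real.exp ((θ * A a ω) ^ 2 / 2) * Real.exp (-((θ * A a ω) ^ 2 / 2)) :=
            mul_le_mul_of_nonneg_right h2 (Real.exp_pos _).le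
        _ = 2 := by rw [mul_assoc, ← Real.exp_add]; simp
    have h2 : avg F + avg F ≤ 2 * avg G := by
      nth_rewrite 2 [← avg_flipDigit j a F]
      rw [← avg_add, ← avg_const_mul]
      exact avg_mono hbound
    have := ih hs
    change avg G ≤ 1 at this
    change avg F ≤ 1
    linarith

/-- Subgaussian deviation of a dyadic martingale in terms of a bound for its square function. -/
lemma owp_abs_sum_le (j : Fin d) (A : Fin m → Dig d m → ℝ) (C : Finset (Fin m))
    (hA : ∀ c ∈ C, IsDiff j c (A c)) {β : ℝ} (hβ : 0 < β) (hlam : 0 ≤ lam) :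
    Owp lam 0 fun ω => ∑ c ∈ C, A c ω ^ 2 ≤ β ^ 2 → |∑ c ∈ C, A c ω| ≤ lam * β := by
  classical
  unfold Owp
  set θ : ℝ := lam / β with hθ
  have hθ0 : 0 ≤ θ := div_nonneg hlam hβ.le
  have h1 := avg_exp_le_one j A θ C hA
  have h2 := avg_exp_le_one j A (-θ) C hA
  set F : Dig d m → ℝ := fun ω => Real.exp (-lam ^ 2 / 2) *
      (Real.exp (θ * ∑ c ∈ C, A c ω - θ ^ 2 / 2 * ∑ c ∈ C, A c ω ^ 2) +
       Real.exp (-θ * ∑ c ∈ C, A c ω - (-θ) ^ 2 / 2 * ∑ c ∈ C, A c ω ^ 2)) with hF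
  have hF0 : ∀ ω, 0 ≤ F ω := fun ω =>
    mul_nonneg (Real.exp_pos _).le (add_nonneg (Real.exp_pos _).le (Real.exp_pos _).le)
  refine (prop_le_avg hF0 ?_).trans ?_
  · intro ω h
    rw [Classical.not_imp, not_le] at h
    obtain ⟨hQ, hS⟩ := h
    simp only [hF]
    have hθβ : θ * β = lam := by rw [hθ]; field_simp
    have hq : θ ^ 2 / 2 * ∑ c ∈ C, A c ω ^ 2 ≤ lam ^ 2 / 2 := by
      calc _ ≤ θ ^ 2 / 2 * β ^ 2 := mul_le_mul_of_nonneg_left hQ (by positivity)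
        _ = lam ^ 2 / 2 := by rw [← hθβ]; ring
    have hl : θ * (lam * β) = lam ^ 2 := by rw [← hθβ]; ring
    rcases lt_abs.1 hS with h' | h'
    · have : lam ^ 2 ≤ θ * ∑ c ∈ C, A c ω := by
        rw [← hl]; exact mul_le_mul_of_nonneg_left h'.le hθ0
      rw [mul_add, ← Real.exp_add, ← Real.exp_add]
      refine le_add_of_le_of_nonneg (Real.one_le_exp ?_) (Real.exp_pos _).le
      linarith
    · have : lam ^ 2 ≤ -θ * ∑ c ∈ C, A c ω := by
        rw [← hl, neg_mul, ← mul_neg]; exact mul_le_mul_of_nonneg_left h'.le hθ0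
      rw [mul_add, ← Real.exp_add, ← Real.exp_add]
      refine le_add_of_nonneg_of_le (Real.exp_pos _).le (Real.one_le_exp ?_)
      rw [neg_sq]
      linarith
  · simp only [hF]
    rw [avg_const_mul, avg_add, pow_zero, one_mul, mul_comm 2]
    exact mul_le_mul_of_nonneg_left (by linarith) (Real.exp_pos _).le

end Avg

/-! ### Hyperbolic sums of Haar-type functions -/

/-- A family of `±1`-valued functions indexed by level vectors, the function with index `r` being
a signed sum of all Haar functions on dyadic boxes with side lengths `2 ^ (- r j)`. -/
structure IsHaarFamily {d m : ℕ} (f : (Fin d → Fin m) → Dig d m → ℝ) : Prop where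
  anti : ∀ r j ω, f r (flipDigit j (r j) ω) = -f r ω
  inv : ∀ r j k, r j < k → ∀ ω, f r (flipDigit j k ω) = f r ω
  sq : ∀ r ω, f r ω ^ 2 = 1

/-- The level vectors with coordinate sum `n` in a product set. -/
def levels {d m : ℕ} (n : ℕ) (J : Fin d → Finset (Fin m)) : Finset (Fin d → Fin m) :=
  (Fintype.piFinset J).filter fun r => ∑ j, (r j : ℕ) = n

/-- The sum of the members of a family over the level vectors of a product set with coordinate
sum `n`. -/
noncomputable def hyp {d m : ℕ} (n : ℕ) (f : (Fin d → Fin m) → Dig d m → ℝ)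
    (J : Fin d → Finset (Fin m)) (ω : Dig d m) : ℝ :=
  ∑ r ∈ levels n J, f r ω

section Hyp

variable {d m n : ℕ} {f : (Fin d → Fin m) → Dig d m → ℝ}

lemma mem_levels {J : Fin d → Finset (Fin m)} {r : Fin d → Fin m} :
    r ∈ levels n J ↔ (∀ j, r j ∈ J j) ∧ ∑ j, (r j : ℕ) = n := by
  simp [levels]

lemma IsHaarFamily.abs_eq (hf : IsHaarFamily f) (r : Fin d → Fin m) (ω : Dig d m) :
    |f r ω| = 1 := by
  simpa using (sq_eq_sq_iff_abs_eq_abs (f r ω) 1).1 (by simp [hf.sq])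

lemma eq_of_sum_eq_of_ne {r r' : Fin d → Fin m} (w : Fin d)
    (hs : ∑ j, (r j : ℕ) = ∑ j, (r' j : ℕ)) (h : ∀ j, j ≠ w → r j = r' j) : r = r' := by
  have h1 : ∑ j ∈ Finset.univ.erase w, (r j : ℕ) = ∑ j ∈ Finset.univ.erase w, (r' j : ℕ) :=
    Finset.sum_congr rfl fun j hj => by rw [h j (Finset.ne_of_mem_erase hj)]
  rw [← Finset.add_sum_erase _ _ (Finset.mem_univ w),
    ← Finset.add_sum_erase _ (fun j => (r' j : ℕ)) (Finset.mem_univ w), h1] at hs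
  funext j
  by_cases hj : j = w
  · subst hj; exact Fin.ext (by omega)
  · exact h j hj

/-- Since the coordinate sum is prescribed, one free coordinate leaves at most one level vector. This
is why a hyperbolic sum with `k` free coordinates has about `m ^ (k - 1)` terms. -/
lemma card_levels_le_one {J : Fin d → Finset (Fin m)} (w : Fin d)
    (h : ∀ j, j ≠ w → (J j).card ≤ 1) : (levels n J).card ≤ 1 := by
  rw [Finset.card_le_one]
  intro r hr r' hr'
  rw [mem_levels] at hr hr'
  exact eq_of_sum_eq_of_ne w (hr.2.trans hr'.2.symm) fun j hj =>
    Finset.card_le_one.1 (h j hj) _ (hr.1 j) _ (hr'.1 j)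

lemma levels_filter_eq (J : Fin d → Finset (Fin m)) (w : Fin d) (E : Finset (Fin m)) {e : Fin m}
    (he : e ∈ E) : (levels n (Function.update J w E)).filter (fun r => r w = e)
      = levels n (Function.update J w {e}) := by
  ext r
  simp only [Finset.mem_filter, mem_levels]
  constructor
  · rintro ⟨⟨h1, h2⟩, h3⟩
    refine ⟨fun j => ?_, h2⟩
    by_cases hj : j = w
    · subst hj; simp [h3]
    · simpa [hj] using h1 j
  · rintro ⟨h1, h2⟩
    have hw : r w = e := by simpa using h1 w
    refine ⟨⟨fun j => ?_, h2⟩, hw⟩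
    by_cases hj : j = w
    · subst hj; simpa [hw] using he
    · simpa [hj] using h1 j

lemma hyp_update (J : Fin d → Finset (Fin m)) (w : Fin d) (E : Finset (Fin m)) (ω : Dig d m) :
    hyp n f (Function.update J w E) ω = ∑ e ∈ E, hyp n f (Function.update J w {e}) ω := by
  unfold hyp
  rw [← Finset.sum_fiberwise_of_maps_to (s := levels n (Function.update J w E)) (t := E)
    (g := fun r => r w)]
  · exact Finset.sum_congr rfl fun e he => by rw [levels_filter_eq J w E he]
  · intro r hr
    simpa using (mem_levels.1 hr).1 w

lemma hyp_eq_sum (J : Fin d → Finset (Fin m)) (w : Fin d) (ω : Dig d m) :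
    hyp n f J ω = ∑ e ∈ J w, hyp n f (Function.update J w {e}) ω := by
  rw [← hyp_update, Function.update_eq_self]

lemma card_levels_eq_sum (J : Fin d → Finset (Fin m)) (w : Fin d) :
    (levels n J).card = ∑ e ∈ J w, (levels n (Function.update J w {e})).card := by
  rw [Finset.card_eq_sum_card_fiberwise (f := fun r => r w) (t := J w)]
  · refine Finset.sum_congr rfl fun e he => ?_
    rw [← levels_filter_eq J w (J w) he, Function.update_eq_self]
  · intro r hr
    exact (mem_levels.1 hr).1 w

/-- With its level in the coordinate `w` fixed to be `e`, a hyperbolic sum is a martingale difference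
in that coordinate. This is what makes the sum over `e` accessible to `owp_abs_sum_le`. -/
lemma hyp_isDiff (hf : IsHaarFamily f) {J : Fin d → Finset (Fin m)} {w : Fin d} {e : Fin m}
    (hJ : J w = {e}) : IsDiff w e (hyp n f J) := by
  refine IsDiff.sum fun r hr => ?_
  have : r w = e := by simpa [hJ] using (mem_levels.1 hr).1 w
  subst this
  exact ⟨hf.anti r w, hf.inv r w⟩

lemma hyp_invFrom (hf : IsHaarFamily f) {J : Fin d → Finset (Fin m)} {w : Fin d} {c : Fin m}
    (hJ : ∀ e ∈ J w, e < c) : InvFrom w c (hyp n f J) :=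
  InvFrom.sum fun r hr k hk ω => hf.inv r w k ((hJ _ ((mem_levels.1 hr).1 w)).trans_le hk) ω

lemma abs_hyp_le_card (hf : IsHaarFamily f) (J : Fin d → Finset (Fin m)) (ω : Dig d m) :
    |hyp n f J ω| ≤ (levels n J).card := by
  refine (Finset.abs_sum_le_sum_abs _ _).trans ?_
  simp [hf.abs_eq]

lemma abs_hyp_le_one (hf : IsHaarFamily f) {J : Fin d → Finset (Fin m)} (w : Fin d)
    (h : ∀ j, j ≠ w → (J j).card ≤ 1) (ω : Dig d m) : |hyp n f J ω| ≤ 1 :=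
  (abs_hyp_le_card hf J ω).trans (by exact_mod_cast card_levels_le_one w h)

lemma sum_sq_hyp_le_one (hf : IsHaarFamily f) {J : Fin d → Finset (Fin m)} (v w : Fin d)
    (h : ∀ j, j ≠ v → (J j).card ≤ 1) (ω : Dig d m) :
    ∑ e ∈ J w, hyp n f (Function.update J w {e}) ω ^ 2 ≤ 1 := by
  have key : ∀ e ∈ J w, hyp n f (Function.update J w {e}) ω ^ 2
      ≤ ((levels n (Function.update J w {e})).card : ℝ) := by
    intro e he
    have hc : (levels n (Function.update J w {e})).card ≤ 1 := by
      refine card_levels_le_one v fun j hj => ?_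
      by_cases hjw : j = w
      · subst hjw; simp
      · simpa [hjw] using h j hj
    have h1 := abs_hyp_le_card hf (n := n) (Function.update J w {e}) ω
    rw [← sq_abs]
    have hc' : ((levels n (Function.update J w {e})).card : ℝ) ≤ 1 := by exact_mod_cast hc
    nlinarith [abs_nonneg (hyp n f (Function.update J w {e}) ω)]
  refine (Finset.sum_le_sum key).trans ?_
  rw [← Nat.cast_sum, ← card_levels_eq_sum]
  exact_mod_cast card_levels_le_one v h

variable {lam : ℝ}

lemma sum_sq_le_of_abs_le {ι : Type*} {s : Finset ι} {A : ι → ℝ} {M b : ℝ}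
    (hs : (s.card : ℝ) ≤ M) (hb : ∀ i ∈ s, |A i| ≤ b) : ∑ i ∈ s, A i ^ 2 ≤ M * b ^ 2 := by
  calc ∑ i ∈ s, A i ^ 2 ≤ ∑ _i ∈ s, b ^ 2 := Finset.sum_le_sum fun i hi => by
        rw [← sq_abs]; exact pow_le_pow_left₀ (abs_nonneg _) (hb i hi) 2
    _ = s.card * b ^ 2 := by simp
    _ ≤ M * b ^ 2 := mul_le_mul_of_nonneg_right hs (sq_nonneg _)

lemma card_level_le (E : Finset (Fin m)) : (E.card : ℝ) ≤ (m : ℝ) ^ 1 := by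
  rw [pow_one]; exact_mod_cast (Finset.card_le_univ E).trans_eq (Fintype.card_fin m)

lemma dead_update {J : Fin d → Finset (Fin m)} {W : Finset (Fin d)} {w : Fin d} (e : Fin m)
    (hJ : ∀ j ∉ W, (J j).card ≤ 1) (j : Fin d) (hj : j ∉ W.erase w) :
    (Function.update J w {e} j).card ≤ 1 := by
  by_cases hjw : j = w
  · subst hjw; simp
  · simpa [hjw] using hJ j fun h => hj (Finset.mem_erase.2 ⟨hjw, h⟩)

/-- The square function in one coordinate of a hyperbolic sum with `k + 1` free coordinates is
overwhelmingly at most its expected order of magnitude `m ^ k`, up to powers of `lam`. The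
hypothesis `ih` is the bound for the sums with `k` free coordinates. -/
lemma owp_sum_sq_hyp_of {k : ℕ} (hf : IsHaarFamily f)
    (ih : ∀ (W : Finset (Fin d)) (J : Fin d → Finset (Fin m)), W.card = k →
      (∀ j ∉ W, (J j).card ≤ 1) →
      Owp lam (2 * k) fun ω => |hyp n f J ω| ≤ lam ^ k * √m ^ (k - 1))
    {W : Finset (Fin d)} {J : Fin d → Finset (Fin m)} (hW : W.card = k + 1)
    (hJ : ∀ j ∉ W, (J j).card ≤ 1) {w : Fin d} (hw : w ∈ W) :
    Owp lam (2 * k + 1) fun ω => ∑ e ∈ J w, hyp n f (Function.update J w {e}) ω ^ 2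
      ≤ (lam ^ k * √m ^ k) ^ 2 := by
  have hWe : (W.erase w).card = k := by rw [Finset.card_erase_of_mem hw, hW]; rfl
  rcases k with _ | k
  · refine Owp.of_forall fun ω => ?_
    have hW' : W.erase w = ∅ := Finset.card_eq_zero.1 hWe
    refine (sum_sq_hyp_le_one hf w w (fun j hj => hJ j fun h => ?_) ω).trans (by simp)
    have : j ∈ W.erase w := Finset.mem_erase.2 ⟨hj, h⟩
    rw [hW'] at this; simp at this
  · have h1 : Owp lam (1 + 2 * (k + 1)) fun ω => ∀ e ∈ J w,
        |hyp n f (Function.update J w {e}) ω| ≤ lam ^ (k + 1) * √m ^ (k + 1 - 1) :=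
      Owp.forall_mem (card_level_le _) fun e _ => ih _ _ hWe (dead_update e hJ)
    rw [add_comm]
    refine h1.imp fun ω hω => ?_
    refine (sum_sq_le_of_abs_le (card_level_le (J w)) hω).trans (le_of_eq ?_)
    have hs : √(m : ℝ) ^ 2 = m := Real.sq_sqrt (Nat.cast_nonneg m)
    nth_rewrite 1 [← hs]
    simp only [Nat.add_sub_cancel]
    ring

/-- A hyperbolic sum with `k` free coordinates is overwhelmingly of size `m ^ ((k - 1) / 2)`, up to
powers of `lam`. -/
theorem owp_abs_hyp_le (hf : IsHaarFamily f) (hlam : 1 ≤ lam) (hm : 2 ≤ m) (k : ℕ) :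
    ∀ (W : Finset (Fin d)) (J : Fin d → Finset (Fin m)), W.card = k →
      (∀ j ∉ W, (J j).card ≤ 1) →
      Owp lam (2 * k) fun ω => |hyp n f J ω| ≤ lam ^ k * √m ^ (k - 1) := by
  induction k with
  | zero =>
    intro W J hW hJ
    refine Owp.of_forall fun ω => ?_
    have hW' : W = ∅ := Finset.card_eq_zero.1 hW
    subst hW'
    simp only [pow_zero, mul_one, Nat.zero_sub]
    refine (abs_hyp_le_card hf J ω).trans ?_
    rw [Nat.cast_le_one, Finset.card_le_one]
    intro r hr r' hr'
    rw [mem_levels] at hr hr'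
    funext j
    exact Finset.card_le_one.1 (hJ j (by simp)) _ (hr.1 j) _ (hr'.1 j)
  | succ k ih =>
    intro W J hW hJ
    obtain ⟨w, hw⟩ : W.Nonempty := Finset.card_pos.1 (by omega)
    have h1 := owp_sum_sq_hyp_of hf ih hW hJ hw
    have h2 := owp_abs_sum_le (lam := lam) w (fun e => hyp n f (Function.update J w {e})) (J w)
      (fun e _ => hyp_isDiff hf (by simp))
      (β := lam ^ k * √m ^ k) (by positivity) (by linarith)
    refine ((h1.and hm h2).mono (by omega) (by simp; omega)).imp fun ω hω => ?_
    rw [hyp_eq_sum J w]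
    refine (hω.2 hω.1).trans (le_of_eq ?_)
    simp only [Nat.add_sub_cancel]
    ring

/-- The square function in one coordinate of a hyperbolic sum with `k + 1` free coordinates. -/
theorem owp_sum_sq_hyp_le (hf : IsHaarFamily f) (hlam : 1 ≤ lam) (hm : 2 ≤ m) {k : ℕ}
    {W : Finset (Fin d)} {J : Fin d → Finset (Fin m)} (hW : W.card = k + 1)
    (hJ : ∀ j ∉ W, (J j).card ≤ 1) {w : Fin d} (hw : w ∈ W) :
    Owp lam (2 * k + 1) fun ω => ∑ e ∈ J w, hyp n f (Function.update J w {e}) ω ^ 2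
      ≤ (lam ^ k * √m ^ k) ^ 2 :=
  owp_sum_sq_hyp_of hf (owp_abs_hyp_le hf hlam hm k) hW hJ hw

end Hyp

/-! ### The gain from coincidences of levels -/

section Gain

open Function (update)

/-- Expanding the square of a bilinear sum `∑ c, U c e * P c (b e)`, whose second factor depends on
`e` only through the block `b e`, into diagonal and off-diagonal contributions. -/
lemma sum_sq_bilinear_le {ι κ β : Type*} [DecidableEq β] [DecidableEq κ] {E : Finset ι}
    {C : Finset κ} {B : Finset β}
    {U : κ → ι → ℝ} {P : κ → β → ℝ} {b : ι → β} {p u g R : ℝ} (hb : ∀ e ∈ E, b e ∈ B)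
    (hp : 0 ≤ p) (hu : 0 ≤ u) (hg : 0 ≤ g) (hC : (C.card : ℝ) ≤ R)
    (hP : ∀ c ∈ C, ∀ e ∈ E, |P c (b e)| ≤ p)
    (hU : ∀ c ∈ C, ∑ e ∈ E, U c e ^ 2 ≤ u)
    (hG : ∀ c ∈ C, ∀ c' ∈ C, c ≠ c' → ∀ k ∈ B,
      |∑ e ∈ E.filter (fun e => b e = k), U c e * U c' e| ≤ g) :
    ∑ e ∈ E, (∑ c ∈ C, U c e * P c (b e)) ^ 2 ≤ p ^ 2 * (R * u + R ^ 2 * (B.card * g)) := by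
  have hR : 0 ≤ R := (Nat.cast_nonneg _).trans hC
  have h1 : ∀ c ∈ C, ∀ c' ∈ C, ∑ e ∈ E, (U c e * P c (b e)) * (U c' e * P c' (b e))
      ≤ (if c = c' then p ^ 2 * u else 0) + p ^ 2 * (B.card * g) := by
    intro c hc c' hc'
    by_cases hcc : c = c'
    · subst hcc
      rw [if_pos rfl]
      refine le_add_of_le_of_nonneg ?_ (by positivity)
      calc _ ≤ ∑ e ∈ E, p ^ 2 * U c e ^ 2 := by
            refine Finset.sum_le_sum fun e he => ?_
            have : P c (b e) ^ 2 ≤ p ^ 2 := by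
              rw [← sq_abs]; exact pow_le_pow_left₀ (abs_nonneg _) (hP c hc e he) 2
            nlinarith [sq_nonneg (U c e)]
        _ ≤ p ^ 2 * u := by
            rw [← Finset.mul_sum]; exact mul_le_mul_of_nonneg_left (hU c hc) (sq_nonneg _)
    · rw [if_neg hcc, zero_add, ← Finset.sum_fiberwise_of_maps_to hb]
      calc _ ≤ ∑ _k ∈ B, p ^ 2 * g := by
            refine Finset.sum_le_sum fun k hk => ?_
            have e1 : ∑ e ∈ E.filter (fun e => b e = k),
                (U c e * P c (b e)) * (U c' e * P c' (b e))
                = (P c k * P c' k) * ∑ e ∈ E.filter (fun e => b e = k), U c e * U c' e := by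
              rw [Finset.mul_sum]
              refine Finset.sum_congr rfl fun e he => ?_
              rw [(Finset.mem_filter.1 he).2]; ring
            rw [e1]
            by_cases hne : (E.filter (fun e => b e = k)).Nonempty
            · obtain ⟨e, he⟩ := hne
              obtain ⟨heE, rfl⟩ := Finset.mem_filter.1 he
              refine (le_abs_self _).trans ?_
              rw [abs_mul, abs_mul, sq]
              exact mul_le_mul (mul_le_mul (hP c hc e heE) (hP c' hc' e heE) (abs_nonneg _) hp)
                (hG c hc c' hc' hcc _ hk) (abs_nonneg _) (by positivity)
            · rw [Finset.not_nonempty_iff_eq_empty.1 hne]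
              simp only [Finset.sum_empty, mul_zero]
              positivity
        _ = p ^ 2 * (B.card * g) := by simp; ring
  calc ∑ e ∈ E, (∑ c ∈ C, U c e * P c (b e)) ^ 2
      = ∑ c ∈ C, ∑ c' ∈ C, ∑ e ∈ E, (U c e * P c (b e)) * (U c' e * P c' (b e)) := by
        simp only [sq, Finset.sum_mul_sum]
        rw [Finset.sum_comm]
        exact Finset.sum_congr rfl fun c _ => Finset.sum_comm
    _ ≤ ∑ c ∈ C, ∑ c' ∈ C, ((if c = c' then p ^ 2 * u else 0) + p ^ 2 * (B.card * g)) :=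
        Finset.sum_le_sum fun c hc => Finset.sum_le_sum fun c' hc' => h1 c hc c' hc'
    _ = p ^ 2 * (C.card * u + (C.card : ℝ) ^ 2 * (B.card * g)) := by
        simp only [Finset.sum_add_distrib, Finset.sum_const, nsmul_eq_mul, Finset.sum_ite_eq]
        rw [Finset.sum_congr rfl fun c hc => if_pos hc]
        simp only [Finset.sum_const, nsmul_eq_mul]
        ring
    _ ≤ p ^ 2 * (R * u + R ^ 2 * (B.card * g)) := by gcongr

lemma sum_mul_sum_eq_diag_add {α : Type*} [LinearOrder α] (E : Finset α) (u v : α → ℝ) :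
    (∑ e ∈ E, u e) * ∑ e ∈ E, v e = ∑ e ∈ E, u e * v e
      + ∑ e ∈ E, u e * ∑ e' ∈ E.filter (· < e), v e'
      + ∑ e ∈ E, v e * ∑ e' ∈ E.filter (· < e), u e' := by
  have h : ∑ e ∈ E, v e * ∑ e' ∈ E.filter (· < e), u e'
      = ∑ e ∈ E, u e * ∑ e' ∈ E.filter (e < ·), v e' := by
    simp only [Finset.sum_filter, Finset.mul_sum]
    rw [Finset.sum_comm]
    refine Finset.sum_congr rfl fun e _ => Finset.sum_congr rfl fun e' _ => ?_
    split_ifs <;> ring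
  rw [h, Finset.sum_mul, ← Finset.sum_add_distrib, ← Finset.sum_add_distrib]
  refine Finset.sum_congr rfl fun e he => ?_
  rw [← mul_add, ← mul_add]
  congr 1
  have : ∀ e' ∈ E, v e' = (if e' = e then v e' else 0) + (if e' < e then v e' else 0)
      + (if e < e' then v e' else 0) := by
    intro e' _
    rcases lt_trichotomy e' e with h | h | h
    · simp [h, h.ne, h.not_gt]
    · simp [h]
    · simp [h, h.ne', h.not_gt]
  rw [Finset.sum_congr rfl this, Finset.sum_add_distrib, Finset.sum_add_distrib,
    Finset.sum_filter, Finset.sum_filter, Finset.sum_ite_eq' E e, if_pos he]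

/-- The correlation over the levels of the coordinate `v` of two hyperbolic sums which have
different fixed levels `a ≠ a'` in the coordinate `i` and `k` further free coordinates is smaller
than the trivial bound `m ^ (k - 1) * R` by a power of `y`. The factor `m ^ (k - 1)` is written
`m ^ k / m` to cover `k = 0`. Each further free coordinate costs a square root of the gain, hence the
exponent `2 ^ (d - k)`; the levels of `v` range over a set of size at least `y ^ 2 ^ (d + 1)`. -/
def GainBound (d k : ℕ) : Prop :=
  ∃ c e : ℕ, ∀ (m n y : ℕ) (lam : ℝ) (f : (Fin d → Fin m) → Dig d m → ℝ), 2 ≤ m → 2 ≤ lam →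
    1 ≤ y → (y ^ 2 ^ (d + 1)) ^ 4 ≤ m → IsHaarFamily f →
    ∀ (W : Finset (Fin d)) (J : Fin d → Finset (Fin m)) (i v : Fin d) (a a' : Fin m)
      (C : Finset (Fin m)) (R : ℕ), W.card = k → i ∉ W → v ∉ W → i ≠ v →
      (∀ j ∉ W, j ≠ i → j ≠ v → (J j).card ≤ 1) → a ≠ a' → y ^ 2 ^ (d + 1) ≤ R → C.card ≤ R →
      Owp lam c fun ω => |∑ b ∈ C, hyp n f (update (update J i {a}) v {b}) ω
        * hyp n f (update (update J i {a'}) v {b}) ω|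
          ≤ lam ^ e * ((m : ℝ) ^ k / m) * R / (y : ℝ) ^ 2 ^ (d - k)

/-- The part with strictly decreasing levels in the coordinate `w` of a correlation over the
levels of the coordinate `v` is smaller than the trivial bound by a power of `y`. -/
def HalfBound (d k : ℕ) : Prop :=
  ∃ c e : ℕ, ∀ (m n y : ℕ) (lam : ℝ) (f : (Fin d → Fin m) → Dig d m → ℝ), 2 ≤ m → 2 ≤ lam →
    1 ≤ y → (y ^ 2 ^ (d + 1)) ^ 4 ≤ m → IsHaarFamily f →
    ∀ (W : Finset (Fin d)) (J J' : Fin d → Finset (Fin m)) (v w : Fin d)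
      (C : Finset (Fin m)) (R : ℕ), W.card = k → w ∈ W → v ∉ W →
      (∀ j ∉ W, j ≠ v → (J j).card ≤ 1) → (∀ j ∉ W, j ≠ v → (J' j).card ≤ 1) →
      y ^ 2 ^ (d + 1) ≤ R → C.card ≤ R →
      Owp lam c fun ω => |∑ l ∈ J w, ∑ b ∈ C, hyp n f (update (update J v {b}) w {l}) ω
        * hyp n f (update (update J' v {b}) w ((J' w).filter (· < l))) ω|
          ≤ lam ^ e * ((m : ℝ) ^ k / m) * R / (y : ℝ) ^ 2 ^ (d - k)

variable {d m n : ℕ} {f : (Fin d → Fin m) → Dig d m → ℝ}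

/-- Two level vectors with the same sum cannot differ in one coordinate only. -/
lemma hyp_mul_hyp_eq_zero {J J' : Fin d → Finset (Fin m)} {i : Fin d}
    (hi : Disjoint (J i) (J' i)) (hJ : ∀ j, j ≠ i → (J j).card ≤ 1)
    (h : ∀ j, j ≠ i → J j = J' j) (ω : Dig d m) : hyp n f J ω * hyp n f J' ω = 0 := by
  by_cases h1 : (levels n J).Nonempty
  · by_cases h2 : (levels n J').Nonempty
    · obtain ⟨r, hr⟩ := h1
      obtain ⟨r', hr'⟩ := h2
      rw [mem_levels] at hr hr'
      have : r = r' := eq_of_sum_eq_of_ne i (hr.2.trans hr'.2.symm) fun j hj =>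
        Finset.card_le_one.1 (hJ j hj) _ (hr.1 j) _ (by rw [h j hj]; exact hr'.1 j)
      subst this
      exact absurd (hr'.1 i) (Finset.disjoint_left.1 hi (hr.1 i))
    · simp [hyp, Finset.not_nonempty_iff_eq_empty.1 h2]
  · simp [hyp, Finset.not_nonempty_iff_eq_empty.1 h1]

lemma gainBound_zero (d : ℕ) : GainBound d 0 := by
  refine ⟨0, 0, ?_⟩
  intro m n y lam f hm hlam hy hL hf W J i v a a' C R hW hi hv hiv hJ ha hR hC
  refine Owp.of_forall fun ω => ?_
  rw [Finset.sum_eq_zero, abs_zero]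
  · positivity
  · intro b _
    have hW' : W = ∅ := Finset.card_eq_zero.1 hW
    refine hyp_mul_hyp_eq_zero (i := i) ?_ ?_ ?_ ω
    · simpa [Function.update_apply, hiv] using ha
    · intro j hj
      by_cases hjv : j = v
      · subst hjv; simp
      · simpa [hj, hjv] using hJ j (by simp [hW']) hj hjv
    · intro j hj
      by_cases hjv : j = v
      · subst hjv; simp
      · simp [hj, hjv]

/-- Without further free coordinates the correlations of the columns `b ≠ b'` vanish, and the
martingale in the coordinate `w` saves the square root of the number of columns. -/
lemma halfBound_one (d : ℕ) : HalfBound d 1 := by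
  refine ⟨0, 1, ?_⟩
  intro m n y lam f hm hlam hy hL hf W J J' v w C R hW hw hv hJ hJ' hR hC
  obtain ⟨w', rfl⟩ := Finset.card_eq_one.1 hW
  obtain rfl : w = w' := by simpa using hw
  have hvw : v ≠ w := by simpa using hv
  have hy1 : (1 : ℝ) ≤ y := by exact_mod_cast hy
  have hR0 : (0 : ℝ) < R := by
    have : 0 < y ^ 2 ^ (d + 1) := by positivity
    exact_mod_cast this.trans_le hR
  have hdead : ∀ (I : Fin d → Finset (Fin m)) (b : Fin m) (l : Finset (Fin m)),
      (∀ j ∉ ({w} : Finset (Fin d)), j ≠ v → (I j).card ≤ 1) → ∀ j, j ≠ w →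
      (update (update I v {b}) w l j).card ≤ 1 := by
    intro I b l hI j hj
    by_cases hjv : j = v
    · subst hjv; simp [hj]
    · simpa [hj, hjv] using hI j (by simpa using hj) hjv
  have h := owp_abs_sum_le (lam := lam) w (fun l ω => ∑ b ∈ C,
    hyp n f (update (update J v {b}) w {l}) ω
        * hyp n f (update (update J' v {b}) w ((J' w).filter (· < l))) ω) (J w)
    (fun l _ => IsDiff.sum fun b _ => (hyp_isDiff hf (by simp)).mul_inv
      (hyp_invFrom hf (by simp))) (β := √R) (by positivity) (by linarith)
  refine h.imp fun ω hω => ?_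
  refine (hω ?_).trans ?_
  · rw [Real.sq_sqrt hR0.le]
    have h2 := sum_sq_bilinear_le (E := J w) (C := C) (B := Finset.univ) (b := id)
      (U := fun b l => hyp n f (update (update J v {b}) w {l}) ω)
      (P := fun b l => hyp n f (update (update J' v {b}) w ((J' w).filter (· < l))) ω)
      (p := 1) (u := 1) (g := 0) (R := R) (fun _ _ => Finset.mem_univ _) zero_le_one zero_le_one
      le_rfl (by exact_mod_cast hC) ?_ ?_ ?_
    · simpa using h2
    · intro b _ l _
      exact abs_hyp_le_one hf w (hdead J' b _ hJ') ω
    · intro b _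
      have := sum_sq_hyp_le_one hf (n := n) w w (J := update J v {b}) (fun j hj => by
        by_cases hjv : j = v
        · subst hjv; simp
        · simpa [hjv] using hJ j (by simpa using hj) hjv) ω
      simpa [hvw.symm] using this
    · intro b _ b' _ hbb k _
      rw [Finset.sum_eq_zero, abs_zero]
      intro l _
      refine hyp_mul_hyp_eq_zero (i := v) ?_ ?_ ?_ ω
      · simpa [Function.update_apply, hvw] using hbb
      · intro j hj
        by_cases hjw : j = w
        · subst hjw; simp
        · simpa [hj, hjw] using hJ j (by simpa using hjw) hj
      · intro j hj
        by_cases hjw : j = w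
        · subst hjw; simp
        · simp [hj, hjw]
  · have hm0 : (m : ℝ) ≠ 0 := by positivity
    have hT : (y : ℝ) ^ 2 ^ (d - 1) ≤ √R := by
      refine Real.le_sqrt_of_sq_le ?_
      rw [← pow_mul, ← pow_succ]
      refine le_trans (pow_le_pow_right₀ hy1 (Nat.pow_le_pow_right (by norm_num) ?_))
        (by exact_mod_cast hR : (y : ℝ) ^ 2 ^ (d + 1) ≤ R)
      omega
    have hT0 : (0 : ℝ) < (y : ℝ) ^ 2 ^ (d - 1) := by positivity
    rw [pow_one, pow_one, div_self hm0, mul_one, mul_div_assoc]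
    refine mul_le_mul_of_nonneg_left ?_ (by linarith)
    rw [le_div_iff₀ hT0]
    calc √R * (y : ℝ) ^ 2 ^ (d - 1) ≤ √R * √R := by gcongr
      _ = R := Real.mul_self_sqrt hR0.le

end Gain

section Gain

open Function (update)

lemma card_block_le {m L : ℕ} (hL : 0 < L) (E : Finset (Fin m)) (β : ℕ) :
    (E.filter fun l : Fin m => (l : ℕ) / L = β).card ≤ L := by
  have h : (E.filter fun l : Fin m => (l : ℕ) / L = β).image (fun l : Fin m => (l : ℕ))
      ⊆ Finset.Ico (L * β) (L * β + L) := by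
    intro x hx
    obtain ⟨l, hl, rfl⟩ := Finset.mem_image.1 hx
    have := (Finset.mem_filter.1 hl).2
    rw [Finset.mem_Ico, ← this]
    exact ⟨Nat.mul_div_le _ _, Nat.lt_mul_div_succ _ hL⟩
  have h2 := Finset.card_le_card h
  rwa [Finset.card_image_of_injective _ Fin.val_injective, Nat.card_Ico,
    Nat.add_sub_cancel_left] at h2

lemma card_part_block_le {m L : ℕ} (hL : 0 < L) (E : Finset (Fin m)) (l : Fin m) :
    (E.filter fun l' : Fin m => L * ((l : ℕ) / L) ≤ l' ∧ l' < l).card ≤ L := by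
  refine (Finset.card_le_card ?_).trans (card_block_le hL E ((l : ℕ) / L))
  intro l' hl'
  obtain ⟨h1, h2, h3⟩ := Finset.mem_filter.1 hl'
  refine Finset.mem_filter.2 ⟨h1, ?_⟩
  have h3' : (l' : ℕ) < l := h3
  apply le_antisymm (Nat.div_le_div_right h3'.le)
  rw [Nat.le_div_iff_mul_le hL, mul_comm]
  exact h2

/-- Numerical bookkeeping for the main part of `halfBound_add_two`. -/
lemma half_main_aux {lam s R L N T : ℝ} {K e0 : ℕ} (hlam : 2 ≤ lam) (hT : 1 ≤ T)
    (hLR : L ≤ R) (hL : T ^ 2 ≤ L) (hN : N * L ≤ 2 * s ^ 2) :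
    (lam ^ (K + 2) * s ^ (K + 1)) ^ 2 * (R * (lam ^ (K + 1) * s ^ (K + 1)) ^ 2
      + R ^ 2 * (N * (lam ^ e0 * (s ^ 2) ^ K * L / T ^ 2)))
      ≤ (lam ^ (2 * K + 5 + e0) * (s ^ 2) ^ (K + 1) * R / T) ^ 2 := by
  have hT0 : 0 < T := by linarith
  have hL0 : 0 < L := lt_of_lt_of_le (by positivity) hL
  have hR0 : 0 < R := by linarith
  have h1 : R ≤ R ^ 2 / T ^ 2 := by
    rw [le_div_iff₀ (by positivity), sq R]
    exact mul_le_mul_of_nonneg_left (hL.trans hLR) hR0.le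
  have hl1 : 1 ≤ lam := by linarith
  have e1 : lam ^ (2 * K + 2) ≤ lam ^ (2 * K + 4 + e0) := pow_le_pow_right₀ hl1 (by omega)
  have e2 : lam ^ e0 ≤ lam ^ (2 * K + 3 + e0) := pow_le_pow_right₀ hl1 (by omega)
  have e3 : lam ^ (2 * K + 4 + e0) = lam ^ (2 * K + 3 + e0) * lam := by
    rw [← pow_succ]; congr 1; omega
  have e4 : lam ^ (2 * K + 5 + e0) = lam ^ (2 * K + 4 + e0) * lam := by
    rw [← pow_succ]; congr 1; omega
  have e5 : lam ^ (2 * K + 2) + 2 * lam ^ e0 ≤ lam ^ (2 * K + 6 + 2 * e0) := by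
    have : lam ^ (2 * K + 5 + e0) ≤ lam ^ (2 * K + 6 + 2 * e0) :=
      pow_le_pow_right₀ hl1 (by omega)
    have p3 : 0 < lam ^ (2 * K + 3 + e0) := by positivity
    have p4 : 0 < lam ^ (2 * K + 4 + e0) := by positivity
    have q1 : 2 * lam ^ (2 * K + 3 + e0) ≤ lam ^ (2 * K + 4 + e0) := by rw [e3]; nlinarith
    have q2 : 2 * lam ^ (2 * K + 4 + e0) ≤ lam ^ (2 * K + 5 + e0) := by rw [e4]; nlinarith
    linarith
  calc _ ≤ (lam ^ (K + 2) * s ^ (K + 1)) ^ 2 * (R ^ 2 / T ^ 2 * (lam ^ (K + 1) * s ^ (K + 1)) ^ 2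
      + R ^ 2 * ((2 * s ^ 2) * (lam ^ e0 * (s ^ 2) ^ K / T ^ 2))) := by
        have : N * (lam ^ e0 * (s ^ 2) ^ K * L / T ^ 2) = (N * L) * (lam ^ e0 * (s ^ 2) ^ K / T ^ 2) := by
          ring
        rw [this]
        gcongr
    _ = (lam ^ (2 * K + 4) * (lam ^ (2 * K + 2) + 2 * lam ^ e0)) * ((s ^ 2) ^ (K + 1) * R / T) ^ 2 := by
        field_simp
        ring
    _ ≤ (lam ^ (2 * K + 4) * lam ^ (2 * K + 6 + 2 * e0)) * ((s ^ 2) ^ (K + 1) * R / T) ^ 2 := by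
        gcongr
    _ = _ := by
        rw [← pow_add]
        have : lam ^ (2 * K + 4 + (2 * K + 6 + 2 * e0)) = (lam ^ (2 * K + 5 + e0)) ^ 2 := by
          rw [← pow_mul]; congr 1; ring
        rw [this]; ring

/-- Numerical bookkeeping for the part of `halfBound_add_two` with both levels in one block. -/
lemma half_near_aux {lam s R L T : ℝ} {K e0 : ℕ} (hlam : 2 ≤ lam) (hs : 0 ≤ s) (hT : 1 ≤ T)
    (hR : 0 ≤ R) (hL0 : 0 ≤ L) (hL : T * L ≤ s) :
    s ^ 2 * (R * ((lam ^ (K + 1) * s ^ K) * (L * (lam ^ (K + 1) * s ^ K)))) ^ 2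
      ≤ (lam ^ (2 * K + 5 + e0) * (s ^ 2) ^ (K + 1) * R / T) ^ 2 := by
  have hT0 : 0 < T := by linarith
  have hl1 : 1 ≤ lam := by linarith
  have e1 : lam ^ (2 * K + 2) ≤ lam ^ (2 * K + 5 + e0) := pow_le_pow_right₀ hl1 (by omega)
  have h1 : L ≤ s / T := by rw [le_div_iff₀ hT0]; linarith
  have : s ^ 2 * (R * ((lam ^ (K + 1) * s ^ K) * (L * (lam ^ (K + 1) * s ^ K)))) ^ 2
      = (lam ^ (2 * K + 2) * (s * (s ^ 2) ^ K * R) * L) ^ 2 := by ring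
  rw [this]
  have h2 : lam ^ (2 * K + 5 + e0) * (s ^ 2) ^ (K + 1) * R / T
      = lam ^ (2 * K + 5 + e0) * (s * (s ^ 2) ^ K * R) * (s / T) := by ring
  rw [h2]
  gcongr

/-- The sum over the larger level `l` is a martingale in the coordinate `w`, so its square function
has to be bounded. The smaller level is split according to whether it lies in the block of length
`y ^ 2 ^ (d + 1)` containing `l`. Those in the same block are few. The sum over those in earlier
blocks depends on `l` only through its block, and is therefore a common factor when the square is
expanded into pairs of columns `b`, `b'`: the diagonal pairs are few, and the off-diagonal ones are
correlations over the levels of one block, to which the gain for `K + 1` free coordinates applies. -/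
theorem halfBound_add_two {d K : ℕ} (hKd : K + 2 ≤ d) (hG : GainBound d (K + 1)) :
    HalfBound d (K + 2) := by
  obtain ⟨c0, e0, hG⟩ := hG
  refine ⟨2 * K + c0 + 20, 2 * K + 7 + e0, ?_⟩
  intro m n y lam f hm hlam hy hLm hf W J J' v w C R hW hw hv hJ hJ' hR hC
  set L : ℕ := y ^ 2 ^ (d + 1) with hLdef
  have hL0 : 0 < L := by positivity
  have hvw : v ≠ w := fun h => hv (h ▸ hw)
  have hm1 : 1 ≤ m := by omega
  have hlam1 : 1 ≤ lam := by linarith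
  have hWe : (W.erase w).card = K + 1 := by rw [Finset.card_erase_of_mem hw, hW]; rfl
  -- `T` is the gain in the conclusion, its square the gain available from `GainBound`
  set T : ℝ := (y : ℝ) ^ 2 ^ (d - (K + 2)) with hT
  have hy1 : (1 : ℝ) ≤ y := by exact_mod_cast hy
  have hT1 : 1 ≤ T := one_le_pow₀ hy1
  have hT0 : 0 < T := by linarith
  have hT2 : (y : ℝ) ^ 2 ^ (d - (K + 1)) = T ^ 2 := by
    rw [hT, ← pow_mul, ← pow_succ]; congr 2; omega
  have hT2L : T ^ 2 ≤ L := by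
    rw [← hT2, hLdef]; push_cast
    exact pow_le_pow_right₀ hy1 (Nat.pow_le_pow_right (by norm_num) (by omega))
  set s : ℝ := √m with hs
  have hs0 : 0 ≤ s := Real.sqrt_nonneg _
  have hss : s ^ 2 = m := Real.sq_sqrt (Nat.cast_nonneg m)
  have hLs : (L : ℝ) ^ 2 ≤ s := by
    refine Real.le_sqrt_of_sq_le ?_
    rw [← pow_mul]; exact_mod_cast hLm
  have hTL : T * L ≤ s := by
    refine le_trans ?_ hLs
    rw [sq]
    exact mul_le_mul_of_nonneg_right (by nlinarith) (Nat.cast_nonneg _)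
  have hLR : (L : ℝ) ≤ R := by exact_mod_cast hR
  have hR0 : (0 : ℝ) < R := lt_of_lt_of_le (by exact_mod_cast hL0) hLR
  have hCm : (C.card : ℝ) ≤ (m : ℝ) ^ 1 := card_level_le C
  have hLm' : L ≤ m := le_trans (by nlinarith [Nat.pow_le_pow_right hL0 (show 1 ≤ 4 by norm_num)]) hLm
  -- the dead coordinates
  have dead1 : ∀ (I : Fin d → Finset (Fin m)) (b : Fin m), (∀ j ∉ W, j ≠ v → (I j).card ≤ 1) →
      ∀ j ∉ W, (update I v {b} j).card ≤ 1 := by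
    intro I b hI j hj
    by_cases hjv : j = v
    · subst hjv; simp
    · simpa [hjv] using hI j hj hjv
  have dead2 : ∀ (I : Fin d → Finset (Fin m)) (b : Fin m) (l : Finset (Fin m)),
      (∀ j ∉ W, j ≠ v → (I j).card ≤ 1) →
      ∀ j ∉ W, (update (update I v {b}) w l j).card ≤ 1 := by
    intro I b l hI j hj
    have hjw : j ≠ w := fun h => hj (h ▸ hw)
    simpa [hjw] using dead1 I b hI j hj
  -- the building blocks
  set U : Fin m → Fin m → Dig d m → ℝ := fun b l => hyp n f (update (update J v {b}) w {l}) with hU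
  set far : Fin m → Fin m → Dig d m → ℝ := fun b l =>
    hyp n f (update (update J' v {b}) w ((J' w).filter fun l' => (l' : ℕ) < L * ((l : ℕ) / L)))
    with hfar
  set near : Fin m → Fin m → Dig d m → ℝ := fun b l =>
    hyp n f (update (update J' v {b}) w
      ((J' w).filter fun l' : Fin m => L * ((l : ℕ) / L) ≤ l' ∧ l' < l)) with hnear
  have hsplit : ∀ b l ω, hyp n f (update (update J' v {b}) w ((J' w).filter (· < l))) ω
      = far b l ω + near b l ω := by
    intro b l ω
    simp only [hfar, hnear]
    rw [hyp_update, hyp_update _ _ (Finset.filter _ _), hyp_update _ _ (Finset.filter _ _),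
      ← Finset.sum_union]
    · refine Finset.sum_congr ?_ fun _ _ => rfl
      ext x
      have hx : L * ((l : ℕ) / L) ≤ l := Nat.mul_div_le _ _
      simp only [Finset.mem_filter, Finset.mem_union, Fin.lt_def]
      constructor
      · rintro ⟨h1, h2⟩
        by_cases h3 : (x : ℕ) < L * ((l : ℕ) / L)
        · exact Or.inl ⟨h1, h3⟩
        · exact Or.inr ⟨h1, by omega, h2⟩
      · rintro (⟨h1, h2⟩ | ⟨h1, h2, h3⟩)
        · exact ⟨h1, by omega⟩
        · exact ⟨h1, h3⟩
    · rw [Finset.disjoint_left]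
      intro x hx hx'
      have h1 := (Finset.mem_filter.1 hx).2
      have h2 := (Finset.mem_filter.1 hx').2.1
      omega
  -- overwhelming events
  have E1 : Owp lam (1 + (1 + 2 * (K + 2))) fun ω => ∀ b ∈ C, ∀ l ∈ (Finset.univ : Finset (Fin m)),
      |far b l ω| ≤ lam ^ (K + 2) * s ^ (K + 1) :=
    Owp.forall_mem hCm fun b _ => Owp.forall_mem (card_level_le _) fun l _ =>
      owp_abs_hyp_le hf hlam1 hm (K + 2) W _ hW (dead2 J' b _ hJ')
  have E2 : Owp lam (1 + (2 * (K + 1) + 1)) fun ω => ∀ b ∈ C,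
      ∑ l ∈ J w, U b l ω ^ 2 ≤ (lam ^ (K + 1) * s ^ (K + 1)) ^ 2 :=
    Owp.forall_mem hCm fun b _ => by
      have := owp_sum_sq_hyp_le (n := n) hf hlam1 hm hW (dead1 J b hJ) hw
      simpa [hvw.symm] using this
  have hNcard : ((Finset.range (m / L + 1)).card : ℝ) ≤ (m : ℝ) ^ 2 := by
    rw [Finset.card_range]
    have h1 : m / L ≤ m := Nat.div_le_self _ _
    have : m / L + 1 ≤ m ^ 2 := by nlinarith
    exact_mod_cast this
  have E3 : Owp lam (1 + (1 + (2 + c0))) fun ω => ∀ b ∈ C, ∀ b' ∈ C,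
      ∀ β ∈ Finset.range (m / L + 1), b ≠ b' →
      |∑ l ∈ (J w).filter (fun l : Fin m => (l : ℕ) / L = β), U b l ω * U b' l ω|
        ≤ lam ^ e0 * ((s ^ 2) ^ K) * L / T ^ 2 :=
    Owp.forall_mem hCm fun b _ => Owp.forall_mem hCm fun b' _ => Owp.forall_mem hNcard fun β _ => by
      by_cases hbb : b = b'
      · exact Owp.of_forall fun ω h => absurd hbb h
      · have := hG m n y lam f hm hlam hy hLm hf (W.erase w) J v w b b'
          ((J w).filter (fun l : Fin m => (l : ℕ) / L = β)) L hWe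
          (fun h => hv (Finset.mem_of_mem_erase h)) (Finset.notMem_erase _ _) hvw
          (fun j hj hjv hjw => hJ j (fun h => hj (Finset.mem_erase.2 ⟨hjw, h⟩)) hjv) hbb le_rfl
          (card_block_le hL0 _ _)
        refine this.imp fun ω hω _ => hω.trans (le_of_eq ?_)
        rw [hT2, hss, pow_succ, mul_div_assoc (_ ^ K), div_self (by positivity), mul_one]
  have E4 : Owp lam (1 + (1 + 2 * (K + 1))) fun ω => ∀ b ∈ C, ∀ l ∈ (Finset.univ : Finset (Fin m)),
      |U b l ω| ≤ lam ^ (K + 1) * s ^ K :=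
    Owp.forall_mem hCm fun b _ => Owp.forall_mem (card_level_le _) fun l _ =>
      owp_abs_hyp_le hf hlam1 hm (K + 1) (W.erase w) _ hWe (dead_update l (dead1 J b hJ))
  have E5 : Owp lam (1 + (1 + 2 * (K + 1))) fun ω => ∀ b ∈ C, ∀ l ∈ (Finset.univ : Finset (Fin m)),
      |hyp n f (update (update J' v {b}) w {l}) ω| ≤ lam ^ (K + 1) * s ^ K :=
    Owp.forall_mem hCm fun b _ => Owp.forall_mem (card_level_le _) fun l _ =>
      owp_abs_hyp_le hf hlam1 hm (K + 1) (W.erase w) _ hWe (dead_update l (dead1 J' b hJ'))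
  set β : ℝ := lam ^ (2 * K + 5 + e0) * (s ^ 2) ^ (K + 1) * R / T with hβ
  have hs0' : 0 < s := Real.sqrt_pos.2 (by positivity)
  have hβ0 : 0 < β := by positivity
  have E6 := owp_abs_sum_le (lam := lam) w (fun l ω => ∑ b ∈ C, U b l ω * far b l ω) (J w)
    (fun l _ => IsDiff.sum fun b _ => (hyp_isDiff hf (by simp)).mul_inv
      (hyp_invFrom hf fun l' hl' => by
        rw [Function.update_self] at hl'
        have h1 : (l' : ℕ) < L * ((l : ℕ) / L) := (Finset.mem_filter.1 hl').2
        exact Fin.lt_def.2 (h1.trans_le (Nat.mul_div_le _ _)))) hβ0 (by linarith)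
  have E7 := owp_abs_sum_le (lam := lam) w (fun l ω => ∑ b ∈ C, U b l ω * near b l ω) (J w)
    (fun l _ => IsDiff.sum fun b _ => (hyp_isDiff hf (by simp)).mul_inv
      (hyp_invFrom hf fun l' hl' => by
        rw [Function.update_self] at hl'
        exact (Finset.mem_filter.1 hl').2.2))
    hβ0 (by linarith)
  refine (((((((E1.and hm E2).and hm E3).and hm E4).and hm E5).and hm E6).and hm E7).mono hm1
    (by omega)).imp ?_
  rintro ω ⟨⟨⟨⟨⟨⟨h1, h2⟩, h3⟩, h4⟩, h5⟩, h6⟩, h7⟩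
  have hnearle : ∀ b ∈ C, ∀ l, |near b l ω| ≤ L * (lam ^ (K + 1) * s ^ K) := by
    intro b hb l
    simp only [hnear]
    rw [hyp_update]
    refine (Finset.abs_sum_le_sum_abs _ _).trans ?_
    refine (Finset.sum_le_sum fun l' _ => h5 b hb l' (Finset.mem_univ _)).trans ?_
    rw [Finset.sum_const, nsmul_eq_mul]
    refine mul_le_mul_of_nonneg_right ?_ (by positivity)
    exact_mod_cast card_part_block_le hL0 _ _
  have B6 : |∑ l ∈ J w, ∑ b ∈ C, U b l ω * far b l ω| ≤ lam * β := by
    refine h6 ?_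
    have := sum_sq_bilinear_le (E := J w) (C := C) (B := Finset.range (m / L + 1))
      (b := fun l : Fin m => (l : ℕ) / L)
      (U := fun b l => U b l ω)
      (P := fun b k => hyp n f (update (update J' v {b}) w
        ((J' w).filter fun l' => (l' : ℕ) < L * k)) ω)
      (p := lam ^ (K + 2) * s ^ (K + 1)) (u := (lam ^ (K + 1) * s ^ (K + 1)) ^ 2)
      (g := lam ^ e0 * ((s ^ 2) ^ K) * L / T ^ 2) (R := R)
      (fun l _ => Finset.mem_range.2 (Nat.lt_succ_of_le (Nat.div_le_div_right l.2.le)))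
      (by positivity) (by positivity) (by positivity) (by exact_mod_cast hC)
      (fun b hb l _ => h1 b hb l (Finset.mem_univ _)) h2
      (fun b hb b' hb' hbb k hk => h3 b hb b' hb' k hk hbb)
    refine this.trans ?_
    refine half_main_aux hlam hT1 hLR hT2L ?_
    rw [Finset.card_range, hss]
    have : (m / L + 1) * L ≤ 2 * m := by
      have := Nat.div_mul_le_self m L
      nlinarith
    exact_mod_cast this
  have B7 : |∑ l ∈ J w, ∑ b ∈ C, U b l ω * near b l ω| ≤ lam * β := by
    refine h7 ?_
    refine (sum_sq_le_of_abs_le (M := s ^ 2)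
      (b := R * ((lam ^ (K + 1) * s ^ K) * (L * (lam ^ (K + 1) * s ^ K)))) ?_ ?_).trans
      (half_near_aux hlam hs0 hT1 hR0.le (Nat.cast_nonneg _) hTL)
    · rw [hss]; simpa only [pow_one] using card_level_le (J w)
    · intro l _
      refine (Finset.abs_sum_le_sum_abs _ _).trans ?_
      have : ∀ b ∈ C, |U b l ω * near b l ω|
          ≤ (lam ^ (K + 1) * s ^ K) * (L * (lam ^ (K + 1) * s ^ K)) := by
        intro b hb
        rw [abs_mul]
        exact mul_le_mul (h4 b hb l (Finset.mem_univ _)) (hnearle b hb l) (abs_nonneg _)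
          (by positivity)
      refine (Finset.sum_le_sum this).trans ?_
      rw [Finset.sum_const, nsmul_eq_mul]
      exact mul_le_mul_of_nonneg_right (by exact_mod_cast hC) (by positivity)
  have hfin : lam ^ (2 * K + 7 + e0) * ((m : ℝ) ^ (K + 2) / m) * R / T = lam ^ 2 * β := by
    rw [hβ, pow_succ _ (K + 1), mul_div_assoc (_ ^ (K + 1)), div_self (by positivity), mul_one, hss]
    ring
  rw [hfin]
  have hsum : ∑ l ∈ J w, ∑ b ∈ C, hyp n f (update (update J v {b}) w {l}) ω
        * hyp n f (update (update J' v {b}) w ((J' w).filter (· < l))) ω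
      = ∑ l ∈ J w, ∑ b ∈ C, U b l ω * far b l ω + ∑ l ∈ J w, ∑ b ∈ C, U b l ω * near b l ω := by
    rw [← Finset.sum_add_distrib]
    refine Finset.sum_congr rfl fun l _ => ?_
    rw [← Finset.sum_add_distrib]
    refine Finset.sum_congr rfl fun b _ => ?_
    rw [hsplit, mul_add]
  rw [hsum]
  refine (abs_add_le _ _).trans ((add_le_add B6 B7).trans ?_)
  nlinarith [mul_pos (show 0 < lam by linarith) hβ0]

end Gain

section Gain

open Function (update)

/-- The levels of the two sums in a free coordinate are either equal, in which case one free
coordinate is lost, or one is strictly larger than the other. -/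
theorem gainBound_succ {d k : ℕ} (hG : GainBound d k) (hH : HalfBound d (k + 1)) :
    GainBound d (k + 1) := by
  obtain ⟨c0, e0, hG⟩ := hG
  obtain ⟨c1, e1, hH⟩ := hH
  refine ⟨c0 + c1 + 3, e0 + e1 + 2, ?_⟩
  intro m n y lam f hm hlam hy hLm hf W J i v a a' C R hW hi hv hiv hJ ha hR hC
  obtain ⟨w, hw⟩ : W.Nonempty := Finset.card_pos.1 (by omega)
  have hWe : (W.erase w).card = k := by rw [Finset.card_erase_of_mem hw, hW]; rfl
  have hvw : v ≠ w := fun h => hv (h ▸ hw)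
  have hiw : i ≠ w := fun h => hi (h ▸ hw)
  have hm1 : 1 ≤ m := by omega
  have hl1 : 1 ≤ lam := by linarith
  have hy1 : (1 : ℝ) ≤ y := by exact_mod_cast hy
  have dead : ∀ (b : Fin m), ∀ j ∉ W, j ≠ v → (update J i {b} j).card ≤ 1 := by
    intro b j hj hjv
    by_cases hji : j = i
    · subst hji; simp
    · simpa [hji] using hJ j hj hji hjv
  have A1 : Owp lam (1 + c0) fun ω => ∀ l ∈ J w,
      |∑ b ∈ C, hyp n f (update (update (update J w {l}) i {a}) v {b}) ω
        * hyp n f (update (update (update J w {l}) i {a'}) v {b}) ω|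
          ≤ lam ^ e0 * ((m : ℝ) ^ k / m) * R / (y : ℝ) ^ 2 ^ (d - k) :=
    Owp.forall_mem (card_level_le _) fun l _ =>
      hG m n y lam f hm hlam hy hLm hf (W.erase w) (update J w {l}) i v a a' C R hWe
        (fun h => hi (Finset.mem_of_mem_erase h)) (fun h => hv (Finset.mem_of_mem_erase h)) hiv
        (fun j hj hji hjv => by
          by_cases hjw : j = w
          · subst hjw; simp
          · simpa [hjw] using hJ j (fun h => hj (Finset.mem_erase.2 ⟨hjw, h⟩)) hji hjv)
        ha hR hC
  have A2 := hH m n y lam f hm hlam hy hLm hf W (update J i {a}) (update J i {a'}) v w C R hW hw hv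
    (dead a) (dead a') hR hC
  have A3 := hH m n y lam f hm hlam hy hLm hf W (update J i {a'}) (update J i {a}) v w C R hW hw hv
    (dead a') (dead a) hR hC
  refine (((A1.and hm A2).and hm A3).mono hm1 (by omega)).imp ?_
  rintro ω ⟨⟨h1, h2⟩, h3⟩
  simp only [Function.update_of_ne hiw.symm] at h2 h3
  have hcomm : ∀ (x b l : Fin m), update (update (update J i {x}) v {b}) w {l}
      = update (update (update J w {l}) i {x}) v {b} := by
    intro x b l
    rw [Function.update_comm hvw, Function.update_comm hiw]
  have hJw : ∀ x b : Fin m, update (update J i {x}) v {b} w = J w := fun x b => by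
    simp [hvw.symm, hiw.symm]
  have hprod : ∑ b ∈ C, hyp n f (update (update J i {a}) v {b}) ω
        * hyp n f (update (update J i {a'}) v {b}) ω
      = ∑ l ∈ J w, ∑ b ∈ C, hyp n f (update (update (update J w {l}) i {a}) v {b}) ω
          * hyp n f (update (update (update J w {l}) i {a'}) v {b}) ω
        + ∑ l ∈ J w, ∑ b ∈ C, hyp n f (update (update (update J i {a}) v {b}) w {l}) ω
          * hyp n f (update (update (update J i {a'}) v {b}) w ((J w).filter (· < l))) ω
        + ∑ l ∈ J w, ∑ b ∈ C, hyp n f (update (update (update J i {a'}) v {b}) w {l}) ω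
          * hyp n f (update (update (update J i {a}) v {b}) w ((J w).filter (· < l))) ω := by
    rw [Finset.sum_comm (s := J w), Finset.sum_comm (s := J w), Finset.sum_comm (s := J w),
      ← Finset.sum_add_distrib, ← Finset.sum_add_distrib]
    refine Finset.sum_congr rfl fun b _ => ?_
    rw [hyp_eq_sum _ w, hyp_eq_sum (update (update J i {a'}) v {b}) w, hJw, hJw,
      sum_mul_sum_eq_diag_add]
    simp only [hyp_update _ w (Finset.filter _ _), hcomm]
  set Q : ℝ := ((m : ℝ) ^ (k + 1) / m) * R / (y : ℝ) ^ 2 ^ (d - (k + 1)) with hQ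
  have hQ0 : 0 ≤ Q := by positivity
  have hmpos : (0 : ℝ) < m := by positivity
  have b1 : |∑ l ∈ J w, ∑ b ∈ C, hyp n f (update (update (update J w {l}) i {a}) v {b}) ω
          * hyp n f (update (update (update J w {l}) i {a'}) v {b}) ω| ≤ lam ^ e0 * Q := by
    refine (Finset.abs_sum_le_sum_abs _ _).trans ((Finset.sum_le_sum h1).trans ?_)
    rw [Finset.sum_const, nsmul_eq_mul]
    have hc := card_level_le (J w)
    rw [pow_one] at hc
    calc _ ≤ (m : ℝ) * (lam ^ e0 * ((m : ℝ) ^ k / m) * R / (y : ℝ) ^ 2 ^ (d - (k + 1))) := by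
          gcongr
          · norm_num
          · omega
      _ = lam ^ e0 * Q := by rw [hQ]; ring
  have b2 : ∀ X : ℝ, |X| ≤ lam ^ e1 * ((m : ℝ) ^ (k + 1) / m) * R / (y : ℝ) ^ 2 ^ (d - (k + 1)) →
      |X| ≤ lam ^ e1 * Q := fun X hX => hX.trans (le_of_eq (by rw [hQ]; ring))
  have e0' : lam ^ e0 ≤ lam ^ (e0 + e1) := pow_le_pow_right₀ hl1 (by omega)
  have e1' : lam ^ e1 ≤ lam ^ (e0 + e1) := pow_le_pow_right₀ hl1 (by omega)
  have e2' : 3 * lam ^ (e0 + e1) ≤ lam ^ (e0 + e1 + 2) := by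
    have h4 : 3 ≤ lam ^ 2 := by nlinarith
    rw [pow_add _ (e0 + e1) 2, mul_comm]
    exact mul_le_mul_of_nonneg_left h4 (by positivity)
  rw [hprod]
  refine (abs_add_le _ _).trans ((add_le_add ((abs_add_le _ _).trans (add_le_add b1 (b2 _ h2)))
    (b2 _ h3)).trans ?_)
  calc _ = (lam ^ e0 + lam ^ e1 + lam ^ e1) * Q := by ring
    _ ≤ lam ^ (e0 + e1 + 2) * Q := by gcongr; linarith
    _ = _ := by rw [hQ]; ring

/-- Both gain estimates, by a simultaneous induction on the number of free coordinates. -/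
theorem gainBound_and_halfBound (d k : ℕ) (hk : k + 1 ≤ d) :
    GainBound d k ∧ HalfBound d (k + 1) := by
  induction k with
  | zero => exact ⟨gainBound_zero d, halfBound_one d⟩
  | succ k ih =>
    obtain ⟨hG, hH⟩ := ih (by omega)
    have hG' := gainBound_succ hG hH
    exact ⟨hG', halfBound_add_two hk hG'⟩

/-- The sum over the levels `b` of the coordinate `v` of the squares of hyperbolic sums with that
level fixed is overwhelmingly at most a small perturbation of its diagonal part. The off-diagonal
part for each of the other free coordinates is bounded by `HalfBound`. -/
theorem exists_owp_sum_sq_hyp_le (d K : ℕ) (hK : K + 1 ≤ d) :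
    ∃ c e : ℕ, ∀ (m n y : ℕ) (lam : ℝ) (f : (Fin d → Fin m) → Dig d m → ℝ), 2 ≤ m → 2 ≤ lam →
    1 ≤ y → (y ^ 2 ^ (d + 1)) ^ 4 ≤ m → IsHaarFamily f →
    ∀ (W : Finset (Fin d)) (J : Fin d → Finset (Fin m)) (v : Fin d)
      (C : Finset (Fin m)) (R : ℕ), W.card = K + 1 → v ∉ W →
      (∀ j ∉ W, j ≠ v → (J j).card ≤ 1) → y ^ 2 ^ (d + 1) ≤ R → C.card ≤ R →
      Owp lam c fun ω => ∑ b ∈ C, hyp n f (update J v {b}) ω ^ 2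
          ≤ (m : ℝ) ^ K * R * (1 + K * lam ^ e / y) := by
  induction K with
  | zero =>
    refine ⟨0, 0, ?_⟩
    intro m n y lam f hm hlam hy hLm hf W J v C R hW hv hJ hR hC
    refine Owp.of_forall fun ω => ?_
    obtain ⟨w, rfl⟩ := Finset.card_eq_one.1 hW
    have h1 : ∀ b ∈ C, |hyp n f (update J v {b}) ω| ≤ 1 := fun b _ =>
      abs_hyp_le_one hf w (fun j hj => by
        by_cases hjv : j = v
        · subst hjv; simp
        · simpa [hjv] using hJ j (by simpa using hj) hjv) ω
    have hCR : (C.card : ℝ) ≤ R := by exact_mod_cast hC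
    simpa using sum_sq_le_of_abs_le hCR h1
  | succ K ih =>
    obtain ⟨c0, e0, ih⟩ := ih (by omega)
    obtain ⟨c1, e1, hH⟩ := (gainBound_and_halfBound d (K + 1) hK).2
    refine ⟨c0 + c1 + 2, e0 + e1 + 1, ?_⟩
    intro m n y lam f hm hlam hy hLm hf W J v C R hW hv hJ hR hC
    obtain ⟨w, hw⟩ : W.Nonempty := Finset.card_pos.1 (by omega)
    have hWe : (W.erase w).card = K + 1 := by rw [Finset.card_erase_of_mem hw, hW]; rfl
    have hvw : v ≠ w := fun h => hv (h ▸ hw)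
    have hl1 : 1 ≤ lam := by linarith
    have hy1 : (1 : ℝ) ≤ y := by exact_mod_cast hy
    have hm0 : (0 : ℝ) < m := by positivity
    have A1 : Owp lam (1 + c0) fun ω => ∀ l ∈ J w,
        ∑ b ∈ C, hyp n f (update (update J w {l}) v {b}) ω ^ 2
          ≤ (m : ℝ) ^ K * R * (1 + K * lam ^ e0 / y) :=
      Owp.forall_mem (card_level_le _) fun l _ =>
        ih m n y lam f hm hlam hy hLm hf (W.erase w) (update J w {l}) v C R hWe
          (fun h => hv (Finset.mem_of_mem_erase h))
          (fun j hj hjv => by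
            by_cases hjw : j = w
            · subst hjw; simp
            · simpa [hjw] using hJ j (fun h => hj (Finset.mem_erase.2 ⟨hjw, h⟩)) hjv)
          hR hC
    have A2 := hH m n y lam f hm hlam hy hLm hf W J J v w C R hW hw hv hJ hJ hR hC
    refine ((A1.and hm A2).mono (by omega) (by omega)).imp ?_
    rintro ω ⟨h1, h2⟩
    have hprod : ∑ b ∈ C, hyp n f (update J v {b}) ω ^ 2
        = ∑ l ∈ J w, ∑ b ∈ C, hyp n f (update (update J w {l}) v {b}) ω ^ 2
          + 2 * ∑ l ∈ J w, ∑ b ∈ C, hyp n f (update (update J v {b}) w {l}) ω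
            * hyp n f (update (update J v {b}) w ((J w).filter (· < l))) ω := by
      rw [Finset.sum_comm (s := J w), Finset.sum_comm (s := J w), Finset.mul_sum,
        ← Finset.sum_add_distrib]
      refine Finset.sum_congr rfl fun b _ => ?_
      have hJw : update J v {b} w = J w := by simp [hvw.symm]
      rw [sq, hyp_eq_sum _ w, hJw, sum_mul_sum_eq_diag_add]
      simp only [hyp_update _ w (Finset.filter _ _)]
      simp only [Function.update_comm hvw, sq]
      ring
    have b1 : ∑ l ∈ J w, ∑ b ∈ C, hyp n f (update (update J w {l}) v {b}) ω ^ 2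
        ≤ m * ((m : ℝ) ^ K * R * (1 + K * lam ^ e0 / y)) := by
      refine (Finset.sum_le_sum h1).trans ?_
      rw [Finset.sum_const, nsmul_eq_mul]
      have hc := card_level_le (J w)
      rw [pow_one] at hc
      gcongr
    have b2 : lam ^ e1 * ((m : ℝ) ^ (K + 1 + 1) / m) * R / (y : ℝ) ^ 2 ^ (d - (K + 1 + 1))
        ≤ lam ^ e1 * (m : ℝ) ^ (K + 1) * R / y := by
      rw [pow_succ _ (K + 1), mul_div_assoc (_ ^ (K + 1)), div_self hm0.ne', mul_one]
      gcongr
      exact le_self_pow₀ hy1 (by positivity)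
    have e0' : lam ^ e0 ≤ lam ^ (e0 + e1 + 1) := pow_le_pow_right₀ hl1 (by omega)
    have e1' : 2 * lam ^ e1 ≤ lam ^ (e0 + e1 + 1) := by
      have : lam ^ (e1 + 1) ≤ lam ^ (e0 + e1 + 1) := pow_le_pow_right₀ hl1 (by omega)
      have h3 : 0 < lam ^ e1 := by positivity
      rw [pow_succ] at this
      nlinarith
    have h4 := (le_abs_self _).trans (h2.trans b2)
    rw [hprod]
    calc _ ≤ m * ((m : ℝ) ^ K * R * (1 + K * lam ^ e0 / y))
          + 2 * (lam ^ e1 * (m : ℝ) ^ (K + 1) * R / y) := by linarith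
      _ = (m : ℝ) ^ (K + 1) * R * (1 + (K * lam ^ e0 + 2 * lam ^ e1) / y) := by ring
      _ ≤ (m : ℝ) ^ (K + 1) * R * (1 + (K * lam ^ (e0 + e1 + 1) + lam ^ (e0 + e1 + 1)) / y) := by
          gcongr
      _ = _ := by push_cast; ring

/-- Correlation over at most `y ^ 2 ^ (d + 1)` levels of the coordinate `v` of two hyperbolic sums
whose levels in the coordinate `w` are separated. By the separation, the second sum is predictable for
the martingale in `w` given by the first, and the square function is treated by `GainBound`. -/
theorem exists_owp_pair_le_of (d k : ℕ) (hk : k + 2 ≤ d) :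
    ∃ c e : ℕ, ∀ (m n y : ℕ) (lam : ℝ) (f : (Fin d → Fin m) → Dig d m → ℝ), 2 ≤ m → 2 ≤ lam →
    1 ≤ y → (y ^ 2 ^ (d + 1)) ^ 4 ≤ m → IsHaarFamily f →
    ∀ (k' : ℕ) (W W' : Finset (Fin d)) (J J' : Fin d → Finset (Fin m)) (v w : Fin d)
      (C : Finset (Fin m)), W.card = k + 1 → W'.card = k' + 1 → k' ≤ d → w ∈ W → v ∉ W →
      (∀ j ∉ W, j ≠ v → (J j).card ≤ 1) → (∀ j ∉ W', j ≠ v → (J' j).card ≤ 1) →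
      (∀ l ∈ J w, ∀ l' ∈ J' w, l' < l) → C.card ≤ y ^ 2 ^ (d + 1) →
      Owp lam c fun ω => |∑ a ∈ C, hyp n f (update J v {a}) ω * hyp n f (update J' v {a}) ω|
          ≤ lam ^ e * (√m ^ k * √m ^ k') * (y : ℝ) ^ 2 ^ (d + 1) / y := by
  obtain ⟨c0, e0, hG⟩ := (gainBound_and_halfBound d k (by omega)).1
  refine ⟨c0 + 2 * d + 8, k + d + 3 + e0, ?_⟩
  intro m n y lam f hm hlam hy hLm hf k' W W' J J' v w C hW hW' hk' hw hv hJ hJ' hsep hC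
  have hvw : v ≠ w := fun h => hv (h ▸ hw)
  have hWe : (W.erase w).card = k := by rw [Finset.card_erase_of_mem hw, hW]; rfl
  have hl1 : 1 ≤ lam := by linarith
  have hy1 : (1 : ℝ) ≤ y := by exact_mod_cast hy
  have hm0 : (0 : ℝ) < m := by positivity
  set s : ℝ := √m with hs
  have hs0 : 0 < s := Real.sqrt_pos.2 hm0
  have hss : s ^ 2 = m := Real.sq_sqrt hm0.le
  set L : ℝ := (y : ℝ) ^ 2 ^ (d + 1) with hL
  have hL0 : 0 < L := by positivity
  have hCm : (C.card : ℝ) ≤ (m : ℝ) ^ 1 := card_level_le C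
  have dead : ∀ (V : Finset (Fin d)) (I : Fin d → Finset (Fin m)) (b : Fin m),
      (∀ j ∉ V, j ≠ v → (I j).card ≤ 1) → ∀ j ∉ V, (update I v {b} j).card ≤ 1 := by
    intro V I b hI j hj
    by_cases hjv : j = v
    · subst hjv; simp
    · simpa [hjv] using hI j hj hjv
  have E1 : Owp lam (1 + 2 * (k' + 1)) fun ω => ∀ a ∈ C,
      |hyp n f (update J' v {a}) ω| ≤ lam ^ (k' + 1) * s ^ k' :=
    Owp.forall_mem hCm fun a _ => owp_abs_hyp_le hf hl1 hm (k' + 1) W' _ hW' (dead W' J' a hJ')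
  have E2 : Owp lam (1 + (2 * k + 1)) fun ω => ∀ a ∈ C,
      ∑ l ∈ J w, hyp n f (update (update J v {a}) w {l}) ω ^ 2 ≤ (lam ^ k * s ^ k) ^ 2 :=
    Owp.forall_mem hCm fun a _ => by
      have := owp_sum_sq_hyp_le (n := n) hf hl1 hm hW (dead W J a hJ) hw
      simpa [hvw.symm] using this
  have hyk : (y : ℝ) ^ 2 ≤ (y : ℝ) ^ 2 ^ (d - k) := by
    refine pow_le_pow_right₀ hy1 ?_
    calc 2 = 2 ^ 1 := rfl
      _ ≤ 2 ^ (d - k) := Nat.pow_le_pow_right (by norm_num) (by omega)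
  have E3 : Owp lam (1 + (1 + c0)) fun ω => ∀ a ∈ C, ∀ a' ∈ C, a ≠ a' →
      |∑ l ∈ J w, hyp n f (update (update J v {a}) w {l}) ω
        * hyp n f (update (update J v {a'}) w {l}) ω| ≤ lam ^ e0 * (s ^ k) ^ 2 / y ^ 2 :=
    Owp.forall_mem hCm fun a _ => Owp.forall_mem hCm fun a' _ => by
      by_cases haa : a = a'
      · exact Owp.of_forall fun ω h => absurd haa h
      · have := hG m n y lam f hm hlam hy hLm hf (W.erase w) J v w a a' (J w) m hWe
          (fun h => hv (Finset.mem_of_mem_erase h)) (Finset.notMem_erase _ _) hvw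
          (fun j hj hjv hjw => hJ j (fun h => hj (Finset.mem_erase.2 ⟨hjw, h⟩)) hjv) haa
          (le_trans (Nat.le_self_pow (by norm_num) _) hLm)
          ((Finset.card_le_univ _).trans_eq (Fintype.card_fin m))
        refine this.imp fun ω hω _ => hω.trans ?_
        have e1 : lam ^ e0 * ((m : ℝ) ^ k / m) * m = lam ^ e0 * (s ^ k) ^ 2 := by
          rw [mul_assoc, div_mul_cancel₀ _ hm0.ne', ← hss]; ring
        rw [e1]
        gcongr
  set β : ℝ := lam ^ (k + d + 2 + e0) * (s ^ k * s ^ k') * L / y with hβ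
  have hβ0 : 0 < β := by positivity
  have E4 := owp_abs_sum_le (lam := lam) w (fun l ω => ∑ a ∈ C,
      hyp n f (update (update J v {a}) w {l}) ω * hyp n f (update J' v {a}) ω) (J w)
    (fun l hl => IsDiff.sum fun a _ => (hyp_isDiff hf (by simp)).mul_inv
      (hyp_invFrom hf fun l' hl' => hsep l hl l' (by simpa [hvw.symm] using hl')))
      hβ0 (by linarith)
  refine ((((E1.and hm E2).and hm E3).and hm E4).mono (by omega) (by omega)).imp ?_
  rintro ω ⟨⟨⟨h1, h2⟩, h3⟩, h4⟩
  have hsum : ∑ a ∈ C, hyp n f (update J v {a}) ω * hyp n f (update J' v {a}) ω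
      = ∑ l ∈ J w, ∑ a ∈ C,
      hyp n f (update (update J v {a}) w {l}) ω * hyp n f (update J' v {a}) ω := by
    rw [Finset.sum_comm]
    refine Finset.sum_congr rfl fun a _ => ?_
    have hJw : update J v {a} w = J w := by simp [hvw.symm]
    rw [hyp_eq_sum (update J v {a}) w, hJw, Finset.sum_mul]
  rw [hsum]
  refine (h4 ?_).trans (le_of_eq (by rw [hβ]; ring))
  have hCL : (C.card : ℝ) ≤ L := by rw [hL]; exact_mod_cast hC
  have hsq := sum_sq_bilinear_le (E := J w) (C := C) (B := {()}) (b := fun _ => ())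
      (U := fun a l => hyp n f (update (update J v {a}) w {l}) ω)
      (P := fun a _ => hyp n f (update J' v {a}) ω)
      (p := lam ^ (k' + 1) * s ^ k') (u := (lam ^ k * s ^ k) ^ 2)
      (g := lam ^ e0 * (s ^ k) ^ 2 / y ^ 2) (R := L)
      (fun l _ => by simp) (by positivity) (by positivity) (by positivity) hCL
      (fun a ha l _ => h1 a ha) h2
      (fun a ha a' ha' haa _ _ => by simpa using h3 a ha a' ha' haa)
  refine hsq.trans ?_
  have hLy : (y : ℝ) ^ 2 ≤ L := by
    rw [hL]
    refine pow_le_pow_right₀ hy1 ?_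
    calc 2 = 2 ^ 1 := rfl
      _ ≤ 2 ^ (d + 1) := Nat.pow_le_pow_right (by norm_num) (by omega)
  have hL1 : L ≤ L ^ 2 / y ^ 2 := by
    rw [le_div_iff₀ (by positivity), sq L]
    exact mul_le_mul_of_nonneg_left hLy hL0.le
  have q1 : lam ^ (2 * k) ≤ lam ^ (2 * k + 1 + 2 * e0) := pow_le_pow_right₀ hl1 (by omega)
  have q2 : lam ^ e0 ≤ lam ^ (2 * k + 1 + 2 * e0) := pow_le_pow_right₀ hl1 (by omega)
  have q3 : lam ^ (2 * k) + lam ^ e0 ≤ lam ^ (2 * k + 2 + 2 * e0) := by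
    have : lam ^ (2 * k + 2 + 2 * e0) = lam ^ (2 * k + 1 + 2 * e0) * lam := by
      rw [← pow_succ]; congr 1; omega
    rw [this]
    nlinarith [show 0 < lam ^ (2 * k + 1 + 2 * e0) by positivity]
  have q4 : lam ^ (2 * k' + 2) ≤ lam ^ (2 * d + 2) := pow_le_pow_right₀ hl1 (by omega)
  calc _ ≤ (lam ^ (k' + 1) * s ^ k') ^ 2 * (L ^ 2 / y ^ 2 * (lam ^ k * s ^ k) ^ 2
        + L ^ 2 * (1 * (lam ^ e0 * (s ^ k) ^ 2 / y ^ 2))) := by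
        simp only [Finset.card_singleton, Nat.cast_one]
        gcongr
    _ = lam ^ (2 * k' + 2) * (lam ^ (2 * k) + lam ^ e0) * ((s ^ k * s ^ k') * L / y) ^ 2 := by
        field_simp
        ring
    _ ≤ lam ^ (2 * d + 2) * lam ^ (2 * k + 2 + 2 * e0) * ((s ^ k * s ^ k') * L / y) ^ 2 := by
        gcongr
    _ = β ^ 2 := by
        rw [hβ, ← pow_add]
        have : lam ^ (2 * d + 2 + (2 * k + 2 + 2 * e0)) = (lam ^ (k + d + 2 + e0)) ^ 2 := by
          rw [← pow_mul]; congr 1; ring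
        rw [this]; ring

end Gain

/-! ### Riesz products -/

section Riesz

open Function (update)

variable {d m n q : ℕ} {f : (Fin d → Fin m) → Dig d m → ℝ} {lam : ℝ}

lemma avg_mul_sum_eq_zero {j : Fin d} {A : Fin m → Dig d m → ℝ} {C : Finset (Fin m)}
    {g : Dig d m → ℝ} (hA : ∀ c ∈ C, IsDiff j c (A c)) (hg : ∀ c ∈ C, InvFrom j c g) :
    avg (fun ω => g ω * ∑ c ∈ C, A c ω) = 0 := by
  simp only [Finset.mul_sum]
  rw [avg_sum]
  refine Finset.sum_eq_zero fun c hc => ?_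
  refine avg_eq_zero_of_flipDigit j c fun ω => ?_
  rw [(hA c hc).anti, hg c hc c le_rfl]; ring

/-- Orthogonality of dyadic martingale differences, relative to a weight depending on coarser
digits only. -/
lemma avg_mul_sum_sq_eq {j : Fin d} {A : Fin m → Dig d m → ℝ} {C : Finset (Fin m)}
    {g : Dig d m → ℝ} (hA : ∀ c ∈ C, IsDiff j c (A c)) (hg : ∀ c ∈ C, InvFrom j c g) :
    avg (fun ω => g ω * (∑ c ∈ C, A c ω) ^ 2) = avg fun ω => g ω * ∑ c ∈ C, A c ω ^ 2 := by
  have h0 : ∀ c ∈ C, ∀ c' ∈ C, c < c' → avg (fun ω => g ω * (A c ω * A c' ω)) = 0 := by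
    intro c hc c' hc' h
    refine avg_eq_zero_of_flipDigit j c' fun ω => ?_
    rw [(hA c' hc').anti, hg c' hc' c' le_rfl, (hA c hc).inv c' h]; ring
  simp only [sq (∑ c ∈ C, A c _), Finset.sum_mul_sum]
  simp only [Finset.mul_sum]
  rw [avg_sum, avg_sum]
  refine Finset.sum_congr rfl fun c hc => ?_
  rw [avg_sum]
  simp only [sq]
  refine Finset.sum_eq_single_of_mem c hc fun c' hc' hne => ?_
  rcases lt_or_gt_of_ne hne with h | h
  · have := h0 c' hc' c hc h
    simpa only [mul_comm (A c' _)] using this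
  · exact h0 c hc c' hc' h

lemma card_levels_le (J : Fin d → Finset (Fin m)) : (levels n J).card ≤ m ^ d := by
  refine (Finset.card_le_univ _).trans ?_
  simp

lemma abs_hyp_le_pow (hf : IsHaarFamily f) (J : Fin d → Finset (Fin m)) (ω : Dig d m) :
    |hyp n f J ω| ≤ (m : ℝ) ^ d :=
  (abs_hyp_le_card hf J ω).trans (by exact_mod_cast card_levels_le J)

lemma sum_sq_hyp_le_pow (hf : IsHaarFamily f) (J : Fin d → Finset (Fin m)) (v : Fin d)
    (ω : Dig d m) : ∑ b ∈ J v, hyp n f (update J v {b}) ω ^ 2 ≤ ((m : ℝ) ^ d) ^ 2 := by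
  have h1 : ∑ b ∈ J v, hyp n f (update J v {b}) ω ^ 2
      ≤ (∑ b ∈ J v, |hyp n f (update J v {b}) ω|) ^ 2 := by
    simp only [← sq_abs (hyp n f _ ω)]
    exact Finset.sum_sq_le_sq_sum_of_nonneg fun i _ => abs_nonneg _
  refine h1.trans (pow_le_pow_left₀ (Finset.sum_nonneg fun i _ => abs_nonneg _) ?_ 2)
  refine (Finset.sum_le_sum fun b _ => abs_hyp_le_card hf _ ω).trans ?_
  rw [← Nat.cast_sum, ← card_levels_eq_sum]
  exact_mod_cast card_levels_le J

lemma invFrom_prod_hyp (hf : IsHaarFamily f) {J : Fin q → Fin d → Finset (Fin m)} {v : Fin d}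
    (hsep : ∀ t t', t < t' → ∀ l ∈ J t v, ∀ l' ∈ J t' v, l < l') {s : Finset (Fin q)} {a : Fin q}
    (ha : ∀ t ∈ s, t < a) (F : ℝ → ℝ) (b : Fin m) (hb : b ∈ J a v) :
    InvFrom v b fun ω => ∏ t ∈ s, F (hyp n f (J t) ω) :=
  InvFrom.prod fun t ht k hk ω => by
    rw [hyp_invFrom hf (fun e he => hsep t a (ha t ht) e he b hb) k hk ω]

/-- The Riesz product has mean one, because its factors use increasing digits of the coordinate `v`,
and each of them adds a martingale difference. -/
lemma avg_riesz_eq_one (hf : IsHaarFamily f) {J : Fin q → Fin d → Finset (Fin m)} {v : Fin d}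
    (hsep : ∀ t t', t < t' → ∀ l ∈ J t v, ∀ l' ∈ J t' v, l < l') (τ : ℝ) (V : Finset (Fin q)) :
    avg (fun ω => ∏ t ∈ V, (1 + τ * hyp n f (J t) ω)) = 1 := by
  induction V using Finset.induction_on_max with
  | empty => simp [avg_const]
  | insert a s ha ih =>
    have has : a ∉ s := fun h => lt_irrefl _ (ha a h)
    have h1 : ∀ ω, ∏ t ∈ insert a s, (1 + τ * hyp n f (J t) ω)
        = ∏ t ∈ s, (1 + τ * hyp n f (J t) ω) + τ * ((∏ t ∈ s, (1 + τ * hyp n f (J t) ω))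
          * ∑ b ∈ J a v, hyp n f (update (J a) v {b}) ω) := by
      intro ω
      rw [Finset.prod_insert has, ← hyp_eq_sum]; ring
    simp only [h1]
    rw [avg_add, avg_const_mul, avg_mul_sum_eq_zero (fun b _ => hyp_isDiff hf (by simp))
      (fun b hb => invFrom_prod_hyp hf hsep ha (fun x => 1 + τ * x) b hb), ih]
    simp

/-- The second moment of the Riesz product. The conditional expectation of each factor is
controlled by the square function, which is at most `2 * M` outside a negligible event. -/
lemma avg_riesz_sq_le (hf : IsHaarFamily f) {J : Fin q → Fin d → Finset (Fin m)} {v : Fin d}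
    (hsep : ∀ t t', t < t' → ∀ l ∈ J t v, ∀ l' ∈ J t' v, l < l') {τ κ M : ℝ} {c : ℕ}
    (hτ : τ ^ 2 * M = κ ^ 2) (hτ0 : 0 ≤ τ) (hτ1 : τ ≤ 1) {V : Finset (Fin q)}
    (hQ : ∀ t ∈ V, Owp lam c fun ω => ∑ b ∈ J t v, hyp n f (update (J t) v {b}) ω ^ 2 ≤ 2 * M) :
    avg (fun ω => ∏ t ∈ V, (1 + τ * hyp n f (J t) ω) ^ 2) ≤ (1 + 2 * κ ^ 2) ^ V.card *
      (1 + V.card * ((1 + (m : ℝ) ^ d) ^ (2 * q) * ((m : ℝ) ^ c * (2 * Real.exp (-lam ^ 2 / 2))))) := by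
  induction V using Finset.induction_on_max with
  | empty => simp [avg_const]
  | insert a s ha ih =>
    have has : a ∉ s := fun h => lt_irrefl _ (ha a h)
    have ih := ih fun t ht => hQ t (Finset.mem_insert_of_mem ht)
    set g : Dig d m → ℝ := fun ω => ∏ t ∈ s, (1 + τ * hyp n f (J t) ω) ^ 2 with hg
    set Q : Dig d m → ℝ := fun ω => ∑ b ∈ J a v, hyp n f (update (J a) v {b}) ω ^ 2 with hQdef
    set ξ : ℝ := (1 + (m : ℝ) ^ d) ^ (2 * q) * ((m : ℝ) ^ c * (2 * Real.exp (-lam ^ 2 / 2))) with hξ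
    have hξ0 : 0 ≤ ξ := by positivity
    have hg0 : ∀ ω, 0 ≤ g ω := fun ω => Finset.prod_nonneg fun t _ => sq_nonneg _
    have hginv : ∀ b ∈ J a v, InvFrom v b g := fun b hb =>
      invFrom_prod_hyp hf hsep ha (fun x => (1 + τ * x) ^ 2) b hb
    have hD : ∀ b ∈ J a v, IsDiff v b (hyp n f (update (J a) v {b})) := fun b _ =>
      hyp_isDiff hf (by simp)
    have h1 : avg (fun ω => ∏ t ∈ insert a s, (1 + τ * hyp n f (J t) ω) ^ 2)
        = avg fun ω => g ω * (1 + τ ^ 2 * Q ω) := by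
      have e1 : ∀ ω, ∏ t ∈ insert a s, (1 + τ * hyp n f (J t) ω) ^ 2
          = g ω + 2 * τ * (g ω * ∑ b ∈ J a v, hyp n f (update (J a) v {b}) ω)
            + τ ^ 2 * (g ω * (∑ b ∈ J a v, hyp n f (update (J a) v {b}) ω) ^ 2) := by
        intro ω
        rw [Finset.prod_insert has, ← hyp_eq_sum]; ring
      have e2 : ∀ ω, g ω * (1 + τ ^ 2 * Q ω) = g ω + τ ^ 2 * (g ω * Q ω) := fun ω => by ring
      simp only [e1, e2]
      rw [avg_add, avg_add, avg_const_mul, avg_const_mul, avg_mul_sum_eq_zero hD hginv,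
        avg_mul_sum_sq_eq hD hginv, avg_add, avg_const_mul]
      simp [hQdef]
    have hH : ∀ t ω, |1 + τ * hyp n f (J t) ω| ≤ 1 + (m : ℝ) ^ d := by
      intro t ω
      refine (abs_add_le _ _).trans ?_
      rw [abs_one, abs_mul, abs_of_nonneg hτ0]
      have := abs_hyp_le_pow hf (n := n) (J t) ω
      nlinarith [abs_nonneg (hyp n f (J t) ω)]
    have hH1 : 1 ≤ 1 + (m : ℝ) ^ d := le_add_of_nonneg_right (by positivity)
    have hgle : ∀ ω, g ω ≤ (1 + (m : ℝ) ^ d) ^ (2 * s.card) := by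
      intro ω
      calc g ω ≤ ∏ _t ∈ s, (1 + (m : ℝ) ^ d) ^ 2 :=
            Finset.prod_le_prod (fun t _ => sq_nonneg _) fun t _ => by
              rw [← sq_abs]; exact pow_le_pow_left₀ (abs_nonneg _) (hH t ω) 2
        _ = _ := by rw [Finset.prod_const, ← pow_mul]
    have hscard : s.card + 1 ≤ q := by
      have := Finset.card_le_univ (insert a s)
      rwa [Finset.card_insert_of_notMem has, Fintype.card_fin] at this
    have hQ0 : ∀ ω, 0 ≤ Q ω := fun ω => Finset.sum_nonneg fun b _ => sq_nonneg _
    have h2 : avg (fun ω => g ω * (1 + τ ^ 2 * Q ω))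
        ≤ avg (fun ω => (1 + 2 * κ ^ 2) * g ω) + (1 + (m : ℝ) ^ d) ^ (2 * q) *
          prop fun ω => ¬ (∑ b ∈ J a v, hyp n f (update (J a) v {b}) ω ^ 2 ≤ 2 * M) := by
      refine avg_le_of_exceptional (fun ω => mul_nonneg (by positivity) (hg0 ω)) ?_ ?_
      · intro ω hω
        rw [mul_comm]
        refine mul_le_mul_of_nonneg_right ?_ (hg0 ω)
        have : τ ^ 2 * Q ω ≤ τ ^ 2 * (2 * M) := mul_le_mul_of_nonneg_left hω (sq_nonneg _)
        nlinarith
      · intro ω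
        have hb : 1 + τ ^ 2 * Q ω ≤ (1 + (m : ℝ) ^ d) ^ 2 := by
          have h3 : Q ω ≤ ((m : ℝ) ^ d) ^ 2 := sum_sq_hyp_le_pow hf (J a) v ω
          have h4 : τ ^ 2 ≤ 1 := pow_le_one₀ hτ0 hτ1
          have h5 : (0 : ℝ) ≤ (m : ℝ) ^ d := by positivity
          nlinarith [hQ0 ω]
        calc g ω * (1 + τ ^ 2 * Q ω)
            ≤ (1 + (m : ℝ) ^ d) ^ (2 * s.card) * (1 + (m : ℝ) ^ d) ^ 2 :=
              mul_le_mul (hgle ω) hb (by have := hQ0 ω; positivity) (by positivity)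
          _ = (1 + (m : ℝ) ^ d) ^ (2 * s.card + 2) := by rw [pow_add]
          _ ≤ _ := pow_le_pow_right₀ hH1 (by omega)
    have h3 : (1 + (m : ℝ) ^ d) ^ (2 * q) *
          prop (fun ω => ¬ (∑ b ∈ J a v, hyp n f (update (J a) v {b}) ω ^ 2 ≤ 2 * M)) ≤ ξ :=
      mul_le_mul_of_nonneg_left (hQ a (Finset.mem_insert_self _ _)) (by positivity)
    rw [h1, Finset.card_insert_of_notMem has]
    rw [avg_const_mul] at h2
    set x : ℝ := 1 + 2 * κ ^ 2 with hx
    have hx1 : 1 ≤ x := le_add_of_nonneg_right (by positivity)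
    have h4 : x * avg g ≤ x * (x ^ s.card * (1 + s.card * ξ)) :=
      mul_le_mul_of_nonneg_left ih (by linarith)
    have h5 : ξ ≤ x ^ (s.card + 1) * ξ := le_mul_of_one_le_left hξ0 (one_le_pow₀ hx1)
    calc _ ≤ x * (x ^ s.card * (1 + s.card * ξ)) + x ^ (s.card + 1) * ξ := by linarith
      _ = _ := by push_cast; ring

/-- The Riesz product is bounded in `L¹`: its mean is one, and it can only be negative where one
of the factors is, an event whose probability is small in comparison with the second moment. -/
theorem avg_abs_riesz_le_two (hf : IsHaarFamily f) {J : Fin q → Fin d → Finset (Fin m)}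
    {v : Fin d} (hsep : ∀ t t', t < t' → ∀ l ∈ J t v, ∀ l' ∈ J t' v, l < l') {τ κ M : ℝ} {c : ℕ}
    (hτ : τ ^ 2 * M = κ ^ 2) (hτ0 : 0 < τ) (hτ1 : τ ≤ 1) (hκ : 0 < κ)
    {V : Finset (Fin q)}
    (hQ : ∀ t ∈ V, Owp lam c fun ω => ∑ b ∈ J t v, hyp n f (update (J t) v {b}) ω ^ 2 ≤ 2 * M)
    (hnum1 : q * ((1 + (m : ℝ) ^ d) ^ (2 * q) * ((m : ℝ) ^ c * (2 * Real.exp (-lam ^ 2 / 2)))) ≤ 1)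
    (hnum2 : q * ((m : ℝ) ^ c * (2 * Real.exp (-lam ^ 2 / 2)) + 2 * Real.exp (-1 / (4 * κ ^ 2)))
      * (2 * Real.exp (2 * κ ^ 2 * q)) ≤ 1 / 4) :
    avg (fun ω => |∏ t ∈ V, (1 + τ * hyp n f (J t) ω)|) ≤ 2 := by
  classical
  set Ψ : Dig d m → ℝ := fun ω => ∏ t ∈ V, (1 + τ * hyp n f (J t) ω) with hΨ
  set E : Dig d m → Prop := fun ω => ∃ t ∈ V, 1 < |τ * hyp n f (J t) ω| with hE
  have hVq : (V.card : ℝ) ≤ q := by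
    exact_mod_cast (Finset.card_le_univ V).trans_eq (Fintype.card_fin q)
  have hM : 0 < M := by
    have : 0 < τ ^ 2 * M := by rw [hτ]; positivity
    exact pos_of_mul_pos_right this (sq_nonneg _)
  -- second moment
  have h2 : avg (fun ω => Ψ ω ^ 2) ≤ 2 * Real.exp (2 * κ ^ 2 * q) := by
    have h := avg_riesz_sq_le hf hsep hτ hτ0.le hτ1 hQ
    simp only [hΨ, ← Finset.prod_pow]
    refine h.trans ?_
    have e1 : (1 + 2 * κ ^ 2) ^ V.card ≤ Real.exp (2 * κ ^ 2 * q) := by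
      calc (1 + 2 * κ ^ 2) ^ V.card ≤ Real.exp (2 * κ ^ 2) ^ V.card := by
            refine pow_le_pow_left₀ (by positivity) ?_ _
            rw [add_comm]; exact Real.add_one_le_exp _
        _ = Real.exp (V.card * (2 * κ ^ 2)) := (Real.exp_nat_mul _ _).symm
        _ ≤ _ := Real.exp_le_exp.2 (by nlinarith [sq_nonneg κ])
    have e2 : 1 + V.card * ((1 + (m : ℝ) ^ d) ^ (2 * q) *
        ((m : ℝ) ^ c * (2 * Real.exp (-lam ^ 2 / 2)))) ≤ 2 := by
      have := mul_le_mul_of_nonneg_right hVq (show 0 ≤ (1 + (m : ℝ) ^ d) ^ (2 * q) *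
        ((m : ℝ) ^ c * (2 * Real.exp (-lam ^ 2 / 2))) by positivity)
      linarith
    exact (mul_le_mul e1 e2 (by positivity) (Real.exp_pos _).le).trans_eq (mul_comm _ _)
  -- the event of a large factor
  have hE1 : prop E ≤ q * ((m : ℝ) ^ c * (2 * Real.exp (-lam ^ 2 / 2))
      + 2 * Real.exp (-1 / (4 * κ ^ 2))) := by
    refine (prop_exists_le V _).trans ?_
    have : ∀ t ∈ V, prop (fun ω => 1 < |τ * hyp n f (J t) ω|)
        ≤ (m : ℝ) ^ c * (2 * Real.exp (-lam ^ 2 / 2)) + 2 * Real.exp (-1 / (4 * κ ^ 2)) := by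
      intro t ht
      have h3 := owp_abs_sum_le (lam := 1 / (√2 * κ)) v (fun b => hyp n f (update (J t) v {b}))
        (J t v) (fun b _ => hyp_isDiff hf (by simp)) (β := √(2 * M)) (by positivity) (by positivity)
      rw [Real.sq_sqrt (by positivity)] at h3
      have h4 := hQ t ht
      unfold Owp at h3 h4
      have e3 : -(1 / (√2 * κ)) ^ 2 / 2 = -1 / (4 * κ ^ 2) := by
        rw [div_pow, mul_pow, Real.sq_sqrt (by norm_num)]; field_simp; norm_num
      have e4 : 1 / (√2 * κ) * √(2 * M) = 1 / τ := by
        have : √M = κ / τ := by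
          rw [Real.sqrt_eq_iff_mul_self_eq hM.le (by positivity)]
          field_simp
          linarith
        rw [Real.sqrt_mul (by norm_num), this]
        field_simp
      rw [e3, e4, pow_zero, one_mul] at h3
      refine (prop_mono fun ω hω => ?_).trans ((prop_or_le _ _).trans (add_le_add h4 h3))
      by_contra hcon
      simp only [not_or, not_not] at hcon
      have h5 := hcon.2 hcon.1
      rw [← hyp_eq_sum, le_div_iff₀ hτ0] at h5
      rw [abs_mul, abs_of_pos hτ0] at hω
      linarith
    refine (Finset.sum_le_sum this).trans ?_
    rw [Finset.sum_const, nsmul_eq_mul]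
    exact mul_le_mul_of_nonneg_right hVq (by positivity)
  have hI : ∀ ω, |Ψ ω| ≤ Ψ ω + 2 * (|Ψ ω| * if E ω then 1 else 0) := by
    intro ω
    by_cases h : E ω
    · simp only [h, if_true]
      linarith [neg_abs_le (Ψ ω)]
    · simp only [h, if_false, mul_zero, add_zero]
      refine le_of_eq (abs_of_nonneg (Finset.prod_nonneg fun t ht => ?_))
      have : |τ * hyp n f (J t) ω| ≤ 1 := by
        by_contra h'
        exact h ⟨t, ht, not_le.1 h'⟩
      linarith [neg_abs_le (τ * hyp n f (J t) ω)]
  have hCS : (avg fun ω => |Ψ ω| * if E ω then (1 : ℝ) else 0) ^ 2 ≤ (1 / 2) ^ 2 := by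
    refine (avg_mul_sq_le _ _).trans ?_
    simp only [sq_abs]
    have e5 : (avg fun ω => (if E ω then (1 : ℝ) else 0) ^ 2) = prop E := by
      unfold prop
      congr 1
      funext ω
      split_ifs <;> norm_num
    rw [e5]
    calc _ ≤ (2 * Real.exp (2 * κ ^ 2 * q)) * (q * ((m : ℝ) ^ c * (2 * Real.exp (-lam ^ 2 / 2))
      + 2 * Real.exp (-1 / (4 * κ ^ 2)))) := mul_le_mul h2 hE1 (prop_nonneg _) (by positivity)
      _ ≤ (1 / 2) ^ 2 := by rw [mul_comm]; norm_num at hnum2 ⊢; exact hnum2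
  have h6 : (avg fun ω => |Ψ ω| * if E ω then (1 : ℝ) else 0) ≤ 1 / 2 :=
    abs_le_of_sq_le_sq' hCS (by norm_num) |>.2
  refine (avg_mono hI).trans ?_
  rw [avg_add, avg_const_mul, avg_riesz_eq_one hf hsep]
  linarith

end Riesz

/-! ### Expanding products over coinciding top levels -/

section Expansion

lemma sum_inv_pow_card_le {q : ℕ} (hq : 1 ≤ q) :
    ∑ P : Finset (Fin q), ((q : ℝ)⁻¹) ^ P.card ≤ 3 := by
  have h := Fintype.sum_pow_mul_eq_add_pow (Fin q) ((q : ℝ)⁻¹) 1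
  simp only [one_pow, mul_one, Fintype.card_fin] at h
  rw [h]
  have hq0 : (q : ℝ) ≠ 0 := by positivity
  calc ((q : ℝ)⁻¹ + 1) ^ q ≤ Real.exp ((q : ℝ)⁻¹) ^ q :=
        pow_le_pow_left₀ (by positivity) (Real.add_one_le_exp _) _
    _ = Real.exp 1 := by rw [← Real.exp_nat_mul, mul_inv_cancel₀ hq0]
    _ ≤ 3 := Real.exp_one_lt_three.le

/-- Once a third factor is small, a common top level costs the additional factor `q * z`; the negative
powers of `q` make the sum over the sets of factors bounded, by `sum_inv_pow_card_le`. -/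
lemma pow_card_le {x z : ℝ} {q a b : ℕ} (hq : 1 ≤ q) (hx : 0 ≤ x) (hxz : x ≤ z)
    (hz : q * z ≤ 1) (ha : 2 ≤ a) (hab : 3 ≤ a + b) :
    x ^ a * z ^ b ≤ x ^ 2 * q ^ 2 * (q * z) * (((q : ℝ)⁻¹) ^ a * ((q : ℝ)⁻¹) ^ b) := by
  have hq0 : (0 : ℝ) < q := by exact_mod_cast hq
  have hz0 : 0 ≤ z := hx.trans hxz
  obtain ⟨k, hk⟩ : ∃ k, a + b = k + 3 := ⟨a + b - 3, by omega⟩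
  have h1 : x ^ a * z ^ b ≤ x ^ 2 * z ^ (k + 1) := by
    obtain ⟨a, rfl⟩ : ∃ a', a = a' + 2 := ⟨a - 2, by omega⟩
    have : k + 1 = a + b := by omega
    rw [this, pow_add, pow_add z, mul_comm (x ^ a), mul_assoc]
    gcongr
  have h2 : (q * z) ^ (k + 1) ≤ q * z := pow_le_of_le_one (by positivity) hz (by omega)
  have h3 : x ^ 2 * z ^ (k + 1) = x ^ 2 * q ^ 2 * (q * z) ^ (k + 1) *
      (((q : ℝ)⁻¹) ^ a * ((q : ℝ)⁻¹) ^ b) := by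
    rw [← pow_add, hk, mul_pow, inv_pow]
    field_simp
    ring
  rw [h3] at h1
  exact h1.trans (by gcongr)

lemma pow_card_le_two {x : ℝ} {q a : ℕ} (hq : 1 ≤ q) (hx : 0 ≤ x) (hz : q * x ≤ 1) (ha : 2 ≤ a) :
    x ^ a ≤ x ^ 2 * q ^ 2 * ((q : ℝ)⁻¹) ^ a := by
  have hq0 : (0 : ℝ) < q := by exact_mod_cast hq
  obtain ⟨a, rfl⟩ : ∃ a', a = a' + 2 := ⟨a - 2, by omega⟩
  have h2 : (q * x) ^ a ≤ 1 := pow_le_one₀ (by positivity) hz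
  have h3 : x ^ (a + 2) = x ^ 2 * q ^ 2 * ((q : ℝ)⁻¹) ^ (a + 2) * (q * x) ^ a := by
    rw [mul_pow, inv_pow]
    field_simp
    ring
  rw [h3]
  exact mul_le_of_le_one_right (by positivity) h2

/-- The dominating function in `abs_sum_top_le`. -/
noncomputable def topBound {m q : ℕ} (L N : ℕ) (x z γ : ℝ) (u : Fin q → ℝ) (U : Finset (Fin q))
    (yb : Fin q → ℕ → ℝ) : ℝ :=
  (∏ t, u t) * (∑ a : Fin m, ∑ P : Finset (Fin q), ∑ P' : Finset (Fin q),
      x ^ 2 * q ^ 2 * (q * z) * (((q : ℝ)⁻¹) ^ P.card * ((q : ℝ)⁻¹) ^ P'.card) *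
        |∏ t ∈ (P ∪ P')ᶜ \ U, (1 + yb t ((a : ℕ) / L))|
    + ∑ P ∈ (Finset.univ : Finset (Finset (Fin q))).filter (fun P => P.card = 2),
      ∑ β ∈ Finset.range N, γ * |∏ t ∈ Pᶜ \ U, (1 + yb t β)|)

/-- The sum over the common top level `a` and over the set `P` of at least two factors attaining
it. Freezing the dependence of the other factors on `a` inside blocks of length `L` reduces the
critical case `#P = 2` to the correlations bounded by `γ`; all remaining terms carry an additional
small factor. -/
lemma abs_sum_top_le {m q L N : ℕ} (hN : ∀ a : Fin m, (a : ℕ) / L < N) {x z γ : ℝ} (hq : 1 ≤ q)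
    {u ν : Fin q → ℝ} {U : Finset (Fin q)} {xx zz : Fin q → Fin m → ℝ} {yb : Fin q → ℕ → ℝ}
    (hx : 0 ≤ x) (hxz : x ≤ z) (hz : q * z ≤ 1) (hu : ∀ t, 0 ≤ u t) (huU : ∀ t ∉ U, u t = 1)
    (hνU : ∀ t ∈ U, ν t = 0) (hν : ∀ t ∉ U, ν t = 1)
    (h1 : ∀ t a, |xx t a| ≤ x * u t) (h2 : ∀ t ∈ U, ∀ β, |yb t β| ≤ u t)
    (h3 : ∀ t a, |zz t a| ≤ z * u t)
    (h4 : ∀ t t', t ≠ t' → ∀ β, |∑ a ∈ Finset.univ.filter (fun a : Fin m => (a : ℕ) / L = β),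
      xx t a * xx t' a| ≤ γ * (u t * u t')) :
    |∑ a : Fin m, ∑ P ∈ (Finset.univ : Finset (Finset (Fin q))).filter (fun P => 2 ≤ P.card),
      (∏ t ∈ P, xx t a) * ∏ t ∈ Pᶜ, (ν t + (yb t ((a : ℕ) / L) + zz t a))|
      ≤ topBound (m := m) L N x z γ u U yb := by
  have hz0 : 0 ≤ z := hx.trans hxz
  -- the factors not involved in the coincidence
  have hrest : ∀ (V : Finset (Fin q)) (β : ℕ), |∏ t ∈ Vᶜ, (ν t + yb t β)|
      ≤ (∏ t ∈ Vᶜ, u t) * |∏ t ∈ Vᶜ \ U, (1 + yb t β)| := by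
    intro V β
    rw [Finset.abs_prod, Finset.abs_prod, ← Finset.prod_sdiff (Finset.sdiff_subset (s := Vᶜ) (t := U)),
      ← Finset.prod_sdiff (f := u) (Finset.sdiff_subset (s := Vᶜ) (t := U)), mul_assoc]
    refine mul_le_mul ?_ ?_ (Finset.prod_nonneg fun _ _ => abs_nonneg _)
      (Finset.prod_nonneg fun t _ => hu t)
    · refine Finset.prod_le_prod (fun _ _ => abs_nonneg _) fun t ht => ?_
      have htU : t ∈ U := by
        simp only [Finset.mem_sdiff, not_and, not_not] at ht
        exact ht.2 ht.1
      rw [hνU t htU, zero_add]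
      exact h2 t htU β
    · rw [← Finset.prod_mul_distrib]
      refine Finset.prod_le_prod (fun _ _ => abs_nonneg _) fun t ht => ?_
      rw [hν t (Finset.mem_sdiff.1 ht).2, huU t (Finset.mem_sdiff.1 ht).2, one_mul]
  set term : Fin m → Finset (Fin q) → Finset (Fin q) → ℝ := fun a P P' =>
    (∏ t ∈ P, xx t a) * ((∏ t ∈ P', zz t a) * ∏ t ∈ Pᶜ \ P', (ν t + yb t ((a : ℕ) / L))) with hterm
  have hexp : ∀ a P, (∏ t ∈ P, xx t a) * ∏ t ∈ Pᶜ, (ν t + (yb t ((a : ℕ) / L) + zz t a))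
      = ∑ P' ∈ Pᶜ.powerset, term a P P' := by
    intro a P
    simp only [hterm]
    rw [← Finset.mul_sum, ← Finset.prod_add]
    congr 1
    exact Finset.prod_congr rfl fun t _ => by ring
  have hsplit : ∀ a P, ∑ P' ∈ Pᶜ.powerset, term a P P'
      = (if P.card = 2 then term a P ∅ else 0)
        + ∑ P' ∈ Pᶜ.powerset, if P.card = 2 ∧ P' = ∅ then 0 else term a P P' := by
    intro a P
    have : ∀ P' ∈ Pᶜ.powerset, term a P P' = (if P' = ∅ then (if P.card = 2 then term a P ∅ else 0)
        else 0) + if P.card = 2 ∧ P' = ∅ then 0 else term a P P' := by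
      intro P' _
      by_cases hc : P.card = 2 <;> by_cases hP' : P' = ∅ <;> simp [hc, hP']
    rw [Finset.sum_congr rfl this, Finset.sum_add_distrib, Finset.sum_ite_eq',
      if_pos (Finset.empty_mem_powerset _)]
  have hbound : ∀ a P P', P' ∈ Pᶜ.powerset → |term a P P'| ≤ (∏ t, u t) * (x ^ P.card * z ^ P'.card *
      |∏ t ∈ (P ∪ P')ᶜ \ U, (1 + yb t ((a : ℕ) / L))|) := by
    intro a P P' hP'
    have hsub := Finset.mem_powerset.1 hP'
    have hV : Pᶜ \ P' = (P ∪ P')ᶜ := by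
      ext t; simp
    have hu3 : ∏ t, u t = (∏ t ∈ P, u t) * ((∏ t ∈ P', u t) * ∏ t ∈ Pᶜ \ P', u t) := by
      rw [mul_comm (∏ t ∈ P', u t), Finset.prod_sdiff hsub, Finset.prod_mul_prod_compl]
    simp only [hterm]
    rw [abs_mul, abs_mul, Finset.abs_prod, Finset.abs_prod, hu3]
    have b1 : ∏ t ∈ P, |xx t a| ≤ x ^ P.card * ∏ t ∈ P, u t := by
      rw [← Finset.prod_const, ← Finset.prod_mul_distrib]
      exact Finset.prod_le_prod (fun _ _ => abs_nonneg _) fun t _ => h1 t a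
    have b2 : ∏ t ∈ P', |zz t a| ≤ z ^ P'.card * ∏ t ∈ P', u t := by
      rw [← Finset.prod_const, ← Finset.prod_mul_distrib]
      exact Finset.prod_le_prod (fun _ _ => abs_nonneg _) fun t _ => h3 t a
    have b3 := hrest (P ∪ P') ((a : ℕ) / L)
    rw [← hV] at b3 ⊢
    have p1 : 0 ≤ ∏ t ∈ P, u t := Finset.prod_nonneg fun t _ => hu t
    have p2 : 0 ≤ ∏ t ∈ P', u t := Finset.prod_nonneg fun t _ => hu t
    calc _ ≤ (x ^ P.card * ∏ t ∈ P, u t) * ((z ^ P'.card * ∏ t ∈ P', u t) *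
          ((∏ t ∈ Pᶜ \ P', u t) * |∏ t ∈ (Pᶜ \ P') \ U, (1 + yb t ((a : ℕ) / L))|)) := by
          gcongr
      _ = _ := by ring
  have hW : 0 ≤ ∏ t, u t := Finset.prod_nonneg fun t _ => hu t
  simp only [hexp, hsplit, Finset.sum_add_distrib]
  rw [topBound, mul_add, add_comm ((∏ t, u t) * _)]
  refine (abs_add_le _ _).trans (add_le_add ?_ ?_)
  · -- exactly two factors with the common top level
    have e1 : ∑ a : Fin m, ∑ P ∈ (Finset.univ : Finset (Finset (Fin q))).filter (fun P => 2 ≤ P.card),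
        (if P.card = 2 then term a P ∅ else 0)
        = ∑ P ∈ (Finset.univ : Finset (Finset (Fin q))).filter (fun P => P.card = 2),
          ∑ β ∈ Finset.range N, ∑ a ∈ Finset.univ.filter (fun a : Fin m => (a : ℕ) / L = β),
            (∏ t ∈ P, xx t a) * ∏ t ∈ Pᶜ, (ν t + yb t β) := by
      rw [Finset.sum_comm, ← Finset.sum_subset (s₁ := (Finset.univ : Finset (Finset (Fin q))).filter
        fun P => P.card = 2)]
      · refine Finset.sum_congr rfl fun P hP => ?_
        have hc : P.card = 2 := (Finset.mem_filter.1 hP).2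
        rw [← Finset.sum_fiberwise_of_maps_to (s := (Finset.univ : Finset (Fin m)))
          (t := Finset.range N) (g := fun a : Fin m => (a : ℕ) / L)
          (fun a _ => Finset.mem_range.2 (hN a))]
        refine Finset.sum_congr rfl fun β _ => Finset.sum_congr rfl fun a ha => ?_
        simp only [hc, if_true, hterm, Finset.prod_empty, one_mul, Finset.sdiff_empty,
          (Finset.mem_filter.1 ha).2]
      · intro P hP
        have hc : P.card = 2 := (Finset.mem_filter.1 hP).2
        exact Finset.mem_filter.2 ⟨Finset.mem_univ _, hc.ge⟩
      · intro P _ hP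
        have hc : P.card ≠ 2 := fun h => hP (Finset.mem_filter.2 ⟨Finset.mem_univ _, h⟩)
        simp [hc]
    rw [e1, Finset.mul_sum]
    refine (Finset.abs_sum_le_sum_abs _ _).trans (Finset.sum_le_sum fun P hP => ?_)
    rw [Finset.mul_sum]
    refine (Finset.abs_sum_le_sum_abs _ _).trans (Finset.sum_le_sum fun β _ => ?_)
    obtain ⟨t, t', htt, rfl⟩ := Finset.card_eq_two.1 (Finset.mem_filter.1 hP).2
    rw [← Finset.sum_mul, abs_mul]
    simp only [Finset.prod_pair htt]
    have b3 := hrest {t, t'} β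
    have hu2 : ∏ t, u t = (u t * u t') * ∏ t ∈ ({t, t'} : Finset (Fin q))ᶜ, u t := by
      rw [← Finset.prod_pair htt, Finset.prod_mul_prod_compl]
    rw [hu2]
    calc _ ≤ (γ * (u t * u t')) * ((∏ t ∈ ({t, t'} : Finset (Fin q))ᶜ, u t) *
          |∏ t ∈ ({t, t'} : Finset (Fin q))ᶜ \ U, (1 + yb t β)|) :=
          mul_le_mul (h4 t t' htt β) b3 (abs_nonneg _) ((abs_nonneg _).trans (h4 t t' htt β))
      _ = _ := by ring
  · -- three factors with the common top level, or one more factor with a level in the same block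
    rw [Finset.mul_sum]
    refine (Finset.abs_sum_le_sum_abs _ _).trans (Finset.sum_le_sum fun a _ => ?_)
    rw [Finset.mul_sum]
    refine (Finset.abs_sum_le_sum_abs _ _).trans ?_
    have hnn : ∀ P P' : Finset (Fin q), 0 ≤ (∏ t, u t) * (x ^ 2 * q ^ 2 * (q * z) *
        (((q : ℝ)⁻¹) ^ P.card * ((q : ℝ)⁻¹) ^ P'.card) *
        |∏ t ∈ (P ∪ P')ᶜ \ U, (1 + yb t ((a : ℕ) / L))|) := fun P P' => by positivity
    refine le_trans (Finset.sum_le_sum fun P hP => ?_) (Finset.sum_le_sum_of_subset_of_nonneg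
      (Finset.filter_subset (fun P : Finset (Fin q) => 2 ≤ P.card) _) fun P _ _ => by
        rw [Finset.mul_sum]; exact Finset.sum_nonneg fun P' _ => hnn P P')
    rw [Finset.mul_sum]
    refine (Finset.abs_sum_le_sum_abs _ _).trans ?_
    refine le_trans (Finset.sum_le_sum fun P' hP' => ?_) (Finset.sum_le_sum_of_subset_of_nonneg
      (Finset.subset_univ _) fun P' _ _ => hnn P P')
    have hc : 2 ≤ P.card := (Finset.mem_filter.1 hP).2
    split_ifs with hmain
    · rw [abs_zero]; exact hnn P P'
    · refine (hbound a P P' hP').trans (mul_le_mul_of_nonneg_left ?_ hW)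
      refine mul_le_mul_of_nonneg_right (pow_card_le hq hx hxz hz hc ?_) (abs_nonneg _)
      by_cases hc2 : P.card = 2
      · have : P' ≠ ∅ := fun h => hmain ⟨hc2, h⟩
        have := Finset.card_pos.2 (Finset.nonempty_iff_ne_empty.2 this)
        omega
      · omega

/-- The average of the dominating function of `abs_sum_top_le`. -/
lemma avg_topBound_le {d m q L N : ℕ} {x z γ : ℝ} (hq : 1 ≤ q) {u : Fin q → ℝ} {U : Finset (Fin q)}
    {yb : Dig d m → Fin q → ℕ → ℝ} (hz : 0 ≤ z) (hγ : 0 ≤ γ) (hu : ∀ t, 0 ≤ u t)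
    (h : ∀ (V : Finset (Fin q)) (β : ℕ), Disjoint V U →
      avg (fun ω => |∏ t ∈ V, (1 + yb ω t β)|) ≤ 2) :
    avg (fun ω => topBound (m := m) L N x z γ u U (yb ω))
      ≤ (∏ t, u t) * (18 * m * x ^ 2 * q ^ 3 * z + 2 * N * q ^ 2 * γ) := by
  unfold topBound
  rw [avg_const_mul, avg_add, avg_sum, avg_sum]
  refine mul_le_mul_of_nonneg_left (add_le_add ?_ ?_) (Finset.prod_nonneg fun t _ => hu t)
  · have h1 : ∀ a : Fin m, avg (fun ω => ∑ P : Finset (Fin q), ∑ P' : Finset (Fin q),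
        x ^ 2 * q ^ 2 * (q * z) * (((q : ℝ)⁻¹) ^ P.card * ((q : ℝ)⁻¹) ^ P'.card) *
        |∏ t ∈ (P ∪ P')ᶜ \ U, (1 + yb ω t ((a : ℕ) / L))|) ≤ 18 * x ^ 2 * q ^ 3 * z := by
      intro a
      rw [avg_sum]
      have h2 : ∀ P : Finset (Fin q), avg (fun ω => ∑ P' : Finset (Fin q),
        x ^ 2 * q ^ 2 * (q * z) * (((q : ℝ)⁻¹) ^ P.card * ((q : ℝ)⁻¹) ^ P'.card) *
        |∏ t ∈ (P ∪ P')ᶜ \ U, (1 + yb ω t ((a : ℕ) / L))|)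
        ≤ ∑ P' : Finset (Fin q), x ^ 2 * q ^ 2 * (q * z) *
          (((q : ℝ)⁻¹) ^ P.card * ((q : ℝ)⁻¹) ^ P'.card) * 2 := by
        intro P
        rw [avg_sum]
        refine Finset.sum_le_sum fun P' _ => ?_
        rw [avg_const_mul]
        exact mul_le_mul_of_nonneg_left (h _ _ Finset.sdiff_disjoint) (by positivity)
      refine (Finset.sum_le_sum fun P _ => h2 P).trans ?_
      have h3 := sum_inv_pow_card_le hq
      set s : ℝ := ∑ P : Finset (Fin q), ((q : ℝ)⁻¹) ^ P.card with hs
      have hs0 : 0 ≤ s := Finset.sum_nonneg fun P _ => by positivity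
      have e : ∑ P : Finset (Fin q), ∑ P' : Finset (Fin q), x ^ 2 * q ^ 2 * (q * z) *
          (((q : ℝ)⁻¹) ^ P.card * ((q : ℝ)⁻¹) ^ P'.card) * 2
          = (2 * (x ^ 2 * q ^ 3 * z)) * (s * s) := by
        rw [hs, Finset.sum_mul_sum, Finset.mul_sum]
        refine Finset.sum_congr rfl fun P _ => ?_
        rw [Finset.mul_sum]
        exact Finset.sum_congr rfl fun P' _ => by ring
      rw [e]
      calc (2 * (x ^ 2 * q ^ 3 * z)) * (s * s) ≤ (2 * (x ^ 2 * q ^ 3 * z)) * (3 * 3) := by gcongr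
        _ = _ := by ring
    refine (Finset.sum_le_sum fun a _ => h1 a).trans (le_of_eq ?_)
    simp; ring
  · have h1 : ∀ P : Finset (Fin q), avg (fun ω => ∑ β ∈ Finset.range N,
        γ * |∏ t ∈ Pᶜ \ U, (1 + yb ω t β)|) ≤ 2 * N * γ := by
      intro P
      rw [avg_sum]
      have : ∀ β ∈ Finset.range N, avg (fun ω => γ * |∏ t ∈ Pᶜ \ U, (1 + yb ω t β)|) ≤ γ * 2 := by
        intro β _
        rw [avg_const_mul]
        exact mul_le_mul_of_nonneg_left (h _ _ Finset.sdiff_disjoint) hγ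
      refine (Finset.sum_le_sum this).trans (le_of_eq ?_)
      simp; ring
    refine (Finset.sum_le_sum fun P _ => h1 P).trans ?_
    rw [Finset.sum_const, nsmul_eq_mul]
    have hc : (((Finset.univ : Finset (Finset (Fin q))).filter fun P => P.card = 2).card : ℝ)
        ≤ q ^ 2 := by
      have : (Finset.univ : Finset (Finset (Fin q))).filter (fun P => P.card = 2)
          = Finset.powersetCard 2 Finset.univ := by
        ext P; simp [Finset.mem_powersetCard]
      rw [this, Finset.card_powersetCard, Finset.card_univ, Fintype.card_fin]
      exact_mod_cast Nat.choose_le_pow q 2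
    calc _ ≤ (q : ℝ) ^ 2 * (2 * N * γ) := by gcongr
      _ = _ := by ring

end Expansion

/-! ### Labels prescribing coincidences -/

section Labels

open Function

/-- A label for one coordinate: either no condition, or a level `a` together with the set of
factors whose level in this coordinate equals `a`, all other factors having smaller level. -/
abbrev Label (m q : ℕ) := Option (Fin m × Finset (Fin q))

/-- The levels that a label allows to the factor `t`. -/
def slot {m q : ℕ} : Label m q → Fin q → Finset (Fin m)
  | none, _ => Finset.univ
  | some p, t => if t ∈ p.2 then {p.1} else Finset.Iio p.1

/-- The factors attaining the level prescribed by a label. -/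
def topSet {m q : ℕ} : Label m q → Finset (Fin q)
  | none => ∅
  | some p => p.2

@[simp] lemma topSet_none {m q : ℕ} : topSet (none : Label m q) = ∅ := rfl

@[simp] lemma topSet_some {m q : ℕ} (p : Fin m × Finset (Fin q)) :
    topSet (some p : Label m q) = p.2 := rfl

/-- The box of levels of the factor `t`: in the coordinate `v` the levels are those in `I t`, in the
other coordinates they are prescribed by the labels. -/
def labelBox {d m q : ℕ} (v : Fin d) (I : Fin q → Finset (Fin m)) (σ : Fin d → Label m q)
    (t : Fin q) : Fin d → Finset (Fin m) :=
  update (fun j => slot (σ j) t) v (I t)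

/-- The number of coordinates in which the level of the factor `t` is prescribed. -/
def labelDeg {d m q : ℕ} (σ : Fin d → Label m q) (t : Fin q) : ℕ :=
  (Finset.univ.filter fun j => t ∈ topSet (σ j)).card

/-- The coordinates other than `j₀` in which the level of the factor `t` is not prescribed. -/
def liveSet {d m q : ℕ} (j₀ : Fin d) (σ : Fin d → Label m q) (t : Fin q) : Finset (Fin d) :=
  Finset.univ.filter fun j => j ≠ j₀ ∧ t ∉ topSet (σ j)

variable {d m q n : ℕ} {f : (Fin d → Fin m) → Dig d m → ℝ} {v j₀ : Fin d}
  {I : Fin q → Finset (Fin m)} {σ : Fin d → Label m q}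

lemma card_slot_of_mem {s : Label m q} {t : Fin q} (h : t ∈ topSet s) : (slot s t).card ≤ 1 := by
  cases s with
  | none => simp at h
  | some p =>
    have h' : t ∈ p.2 := h
    simp [slot, h']

lemma card_liveSet_add (h0 : σ j₀ = none) (t : Fin q) :
    (liveSet j₀ σ t).card + 1 + labelDeg σ t = d := by
  have h1 : (Finset.univ.filter fun j => t ∉ topSet (σ j)) = insert j₀ (liveSet j₀ σ t) := by
    ext j
    by_cases hj : j = j₀
    · subst hj; simp [liveSet, h0]
    · simp [liveSet, hj]
  have h2 : j₀ ∉ liveSet j₀ σ t := by simp [liveSet]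
  have h3 := Finset.card_filter_add_card_filter_not (s := (Finset.univ : Finset (Fin d)))
    (fun j => t ∈ topSet (σ j))
  rw [h1, Finset.card_insert_of_notMem h2, Finset.card_univ, Fintype.card_fin] at h3
  unfold labelDeg
  omega

lemma mem_liveSet_of_eq_none (hv : σ v = none) (hjv : j₀ ≠ v) (t : Fin q) : v ∈ liveSet j₀ σ t := by
  simp [liveSet, hv, hjv.symm]

lemma labelDeg_add_two_le (h0 : σ j₀ = none) (hv : σ v = none) (hjv : j₀ ≠ v) (t : Fin q) :
    labelDeg σ t + 2 ≤ d := by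
  have h1 := card_liveSet_add h0 t
  have h2 := Finset.card_pos.2 ⟨v, mem_liveSet_of_eq_none hv hjv t⟩
  omega

lemma card_labelBox_le (hv : σ v = none) {t : Fin q} {j : Fin d} (hj : j ∉ liveSet j₀ σ t)
    (hj0 : j ≠ j₀) : (labelBox v I σ t j).card ≤ 1 := by
  have h : t ∈ topSet (σ j) := by
    by_contra h
    exact hj (by simp [liveSet, hj0, h])
  have hjv : j ≠ v := by rintro rfl; simp [hv] at h
  rw [labelBox, update_of_ne hjv]
  exact card_slot_of_mem h

/-- The constants in `exists_owp_pair_le_of` can be chosen independently of the number of free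
coordinates. -/
lemma exists_owp_pair_le (d : ℕ) :
    ∃ c e : ℕ, ∀ k, k + 2 ≤ d → ∀ (m n y : ℕ) (lam : ℝ) (f : (Fin d → Fin m) → Dig d m → ℝ),
    2 ≤ m → 2 ≤ lam → 1 ≤ y → (y ^ 2 ^ (d + 1)) ^ 4 ≤ m → IsHaarFamily f →
    ∀ (k' : ℕ) (W W' : Finset (Fin d)) (J J' : Fin d → Finset (Fin m)) (v w : Fin d)
      (C : Finset (Fin m)), W.card = k + 1 → W'.card = k' + 1 → k' ≤ d → w ∈ W → v ∉ W →
      (∀ j ∉ W, j ≠ v → (J j).card ≤ 1) → (∀ j ∉ W', j ≠ v → (J' j).card ≤ 1) →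
      (∀ l ∈ J w, ∀ l' ∈ J' w, l' < l) → C.card ≤ y ^ 2 ^ (d + 1) →
      Owp lam c fun ω => |∑ a ∈ C, hyp n f (update J v {a}) ω * hyp n f (update J' v {a}) ω|
          ≤ lam ^ e * (√m ^ k * √m ^ k') * (y : ℝ) ^ 2 ^ (d + 1) / y := by
  have h0 : ∀ k, ∃ c e : ℕ, k + 2 ≤ d → ∀ (m n y : ℕ) (lam : ℝ)
      (f : (Fin d → Fin m) → Dig d m → ℝ),
      2 ≤ m → 2 ≤ lam → 1 ≤ y → (y ^ 2 ^ (d + 1)) ^ 4 ≤ m → IsHaarFamily f →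
      ∀ (k' : ℕ) (W W' : Finset (Fin d)) (J J' : Fin d → Finset (Fin m)) (v w : Fin d)
      (C : Finset (Fin m)), W.card = k + 1 → W'.card = k' + 1 → k' ≤ d → w ∈ W → v ∉ W →
      (∀ j ∉ W, j ≠ v → (J j).card ≤ 1) → (∀ j ∉ W', j ≠ v → (J' j).card ≤ 1) →
      (∀ l ∈ J w, ∀ l' ∈ J' w, l' < l) → C.card ≤ y ^ 2 ^ (d + 1) →
      Owp lam c fun ω => |∑ a ∈ C, hyp n f (update J v {a}) ω * hyp n f (update J' v {a}) ω|
          ≤ lam ^ e * (√m ^ k * √m ^ k') * (y : ℝ) ^ 2 ^ (d + 1) / y := by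
    intro k
    by_cases hk : k + 2 ≤ d
    · obtain ⟨c, e, h⟩ := exists_owp_pair_le_of d k hk
      exact ⟨c, e, fun _ => h⟩
    · exact ⟨0, 0, fun h => absurd h hk⟩
  choose c e h using h0
  refine ⟨∑ k ∈ Finset.range d, c k, ∑ k ∈ Finset.range d, e k, ?_⟩
  intro k hk m n y lam f hm hlam hy hym hf k' W W' J J' v w C h1 h2 h3 h4 h5 h6 h7 h8 h9
  have hkd : k ∈ Finset.range d := Finset.mem_range.2 (by omega)
  refine ((h k hk m n y lam f hm hlam hy hym hf k' W W' J J' v w C h1 h2 h3 h4 h5 h6 h7 h8 h9).mono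
    (by omega) (Finset.single_le_sum (fun _ _ => Nat.zero_le _) hkd)).imp fun ω hω => hω.trans ?_
  have : lam ^ e k ≤ lam ^ ∑ k ∈ Finset.range d, e k :=
    pow_le_pow_right₀ (by linarith) (Finset.single_le_sum (fun _ _ => Nat.zero_le _) hkd)
  gcongr

/-- The levels below the block with index `β`. -/
def cutBelow (m L β : ℕ) : Finset (Fin m) := Finset.univ.filter fun l => (l : ℕ) < L * β

/-- The levels in the block with index `β`. -/
def blockAt (m L β : ℕ) : Finset (Fin m) := Finset.univ.filter fun l => (l : ℕ) / L = β

lemma card_blockAt_le {L : ℕ} (hL : 0 < L) (β : ℕ) : (blockAt m L β).card ≤ L := by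
  have : (blockAt m L β).image (fun l : Fin m => (l : ℕ)) ⊆ Finset.Ico (β * L) ((β + 1) * L) := by
    intro l hl
    obtain ⟨l, hl', rfl⟩ := Finset.mem_image.1 hl
    have := (Finset.mem_filter.1 hl').2
    rw [Nat.div_eq_iff hL] at this
    rw [Finset.mem_Ico]
    have h2 : (β + 1) * L = β * L + L := by ring
    omega
  have h := Finset.card_le_card this
  rw [Finset.card_image_of_injective _ Fin.val_injective, Nat.card_Ico, add_mul, one_mul] at h
  omega

lemma cutBelow_eq_min {L : ℕ} (hL : 0 < L) (β : ℕ) : cutBelow m L β = cutBelow m L (min β m) := by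
  rcases le_total β m with h | h
  · rw [min_eq_left h]
  · rw [min_eq_right h]
    ext l
    simp only [cutBelow, Finset.mem_filter, Finset.mem_univ, true_and]
    have h1 : (l : ℕ) < L * m := l.2.trans_le (Nat.le_mul_of_pos_left _ hL)
    exact ⟨fun _ => h1, fun _ => h1.trans_le (Nat.mul_le_mul_left _ h)⟩

lemma blockAt_eq_empty {L β : ℕ} (h : m ≤ β) : blockAt m L β = ∅ := by
  refine Finset.filter_eq_empty_iff.2 fun l _ hl => ?_
  have := Nat.div_le_self (l : ℕ) L
  have := l.2
  omega

/-- The bounds on the random sums that enter the expansion around a tuple of labels. -/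
def LabelGood (n : ℕ) (f : (Fin d → Fin m) → Dig d m → ℝ) (y e : ℕ) (lam : ℝ) (v j₀ : Fin d)
    (I : Fin q → Finset (Fin m)) (σ : Fin d → Label m q) (ω : Dig d m) : Prop :=
  (∀ t a, |hyp n f (update (labelBox v I σ t) j₀ {a}) ω| ≤ lam ^ d * √m ^ (d - 2 - labelDeg σ t)) ∧
  (∀ t β, |hyp n f (update (labelBox v I σ t) j₀ (cutBelow m (y ^ 2 ^ (d + 1)) β)) ω|
    ≤ lam ^ d * √m ^ (d - 1 - labelDeg σ t)) ∧
  ∀ t t', t ≠ t' → ∀ β, |∑ a ∈ blockAt m (y ^ 2 ^ (d + 1)) β,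
      hyp n f (update (labelBox v I σ t) j₀ {a}) ω * hyp n f (update (labelBox v I σ t') j₀ {a}) ω|
    ≤ lam ^ e * (√m ^ (d - 2 - labelDeg σ t) * √m ^ (d - 2 - labelDeg σ t')) *
      (y : ℝ) ^ 2 ^ (d + 1) / y

lemma exists_owp_labelGood (d : ℕ) :
    ∃ c e : ℕ, ∀ (m n y q : ℕ) (lam : ℝ) (f : (Fin d → Fin m) → Dig d m → ℝ) (v j₀ : Fin d)
      (I : Fin q → Finset (Fin m)) (σ : Fin d → Label m q),
    2 ≤ m → 2 ≤ lam → 1 ≤ y → (y ^ 2 ^ (d + 1)) ^ 4 ≤ m → IsHaarFamily f → q ≤ m →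
    (∀ t t', t < t' → ∀ l ∈ I t, ∀ l' ∈ I t', l < l') → j₀ ≠ v → σ j₀ = none → σ v = none →
    Owp lam c (LabelGood n f y e lam v j₀ I σ) := by
  obtain ⟨c, e, hpair⟩ := exists_owp_pair_le d
  refine ⟨4 + (2 * d + c) + 2, e, ?_⟩
  intro m n y q lam f v j₀ I σ hm hlam hy hym hf hq hsep hjv h0 hv
  have hL : 0 < y ^ 2 ^ (d + 1) := by positivity
  have hlam1 : 1 ≤ lam := by linarith
  have hm1 : 1 ≤ m := by omega
  have hqm : ((Finset.univ : Finset (Fin q)).card : ℝ) ≤ (m : ℝ) ^ 1 := by simpa using hq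
  have hrm : ((Finset.range (m + 1)).card : ℝ) ≤ (m : ℝ) ^ 2 := by
    rw [Finset.card_range]; exact_mod_cast (by nlinarith : m + 1 ≤ m ^ 2)
  have hrm' : ((Finset.range m).card : ℝ) ≤ (m : ℝ) ^ 1 := by simp
  have hcl := fun t => card_liveSet_add (σ := σ) h0 t
  have hdeg := fun t => labelDeg_add_two_le (σ := σ) h0 hv hjv t
  have A : Owp lam (1 + (1 + 2 * d)) fun ω => ∀ t ∈ (Finset.univ : Finset (Fin q)),
      ∀ a ∈ (Finset.univ : Finset (Fin m)),
      |hyp n f (update (labelBox v I σ t) j₀ {a}) ω|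
        ≤ lam ^ d * √m ^ (d - 2 - labelDeg σ t) := by
    refine Owp.forall_mem hqm fun t _ => Owp.forall_mem (card_level_le _) fun a _ => ?_
    refine ((owp_abs_hyp_le hf hlam1 hm (liveSet j₀ σ t).card (liveSet j₀ σ t) _ rfl ?_).mono hm1
      (by have := hcl t; omega)).imp fun ω hω => hω.trans ?_
    · intro j hj
      by_cases hj0 : j = j₀
      · subst hj0; simp
      · rw [update_of_ne hj0]; exact card_labelBox_le hv hj hj0
    · have : (liveSet j₀ σ t).card - 1 = d - 2 - labelDeg σ t := by have := hcl t; omega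
      rw [this]
      refine mul_le_mul_of_nonneg_right (pow_le_pow_right₀ hlam1 ?_) (by positivity)
      have := hcl t; omega
  have B : Owp lam (1 + (2 + 2 * d)) fun ω => ∀ t ∈ (Finset.univ : Finset (Fin q)),
      ∀ β ∈ Finset.range (m + 1),
      |hyp n f (update (labelBox v I σ t) j₀ (cutBelow m (y ^ 2 ^ (d + 1)) β)) ω|
        ≤ lam ^ d * √m ^ (d - 1 - labelDeg σ t) := by
    refine Owp.forall_mem hqm fun t _ => Owp.forall_mem hrm fun β _ => ?_
    have hc : (insert j₀ (liveSet j₀ σ t)).card = (liveSet j₀ σ t).card + 1 :=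
      Finset.card_insert_of_notMem (by simp [liveSet])
    refine ((owp_abs_hyp_le hf hlam1 hm _ (insert j₀ (liveSet j₀ σ t)) _ rfl ?_).mono hm1
      (by rw [hc]; have := hcl t; omega)).imp fun ω hω => hω.trans ?_
    · intro j hj
      rw [Finset.mem_insert, not_or] at hj
      rw [update_of_ne hj.1]; exact card_labelBox_le hv hj.2 hj.1
    · have : (insert j₀ (liveSet j₀ σ t)).card - 1 = d - 1 - labelDeg σ t := by
        rw [hc]; have := hcl t; omega
      rw [this]
      refine mul_le_mul_of_nonneg_right (pow_le_pow_right₀ hlam1 ?_) (by positivity)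
      rw [hc]; have := hcl t; omega
  have Cc : Owp lam (1 + (1 + (1 + c))) fun ω => ∀ t ∈ (Finset.univ : Finset (Fin q)),
      ∀ t' ∈ (Finset.univ : Finset (Fin q)), ∀ β ∈ Finset.range m, t ≠ t' →
      |∑ a ∈ blockAt m (y ^ 2 ^ (d + 1)) β,
      hyp n f (update (labelBox v I σ t) j₀ {a}) ω * hyp n f (update (labelBox v I σ t') j₀ {a}) ω|
    ≤ lam ^ e * (√m ^ (d - 2 - labelDeg σ t) * √m ^ (d - 2 - labelDeg σ t')) *
      (y : ℝ) ^ 2 ^ (d + 1) / y := by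
    refine Owp.forall_mem hqm fun t _ => Owp.forall_mem hqm fun t' _ => Owp.forall_mem hrm'
      fun β _ => ?_
    have key : ∀ t t' : Fin q, t' < t → Owp lam c fun ω => |∑ a ∈ blockAt m (y ^ 2 ^ (d + 1)) β,
      hyp n f (update (labelBox v I σ t) j₀ {a}) ω * hyp n f (update (labelBox v I σ t') j₀ {a}) ω|
      ≤ lam ^ e * (√m ^ (d - 2 - labelDeg σ t) * √m ^ (d - 2 - labelDeg σ t')) *
      (y : ℝ) ^ 2 ^ (d + 1) / y := by
      intro t t' htt
      have g1 := hcl t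
      have g2 := hcl t'
      have g3 := hdeg t
      have g4 := hdeg t'
      refine hpair (d - 2 - labelDeg σ t) (by omega) m n y lam f hm hlam hy hym hf
        (d - 2 - labelDeg σ t') (liveSet j₀ σ t) (liveSet j₀ σ t') _ _ j₀ v _ (by omega) (by omega)
        (by omega) (mem_liveSet_of_eq_none hv hjv t) (by simp [liveSet])
        (fun j hj hj0 => card_labelBox_le hv hj hj0) (fun j hj hj0 => card_labelBox_le hv hj hj0)
        ?_ (card_blockAt_le hL β)
      intro l hl l' hl'
      simp only [labelBox, update_self] at hl hl'
      exact hsep _ _ htt _ hl' _ hl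
    rcases lt_trichotomy t' t with h | h | h
    · exact (key t t' h).imp fun ω hω _ => hω
    · exact Owp.of_forall fun ω hne => absurd h.symm hne
    · refine (key t' t h).imp fun ω hω _ => ?_
      have e1 : ∀ a, hyp n f (update (labelBox v I σ t) j₀ {a}) ω *
          hyp n f (update (labelBox v I σ t') j₀ {a}) ω
          = hyp n f (update (labelBox v I σ t') j₀ {a}) ω *
          hyp n f (update (labelBox v I σ t) j₀ {a}) ω := fun a => mul_comm _ _
      simp only [e1]
      rwa [mul_comm (√m ^ (d - 2 - labelDeg σ t))]
  refine ((A.and hm (B.and hm Cc)).mono hm1 ?_).imp ?_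
  · omega
  rintro ω ⟨hA, hB, hC⟩
  refine ⟨fun t a => hA t (Finset.mem_univ _) a (Finset.mem_univ _), fun t β => ?_,
    fun t t' htt β => ?_⟩
  · rw [cutBelow_eq_min hL]
    exact hB t (Finset.mem_univ _) _ (Finset.mem_range.2 (by omega))
  · by_cases hβ : β < m
    · exact hC t (Finset.mem_univ _) t' (Finset.mem_univ _) β (Finset.mem_range.2 hβ) htt
    · rw [blockAt_eq_empty (not_lt.1 hβ), Finset.sum_empty, abs_zero]
      positivity

end Labels

section LabelSum

open Function

variable {d m q n : ℕ} {f : (Fin d → Fin m) → Dig d m → ℝ} {v j₀ : Fin d}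
  {I : Fin q → Finset (Fin m)} {σ : Fin d → Label m q}

/-- The product attached to a tuple of labels: the factors with a prescribed level lose the summand
`1`, and all sums are restricted to the levels allowed by the labels. -/
noncomputable def labelRiesz (n : ℕ) (f : (Fin d → Fin m) → Dig d m → ℝ) (τ : ℝ) (v : Fin d)
    (I : Fin q → Finset (Fin m)) (σ : Fin d → Label m q) (ω : Dig d m) : ℝ :=
  ∏ t, ((if labelDeg σ t = 0 then 1 else 0) + τ * hyp n f (labelBox v I σ t) ω)

lemma labelDeg_update_of_mem (h0 : σ j₀ = none) {p : Fin m × Finset (Fin q)} {t : Fin q}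
    (ht : t ∈ p.2) : labelDeg (update σ j₀ (some p)) t = labelDeg σ t + 1 := by
  have : (Finset.univ.filter fun j => t ∈ topSet (update σ j₀ (some p) j))
      = insert j₀ (Finset.univ.filter fun j => t ∈ topSet (σ j)) := by
    ext j
    by_cases hj : j = j₀
    · subst hj; simp [ht]
    · simp [hj]
  rw [labelDeg, this, Finset.card_insert_of_notMem (by simp [h0]), labelDeg]

lemma labelDeg_update_of_notMem (h0 : σ j₀ = none) {p : Fin m × Finset (Fin q)} {t : Fin q}
    (ht : t ∉ p.2) : labelDeg (update σ j₀ (some p)) t = labelDeg σ t := by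
  have : (Finset.univ.filter fun j => t ∈ topSet (update σ j₀ (some p) j))
      = Finset.univ.filter fun j => t ∈ topSet (σ j) := by
    ext j
    by_cases hj : j = j₀
    · subst hj; simp [ht, h0]
    · simp [hj]
  rw [labelDeg, this, labelDeg]

lemma labelBox_update (hjv : j₀ ≠ v) (p : Fin m × Finset (Fin q)) (t : Fin q) :
    labelBox v I (update σ j₀ (some p)) t
      = update (labelBox v I σ t) j₀ (if t ∈ p.2 then {p.1} else Finset.Iio p.1) := by
  funext j
  by_cases hj : j = j₀
  · subst hj; simp [labelBox, hjv, slot]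
  · by_cases hv : j = v
    · subst hv; simp [labelBox, hj]
    · simp [labelBox, hj, hv]

lemma hyp_update_Iio (J : Fin d → Finset (Fin m)) (j₀ : Fin d) (L : ℕ) (a : Fin m) (ω : Dig d m) :
    hyp n f (update J j₀ (Finset.Iio a)) ω = hyp n f (update J j₀ (cutBelow m L ((a : ℕ) / L))) ω
      + ∑ l ∈ (Finset.Iio a).filter (fun l : Fin m => ¬ (l : ℕ) < L * ((a : ℕ) / L)),
        hyp n f (update J j₀ {l}) ω := by
  rw [hyp_update, hyp_update J j₀ (cutBelow _ _ _),
    ← Finset.sum_filter_add_sum_filter_not (Finset.Iio a)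
      (fun l : Fin m => (l : ℕ) < L * ((a : ℕ) / L))]
  congr 2
  ext l
  simp only [cutBelow, Finset.mem_filter, Finset.mem_Iio, Finset.mem_univ, true_and,
    and_iff_right_iff_imp]
  intro h
  have := Nat.mul_div_le (a : ℕ) L
  exact Fin.lt_def.2 (by omega)

lemma card_Iio_filter_le {L : ℕ} (hL : 0 < L) (a : Fin m) :
    ((Finset.Iio a).filter (fun l : Fin m => ¬ (l : ℕ) < L * ((a : ℕ) / L))).card ≤ L := by
  refine (Finset.card_le_card fun l hl => ?_).trans (card_blockAt_le (m := m) hL ((a : ℕ) / L))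
  simp only [Finset.mem_filter, Finset.mem_Iio, not_lt] at hl
  simp only [blockAt, Finset.mem_filter, Finset.mem_univ, true_and]
  refine le_antisymm (Nat.div_le_div_right (Fin.le_def.1 hl.1.le)) ?_
  rw [Nat.le_div_iff_mul_le hL, mul_comm]
  exact hl.2

/-- The bound for a factor with `g` prescribed levels: each of them saves `s`. -/
lemma mul_pow_le_div_pow {τ X s B : ℝ} {D k g : ℕ} (hτB : τ * B * s ^ D ≤ X) (hX : 1 ≤ X)
    (hs : 0 < s) (hkg : k + g = D) (hg : 1 ≤ g) : τ * (B * s ^ k) ≤ (X / s) ^ g := by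
  rw [div_pow, le_div_iff₀ (by positivity)]
  calc τ * (B * s ^ k) * s ^ g = τ * B * s ^ D := by rw [← hkg, pow_add]; ring
    _ ≤ X := hτB
    _ ≤ X ^ g := le_self_pow₀ hX (by omega)

lemma abs_labelRiesz_le (hf : IsHaarFamily f) {τ : ℝ} (hτ0 : 0 ≤ τ) (hτ1 : τ ≤ 1)
    (σ : Fin d → Label m q) (ω : Dig d m) :
    |labelRiesz n f τ v I σ ω| ≤ (1 + (m : ℝ) ^ d) ^ q := by
  rw [labelRiesz, Finset.abs_prod]
  refine (Finset.prod_le_prod (g := fun _ => 1 + (m : ℝ) ^ d) (fun _ _ => abs_nonneg _)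
    fun t _ => ?_).trans_eq (by simp)
  refine (abs_add_le _ _).trans (add_le_add (by split_ifs <;> simp) ?_)
  rw [abs_mul, abs_of_nonneg hτ0]
  have := abs_hyp_le_pow (n := n) hf (labelBox v I σ t) ω
  nlinarith [abs_nonneg (hyp n f (labelBox v I σ t) ω)]

/-- The contribution of all possible coincidences in the coordinate `j₀`, for fixed labels in the
other coordinates. -/
theorem avg_abs_sum_labelRiesz_le {y c e : ℕ} {lam τ X : ℝ} (hf : IsHaarFamily f)
    (hgood : Owp lam c (LabelGood n f y e lam v j₀ I σ)) (hm : 1 ≤ m) (hlam : 1 ≤ lam)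
    (hy : 1 ≤ y) (h0 : σ j₀ = none) (hv : σ v = none) (hjv : j₀ ≠ v) (hτ0 : 0 ≤ τ) (hτ1 : τ ≤ 1)
    (hX : 1 ≤ X) (hτX : τ * lam ^ d * √m ^ (d - 1) ≤ X) (hq : 1 ≤ q)
    (hLm : y ^ 2 ^ (d + 1) ≤ m) (hz : q * ((y : ℝ) ^ 2 ^ (d + 1) * (X / √m)) ≤ 1)
    (hR : ∀ (J : Fin q → Fin d → Finset (Fin m)) (V : Finset (Fin q)), (∀ t, J t v = I t) →
      avg (fun ω => |∏ t ∈ V, (1 + τ * hyp n f (J t) ω)|) ≤ 2) :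
    avg (fun ω => |∑ a : Fin m, ∑ P ∈ (Finset.univ : Finset (Finset (Fin q))).filter
        (fun P => 2 ≤ P.card), labelRiesz n f τ v I (update σ j₀ (some (a, P))) ω|)
      ≤ (∏ t, (X / √m) ^ labelDeg σ t) *
          (18 * X ^ 3 * q ^ 3 * (y : ℝ) ^ 2 ^ (d + 1) / √m + 4 * q ^ 2 * lam ^ e * X ^ 2 / y)
        + m * 2 ^ q * (1 + (m : ℝ) ^ d) ^ q * ((m : ℝ) ^ c * (2 * Real.exp (-lam ^ 2 / 2))) := by
  set L := y ^ 2 ^ (d + 1) with hLdef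
  have hL : 0 < L := by positivity
  have hL' : (y : ℝ) ^ 2 ^ (d + 1) = L := by rw [hLdef]; push_cast; rfl
  rw [hL'] at hz ⊢
  have hs : 0 < √(m : ℝ) := Real.sqrt_pos.2 (by exact_mod_cast hm)
  have hs2 : √(m : ℝ) ^ 2 = m := Real.sq_sqrt (by positivity)
  have hm0 : (0 : ℝ) < m := by exact_mod_cast hm
  have hy0 : (0 : ℝ) < y := by exact_mod_cast hy
  have hL1 : (1 : ℝ) ≤ L := by exact_mod_cast hL
  set x := X / √m with hx
  have hx0 : 0 ≤ x := by positivity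
  set z := L * x with hzdef
  have hxz : x ≤ z := le_mul_of_one_le_left hx0 hL1
  set γ := lam ^ e * x ^ 2 * L / y with hγ
  have hγ0 : 0 ≤ γ := by positivity
  set u : Fin q → ℝ := fun t => x ^ labelDeg σ t with hu
  set U : Finset (Fin q) := Finset.univ.filter fun t => labelDeg σ t ≠ 0 with hU
  set yb : Dig d m → Fin q → ℕ → ℝ :=
    fun ω t β => τ * hyp n f (update (labelBox v I σ t) j₀ (cutBelow m L β)) ω with hyb
  have hN : ∀ a : Fin m, (a : ℕ) / L < m / L + 1 := fun a =>
    Nat.lt_succ_of_le (Nat.div_le_div_right a.2.le)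
  have hdeg := fun t => labelDeg_add_two_le (σ := σ) h0 hv hjv t
  have hτX' : τ * 1 * √m ^ (d - 1) ≤ X := by
    refine le_trans ?_ hτX
    gcongr
    exact one_le_pow₀ hlam
  have hfac : ∀ a P ω, labelRiesz n f τ v I (update σ j₀ (some (a, P))) ω
      = (∏ t ∈ P, τ * hyp n f (update (labelBox v I σ t) j₀ {a}) ω) *
        ∏ t ∈ Pᶜ, ((if labelDeg σ t = 0 then 1 else 0) + (yb ω t ((a : ℕ) / L) +
          ∑ l ∈ (Finset.Iio a).filter (fun l : Fin m => ¬ (l : ℕ) < L * ((a : ℕ) / L)),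
            τ * hyp n f (update (labelBox v I σ t) j₀ {l}) ω)) := by
    intro a P ω
    rw [labelRiesz, ← Finset.prod_mul_prod_compl P]
    congr 1
    · refine Finset.prod_congr rfl fun t ht => ?_
      rw [labelDeg_update_of_mem h0 ht, labelBox_update hjv, if_pos ht, if_neg (by omega), zero_add]
    · refine Finset.prod_congr rfl fun t ht => ?_
      have ht' := Finset.mem_compl.1 ht
      rw [labelDeg_update_of_notMem h0 ht', labelBox_update hjv, if_neg ht', hyb,
        hyp_update_Iio _ _ L, mul_add, Finset.mul_sum]
  have hexc := avg_le_of_exceptional (p := LabelGood n f y e lam v j₀ I σ)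
    (F := fun ω => |∑ a : Fin m, ∑ P ∈ (Finset.univ : Finset (Finset (Fin q))).filter
        (fun P => 2 ≤ P.card), labelRiesz n f τ v I (update σ j₀ (some (a, P))) ω|)
    (G := fun ω => topBound (m := m) L (m / L + 1) x z γ u U (yb ω))
    (K := m * 2 ^ q * (1 + (m : ℝ) ^ d) ^ q) ?_ ?_ ?_
  · have hav := avg_topBound_le (d := d) (m := m) (q := q) (L := L) (N := m / L + 1) (x := x)
      (z := z) (γ := γ) hq (u := u) (U := U) (yb := yb) (hx0.trans hxz) hγ0
      (fun t => by positivity) (fun V β _ => by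
        refine hR (fun t => update (labelBox v I σ t) j₀ (cutBelow m L β)) V fun t => ?_
        rw [update_of_ne hjv.symm, labelBox, update_self])
    refine hexc.trans (add_le_add (hav.trans ?_)
      (mul_le_mul_of_nonneg_left hgood (by positivity)))
    refine mul_le_mul_of_nonneg_left (add_le_add (le_of_eq ?_) ?_)
      (Finset.prod_nonneg fun t _ => by positivity)
    · rw [hzdef, hx]
      field_simp
      rw [hs2]
    · have h1 : ((m / L + 1 : ℕ) : ℝ) * L ≤ 2 * m := by
        have : (m / L + 1) * L ≤ 2 * m := by
          have := Nat.div_mul_le_self m L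
          rw [add_mul]; omega
        exact_mod_cast this
      have h2 : x ^ 2 = X ^ 2 / m := by rw [hx, div_pow, hs2]
      calc 2 * ((m / L + 1 : ℕ) : ℝ) * q ^ 2 * γ
          = 2 * (((m / L + 1 : ℕ) : ℝ) * L) * (q ^ 2 * lam ^ e * X ^ 2 / (m * y)) := by
            rw [hγ, h2]; field_simp
        _ ≤ 2 * (2 * m) * (q ^ 2 * lam ^ e * X ^ 2 / (m * y)) := by gcongr
        _ = _ := by field_simp; ring
  · intro ω
    unfold topBound
    positivity
  · rintro ω ⟨hA, hB, hC⟩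
    simp only [hfac]
    have hb1 : ∀ t a, |τ * hyp n f (update (labelBox v I σ t) j₀ {a}) ω| ≤ x * u t := by
      intro t a
      rw [abs_mul, abs_of_nonneg hτ0, hu, ← pow_succ']
      have := hdeg t
      exact (mul_le_mul_of_nonneg_left (hA t a) hτ0).trans
        (mul_pow_le_div_pow hτX hX hs (by omega) (by omega))
    refine abs_sum_top_le hN hq hx0 hxz hz (fun t => by positivity) ?_ ?_ ?_ hb1 ?_ ?_ ?_
    · intro t ht
      have : labelDeg σ t = 0 := by simpa [hU] using ht
      simp [hu, this]
    · intro t ht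
      have : labelDeg σ t ≠ 0 := by simpa [hU] using ht
      simp [this]
    · intro t ht
      have : labelDeg σ t = 0 := by simpa [hU] using ht
      simp [this]
    · intro t ht β
      have h1 : labelDeg σ t ≠ 0 := by simpa [hU] using ht
      have := hdeg t
      rw [hyb, abs_mul, abs_of_nonneg hτ0]
      exact (mul_le_mul_of_nonneg_left (hB t β) hτ0).trans
        (mul_pow_le_div_pow hτX hX hs (by omega) (by omega))
    · intro t a
      refine (Finset.abs_sum_le_sum_abs _ _).trans ((Finset.sum_le_sum fun l _ => hb1 t l).trans ?_)
      rw [Finset.sum_const, nsmul_eq_mul, hzdef, mul_assoc]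
      have hu0 : 0 ≤ x * u t := by positivity
      exact mul_le_mul_of_nonneg_right (by exact_mod_cast card_Iio_filter_le hL a) hu0
    · intro t t' htt β
      have h1 := hdeg t
      have h2 := hdeg t'
      have e1 : τ * (1 * √m ^ (d - 2 - labelDeg σ t)) ≤ x ^ (labelDeg σ t + 1) :=
        mul_pow_le_div_pow hτX' hX hs (by omega) (by omega)
      have e2 : τ * (1 * √m ^ (d - 2 - labelDeg σ t')) ≤ x ^ (labelDeg σ t' + 1) :=
        mul_pow_le_div_pow hτX' hX hs (by omega) (by omega)
      have e3 : ∑ a ∈ Finset.univ.filter (fun a : Fin m => (a : ℕ) / L = β),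
          τ * hyp n f (update (labelBox v I σ t) j₀ {a}) ω *
          (τ * hyp n f (update (labelBox v I σ t') j₀ {a}) ω)
          = τ ^ 2 * ∑ a ∈ blockAt m L β, hyp n f (update (labelBox v I σ t) j₀ {a}) ω *
            hyp n f (update (labelBox v I σ t') j₀ {a}) ω := by
        rw [Finset.mul_sum]
        exact Finset.sum_congr rfl fun a _ => by ring
      rw [e3, abs_mul, abs_of_nonneg (sq_nonneg τ)]
      have e4 := hC t t' htt β
      rw [hL'] at e4
      calc _ ≤ τ ^ 2 * (lam ^ e * (√m ^ (d - 2 - labelDeg σ t) * √m ^ (d - 2 - labelDeg σ t')) *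
          L / y) := mul_le_mul_of_nonneg_left e4 (sq_nonneg τ)
        _ = lam ^ e * L / y * ((τ * (1 * √m ^ (d - 2 - labelDeg σ t))) *
            (τ * (1 * √m ^ (d - 2 - labelDeg σ t')))) := by ring
        _ ≤ lam ^ e * L / y * (x ^ (labelDeg σ t + 1) * x ^ (labelDeg σ t' + 1)) := by gcongr
        _ = γ * (u t * u t') := by rw [hγ, hu]; ring
  · intro ω
    have hK : ∀ a : Fin m, ∀ P : Finset (Fin q),
        |labelRiesz n f τ v I (update σ j₀ (some (a, P))) ω| ≤ (1 + (m : ℝ) ^ d) ^ q :=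
      fun a P => abs_labelRiesz_le hf hτ0 hτ1 _ ω
    refine (Finset.abs_sum_le_sum_abs _ _).trans ?_
    have h1 : ∀ a : Fin m, |∑ P ∈ (Finset.univ : Finset (Finset (Fin q))).filter
        (fun P => 2 ≤ P.card), labelRiesz n f τ v I (update σ j₀ (some (a, P))) ω|
        ≤ 2 ^ q * (1 + (m : ℝ) ^ d) ^ q := by
      intro a
      refine (Finset.abs_sum_le_sum_abs _ _).trans ((Finset.sum_le_sum fun P _ => hK a P).trans ?_)
      rw [Finset.sum_const, nsmul_eq_mul]
      refine mul_le_mul_of_nonneg_right ?_ (by positivity)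
      have := Finset.card_filter_le (Finset.univ : Finset (Finset (Fin q))) (fun P => 2 ≤ P.card)
      rw [Finset.card_univ, Fintype.card_finset, Fintype.card_fin] at this
      exact_mod_cast this
    refine (Finset.sum_le_sum fun a _ => h1 a).trans_eq ?_
    simp; ring

end LabelSum

/-! ### Removing the products with ties -/

section Ties

open Function

variable {d m q n : ℕ} {f : (Fin d → Fin m) → Dig d m → ℝ} {v j₀ : Fin d}
  {I : Fin q → Finset (Fin m)} {σ : Fin d → Label m q}

/-- One summand of the expanded product: every factor contributes `1` or a function `τ * f r`. -/
noncomputable def choiceTerm (f : (Fin d → Fin m) → Dig d m → ℝ) (τ : ℝ)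
    (o : Fin q → Option (Fin d → Fin m)) (ω : Dig d m) : ℝ :=
  ∏ t, (o t).elim 1 fun r => τ * f r ω

/-- The index set of the expanded product. -/
def choices (n : ℕ) (v : Fin d) (I : Fin q → Finset (Fin m)) :
    Finset (Fin q → Option (Fin d → Fin m)) :=
  Fintype.piFinset fun t => (levels n (labelBox v I (fun _ => none) t)).insertNone

/-- The choice `x` made for the factor `t` obeys the label `s` in the coordinate `j`. -/
def Fits (s : Label m q) (t : Fin q) (j : Fin d) (x : Option (Fin d → Fin m)) : Prop :=
  x.elim (t ∉ topSet s) fun r => r j ∈ slot s t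

/-- In the coordinate `j`, the largest level of the chosen functions is attained at least twice. -/
def Tie (o : Fin q → Option (Fin d → Fin m)) (j : Fin d) : Prop :=
  ∃ p : Fin m × Finset (Fin q), 2 ≤ p.2.card ∧ ∀ t, Fits (some p) t j (o t)

open scoped Classical in
/-- The indicator function of the choices obeying a label. -/
noncomputable def fitInd (s : Label m q) (j : Fin d) (o : Fin q → Option (Fin d → Fin m)) : ℝ :=
  ∏ t, if Fits s t j (o t) then 1 else 0

/-- The labels used to detect a tie. -/
def tieLabels (m q : ℕ) : Finset (Label m q) :=
  ((Finset.univ : Finset (Fin m × Finset (Fin q))).filter fun p => 2 ≤ p.2.card).insertNone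

/-- The sign of a label in the inclusion-exclusion formula. -/
def labelSign (s : Label m q) : ℝ := s.elim 1 fun _ => -1

open scoped Classical in
/-- The indicator function of the choices without a tie in the coordinate `j`. -/
noncomputable def noTie (o : Fin q → Option (Fin d → Fin m)) (j : Fin d) : ℝ :=
  if Tie o j then 0 else 1

/-- The part of the expanded product without ties in the coordinates `S`. -/
noncomputable def tieFree (n : ℕ) (f : (Fin d → Fin m) → Dig d m → ℝ) (τ : ℝ) (v : Fin d)
    (I : Fin q → Finset (Fin m)) (S : Finset (Fin d)) (ω : Dig d m) : ℝ :=
  ∑ o ∈ choices n v I, choiceTerm f τ o ω * ∏ j ∈ S, noTie o j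

/-- The labels available in each coordinate when ties in the coordinates `S` are excluded. -/
def labelsOn (m q : ℕ) (S : Finset (Fin d)) (j : Fin d) : Finset (Label m q) :=
  if j ∈ S then tieLabels m q else {none}

lemma fitInd_none (j : Fin d) (o : Fin q → Option (Fin d → Fin m)) :
    fitInd (none : Label m q) j o = 1 := by
  refine Finset.prod_eq_one fun t _ => if_pos ?_
  unfold Fits
  cases o t <;> simp [slot]

lemma fitInd_eq_one {s : Label m q} {j : Fin d} {o : Fin q → Option (Fin d → Fin m)} :
    (∀ t, Fits s t j (o t)) → fitInd s j o = 1 :=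
  fun h => Finset.prod_eq_one fun t _ => if_pos (h t)

lemma fitInd_eq_zero {s : Label m q} {j : Fin d} {o : Fin q → Option (Fin d → Fin m)}
    (h : ¬ ∀ t, Fits s t j (o t)) : fitInd s j o = 0 := by
  obtain ⟨t, ht⟩ := not_forall.1 h
  exact Finset.prod_eq_zero (Finset.mem_univ t) (if_neg ht)

lemma Fits.exists_of_mem {p : Fin m × Finset (Fin q)} {t : Fin q} {j : Fin d}
    {x : Option (Fin d → Fin m)} (h : Fits (some p) t j x) (ht : t ∈ p.2) :
    ∃ r, x = some r ∧ r j = p.1 := by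
  cases x with
  | none => exact absurd ht h
  | some r =>
    have h' : r j ∈ slot (some p) t := h
    rw [slot, if_pos ht, Finset.mem_singleton] at h'
    exact ⟨r, rfl, h'⟩

lemma Fits.lt_of_notMem {p : Fin m × Finset (Fin q)} {t : Fin q} {j : Fin d}
    {r : Fin d → Fin m} (h : Fits (some p) t j (some r)) (ht : t ∉ p.2) : r j < p.1 := by
  have h' : r j ∈ slot (some p) t := h
  rwa [slot, if_neg ht, Finset.mem_Iio] at h'

/-- The largest level and the set of factors attaining it are determined by the choice. -/
lemma eq_of_fits {p p' : Fin m × Finset (Fin q)} {j : Fin d} {o : Fin q → Option (Fin d → Fin m)}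
    (hp : 2 ≤ p.2.card) (hp' : 2 ≤ p'.2.card) (h : ∀ t, Fits (some p) t j (o t))
    (h' : ∀ t, Fits (some p') t j (o t)) : p = p' := by
  have le : ∀ p p' : Fin m × Finset (Fin q), 2 ≤ p.2.card → (∀ t, Fits (some p) t j (o t)) →
      (∀ t, Fits (some p') t j (o t)) → p.1 ≤ p'.1 := by
    intro p p' hp h h'
    obtain ⟨t, ht⟩ := Finset.card_pos.1 (by omega : 0 < p.2.card)
    obtain ⟨r, hr, hrp⟩ := (h t).exists_of_mem ht
    by_cases ht' : t ∈ p'.2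
    · obtain ⟨r', hr', hrp'⟩ := (h' t).exists_of_mem ht'
      rw [hr, Option.some_inj] at hr'
      rw [← hrp, ← hrp', hr']
    · have := h' t
      rw [hr] at this
      exact hrp ▸ (this.lt_of_notMem ht').le
  have heq : p.1 = p'.1 := le_antisymm (le p p' hp h h') (le p' p hp' h' h)
  have sub : ∀ p p' : Fin m × Finset (Fin q), p.1 = p'.1 → (∀ t, Fits (some p) t j (o t)) →
      (∀ t, Fits (some p') t j (o t)) → p.2 ⊆ p'.2 := by
    intro p p' he h h' t ht
    by_contra ht'
    obtain ⟨r, hr, hrp⟩ := (h t).exists_of_mem ht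
    have := h' t
    rw [hr] at this
    exact absurd (this.lt_of_notMem ht') (by rw [hrp, he]; exact lt_irrefl _)
  exact Prod.ext heq (Finset.Subset.antisymm (sub p p' heq h h') (sub p' p heq.symm h' h))

lemma one_sub_noTie (o : Fin q → Option (Fin d → Fin m)) (j : Fin d) :
    1 - noTie o j = ∑ p ∈ (Finset.univ : Finset (Fin m × Finset (Fin q))).filter
      (fun p => 2 ≤ p.2.card), fitInd (some p) j o := by
  unfold noTie
  by_cases h : Tie o j
  · obtain ⟨p, hp, hfit⟩ := h
    rw [if_pos ⟨p, hp, hfit⟩, sub_zero, Finset.sum_eq_single_of_mem p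
      (Finset.mem_filter.2 ⟨Finset.mem_univ _, hp⟩), fitInd_eq_one hfit]
    intro p' hp' hne
    exact fitInd_eq_zero fun h' => hne (eq_of_fits (Finset.mem_filter.1 hp').2 hp h' hfit)
  · rw [if_neg h, sub_self]
    exact (Finset.sum_eq_zero fun p hp => fitInd_eq_zero fun h' =>
      h ⟨p, (Finset.mem_filter.1 hp).2, h'⟩).symm

lemma noTie_eq_sum (o : Fin q → Option (Fin d → Fin m)) (j : Fin d) :
    noTie o j = ∑ s ∈ tieLabels m q, labelSign s * fitInd s j o := by
  rw [tieLabels, Finset.sum_insertNone, fitInd_none]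
  have := one_sub_noTie o j
  simp only [labelSign, Option.elim_none, Option.elim_some, neg_one_mul, Finset.sum_neg_distrib]
  linarith

lemma prod_noTie_eq_sum (S : Finset (Fin d)) (o : Fin q → Option (Fin d → Fin m)) :
    ∏ j ∈ S, noTie o j = ∑ σ ∈ Fintype.piFinset (labelsOn m q S),
      (∏ j, labelSign (σ j)) * ∏ j, fitInd (σ j) j o := by
  simp only [← Finset.prod_mul_distrib]
  rw [← Finset.prod_univ_sum (labelsOn m q S) (fun j s => labelSign s * fitInd s j o),
    ← Finset.prod_subset (Finset.subset_univ S)]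
  · exact Finset.prod_congr rfl fun j hj => by rw [labelsOn, if_pos hj, noTie_eq_sum]
  · intro j _ hj
    rw [labelsOn, if_neg hj, Finset.sum_singleton, fitInd_none]
    simp [labelSign]

lemma mem_levels_labelBox (hv : σ v = none) {t : Fin q} {r : Fin d → Fin m} :
    r ∈ levels n (labelBox v I σ t) ↔ r ∈ levels n (labelBox v I (fun _ => none) t) ∧
      ∀ j, r j ∈ slot (σ j) t := by
  simp only [mem_levels]
  constructor
  · rintro ⟨h1, h2⟩
    refine ⟨⟨fun j => ?_, h2⟩, fun j => ?_⟩
    · have := h1 j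
      by_cases hj : j = v
      · subst hj; simpa [labelBox] using this
      · simp [labelBox, hj, slot]
    · by_cases hj : j = v
      · subst hj; simp [hv, slot]
      · simpa [labelBox, hj] using h1 j
  · rintro ⟨⟨h1, h2⟩, h3⟩
    refine ⟨fun j => ?_, h2⟩
    by_cases hj : j = v
    · subst hj; simpa [labelBox] using h1 j
    · simpa [labelBox, hj] using h3 j

/-- Restricting the expansion to the choices obeying given labels yields the product attached to
these labels. -/
lemma sum_choiceTerm_mul_fitInd (hv : σ v = none) (τ : ℝ) (ω : Dig d m) :
    ∑ o ∈ choices n v I, choiceTerm f τ o ω * ∏ j, fitInd (σ j) j o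
      = labelRiesz n f τ v I σ ω := by
  classical
  unfold choiceTerm fitInd choices labelRiesz
  have h1 : ∀ o : Fin q → Option (Fin d → Fin m),
      ((∏ t, (o t).elim 1 fun r => τ * f r ω) *
        ∏ j, ∏ t, if Fits (σ j) t j (o t) then (1 : ℝ) else 0)
      = ∏ t, ((o t).elim 1 (fun r => τ * f r ω) *
          ∏ j, if Fits (σ j) t j (o t) then (1 : ℝ) else 0) := by
    intro o
    rw [Finset.prod_comm, ← Finset.prod_mul_distrib]
  simp only [h1]
  rw [← Finset.prod_univ_sum (fun t => (levels n (labelBox v I (fun _ => none) t)).insertNone)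
    (fun t x => x.elim 1 (fun r => τ * f r ω) * ∏ j, if Fits (σ j) t j x then (1 : ℝ) else 0)]
  refine Finset.prod_congr rfl fun t _ => ?_
  rw [Finset.sum_insertNone]
  congr 1
  · simp only [Option.elim_none, one_mul]
    rw [Finset.prod_ite_zero]
    have : (∀ i, Fits (σ i) t i none) ↔ labelDeg σ t = 0 := by
      simp [labelDeg, Fits, Finset.filter_eq_empty_iff]
    simp [this]
  · simp only [Option.elim_some]
    rw [hyp, Finset.mul_sum]
    have : levels n (labelBox v I σ t) = (levels n (labelBox v I (fun _ => none) t)).filter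
        fun r => ∀ j, r j ∈ slot (σ j) t := by
      ext r; rw [Finset.mem_filter, mem_levels_labelBox hv]
    rw [this, Finset.sum_filter]
    refine Finset.sum_congr rfl fun r _ => ?_
    rw [Finset.prod_ite_zero]
    have : (∀ i, Fits (σ i) t i (some r)) ↔
        ∀ j, r j ∈ slot (σ j) t := by simp [Fits]
    simp [this]

lemma tieFree_empty (τ : ℝ) (ω : Dig d m) :
    tieFree n f τ v I ∅ ω = ∏ t, (1 + τ * hyp n f (labelBox v I (fun _ => none) t) ω) := by
  have h := sum_choiceTerm_mul_fitInd (n := n) (f := f) (v := v) (I := I)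
    (σ := fun _ => (none : Label m q)) rfl τ ω
  simp only [fitInd_none, Finset.prod_const_one] at h
  unfold tieFree
  simp only [Finset.prod_empty]
  rw [h, labelRiesz]
  simp [labelDeg]

lemma prod_fitInd_update (h0 : σ j₀ = none) (p : Fin m × Finset (Fin q))
    (o : Fin q → Option (Fin d → Fin m)) :
    ∏ j, fitInd (update σ j₀ (some p) j) j o = fitInd (some p) j₀ o * ∏ j, fitInd (σ j) j o := by
  rw [← Finset.mul_prod_erase _ _ (Finset.mem_univ j₀), ← Finset.mul_prod_erase _ _
    (Finset.mem_univ j₀), update_self, h0, fitInd_none, one_mul]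
  congr 1
  exact Finset.prod_congr rfl fun j hj => by rw [update_of_ne (Finset.ne_of_mem_erase hj)]

lemma eq_none_of_mem_labelsOn {S : Finset (Fin d)} (hσ : σ ∈ Fintype.piFinset (labelsOn m q S))
    {j : Fin d} (hj : j ∉ S) : σ j = none := by
  have := Fintype.mem_piFinset.1 hσ j
  rwa [labelsOn, if_neg hj, Finset.mem_singleton] at this

/-- Imposing the absence of ties in one more coordinate `j₀` removes the terms with a tie in `j₀`.
They are classified by the largest tied level `a` and the set `P` of the factors attaining it. -/
lemma tieFree_sub_tieFree_insert {S : Finset (Fin d)} (hj : j₀ ∉ S) (hvS : v ∉ S) (hjv : j₀ ≠ v)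
    (τ : ℝ) (ω : Dig d m) :
    tieFree n f τ v I S ω - tieFree n f τ v I (insert j₀ S) ω
      = ∑ σ ∈ Fintype.piFinset (labelsOn m q S), (∏ j, labelSign (σ j)) *
        ∑ a : Fin m, ∑ P ∈ (Finset.univ : Finset (Finset (Fin q))).filter (fun P => 2 ≤ P.card),
          labelRiesz n f τ v I (update σ j₀ (some (a, P))) ω := by
  have hprod : ∀ F : Fin m × Finset (Fin q) → ℝ,
      ∑ a : Fin m, ∑ P ∈ (Finset.univ : Finset (Finset (Fin q))).filter (fun P => 2 ≤ P.card),
        F (a, P) = ∑ p ∈ (Finset.univ : Finset (Fin m × Finset (Fin q))).filter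
          (fun p => 2 ≤ p.2.card), F p := by
    intro F
    rw [← Finset.sum_product']
    refine Finset.sum_congr ?_ fun _ _ => rfl
    ext p; simp
  unfold tieFree
  rw [← Finset.sum_sub_distrib]
  have h1 : ∀ o, choiceTerm f τ o ω * ∏ j ∈ S, noTie o j
      - choiceTerm f τ o ω * ∏ j ∈ insert j₀ S, noTie o j
      = ∑ σ ∈ Fintype.piFinset (labelsOn m q S), (∏ j, labelSign (σ j)) *
        ∑ p ∈ (Finset.univ : Finset (Fin m × Finset (Fin q))).filter (fun p => 2 ≤ p.2.card),
          choiceTerm f τ o ω * ∏ j, fitInd (update σ j₀ (some p) j) j o := by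
    intro o
    rw [Finset.prod_insert hj]
    have e : choiceTerm f τ o ω * ∏ j ∈ S, noTie o j
      - choiceTerm f τ o ω * (noTie o j₀ * ∏ j ∈ S, noTie o j)
      = (∏ j ∈ S, noTie o j) * (choiceTerm f τ o ω * (1 - noTie o j₀)) := by ring
    rw [e, one_sub_noTie, prod_noTie_eq_sum, Finset.sum_mul]
    refine Finset.sum_congr rfl fun σ hσ => ?_
    rw [mul_assoc, Finset.mul_sum, Finset.mul_sum]
    congr 1
    refine Finset.sum_congr rfl fun p _ => ?_
    rw [prod_fitInd_update (eq_none_of_mem_labelsOn hσ hj)]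
    ring
  rw [Finset.sum_congr rfl fun o _ => h1 o, Finset.sum_comm]
  refine Finset.sum_congr rfl fun σ hσ => ?_
  rw [← Finset.mul_sum, Finset.sum_comm,
    hprod fun p => labelRiesz n f τ v I (update σ j₀ (some p)) ω]
  congr 1
  refine Finset.sum_congr rfl fun p _ => ?_
  refine sum_choiceTerm_mul_fitInd ?_ τ ω
  rw [update_of_ne hjv.symm]
  exact eq_none_of_mem_labelsOn hσ hvS

lemma abs_prod_labelSign (σ : Fin d → Label m q) : |∏ j, labelSign (σ j)| = 1 := by
  rw [Finset.abs_prod]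
  refine Finset.prod_eq_one fun j _ => ?_
  cases σ j <;> simp [labelSign]

lemma sum_prod_pow_labelDeg_le {x : ℝ} (hx : 0 ≤ x) (hq : 1 ≤ q) (hqx : q * x ≤ 1)
    (S : Finset (Fin d)) :
    ∑ σ ∈ Fintype.piFinset (labelsOn m q S), ∏ t, x ^ labelDeg σ t
      ≤ (1 + 3 * (m * x ^ 2) * q ^ 2) ^ d := by
  have h1 : ∀ σ : Fin d → Label m q, ∏ t, x ^ labelDeg σ t = ∏ j, x ^ (topSet (σ j)).card := by
    intro σ
    have e1 : ∀ t, x ^ labelDeg σ t = ∏ j, if t ∈ topSet (σ j) then x else 1 := by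
      intro t
      rw [Finset.prod_ite, Finset.prod_const, Finset.prod_const_one, mul_one, labelDeg]
    have e2 : ∀ j, x ^ (topSet (σ j)).card = ∏ t, if t ∈ topSet (σ j) then x else 1 := by
      intro j
      rw [Finset.prod_ite, Finset.prod_const, Finset.prod_const_one, mul_one]
      simp
    simp only [e1, e2]
    exact Finset.prod_comm
  have hnn : 0 ≤ 3 * (m * x ^ 2) * (q : ℝ) ^ 2 := by positivity
  simp only [h1]
  rw [← Finset.prod_univ_sum (labelsOn m q S) (fun _ s => x ^ (topSet s).card)]
  refine (Finset.prod_le_prod (g := fun _ => 1 + 3 * (m * x ^ 2) * (q : ℝ) ^ 2)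
    (fun j _ => Finset.sum_nonneg fun s _ => by positivity) fun j _ => ?_).trans_eq (by simp)
  by_cases hj : j ∈ S
  · rw [labelsOn, if_pos hj, tieLabels, Finset.sum_insertNone]
    simp only [topSet_none, topSet_some, Finset.card_empty, pow_zero]
    gcongr
    calc ∑ p ∈ (Finset.univ : Finset (Fin m × Finset (Fin q))).filter (fun p => 2 ≤ p.2.card),
          x ^ p.2.card
        ≤ ∑ p ∈ (Finset.univ : Finset (Fin m × Finset (Fin q))).filter (fun p => 2 ≤ p.2.card),
          x ^ 2 * q ^ 2 * ((q : ℝ)⁻¹) ^ p.2.card :=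
          Finset.sum_le_sum fun p hp => pow_card_le_two hq hx hqx (Finset.mem_filter.1 hp).2
      _ ≤ ∑ p : Fin m × Finset (Fin q), x ^ 2 * q ^ 2 * ((q : ℝ)⁻¹) ^ p.2.card :=
          Finset.sum_le_sum_of_subset_of_nonneg (Finset.filter_subset _ _)
            fun _ _ _ => by positivity
      _ = m * (x ^ 2 * q ^ 2) * ∑ P : Finset (Fin q), ((q : ℝ)⁻¹) ^ P.card := by
          rw [Fintype.sum_prod_type]
          simp only
          rw [Finset.sum_const, Finset.card_univ, Fintype.card_fin,
            nsmul_eq_mul, ← Finset.mul_sum]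
          ring
      _ ≤ m * (x ^ 2 * q ^ 2) * 3 := by
          gcongr
          exact sum_inv_pow_card_le hq
      _ = _ := by ring
  · rw [labelsOn, if_neg hj, Finset.sum_singleton]
    simp only [topSet_none, Finset.card_empty, pow_zero]
    linarith

lemma card_piFinset_labelsOn_le (S : Finset (Fin d)) :
    ((Fintype.piFinset (labelsOn m q S)).card : ℝ) ≤ (1 + m * 2 ^ q) ^ d := by
  rw [Fintype.card_piFinset]
  push_cast
  refine (Finset.prod_le_prod (g := fun _ => 1 + (m : ℝ) * 2 ^ q) (fun j _ => by positivity)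
    fun j _ => ?_).trans_eq (by simp)
  by_cases hj : j ∈ S
  · rw [labelsOn, if_pos hj, tieLabels, Finset.card_insertNone]
    have h := Finset.card_filter_le (Finset.univ : Finset (Fin m × Finset (Fin q)))
      (fun p => 2 ≤ p.2.card)
    rw [Finset.card_univ, Fintype.card_prod, Fintype.card_finset, Fintype.card_fin,
      Fintype.card_fin] at h
    have h' : ((((Finset.univ : Finset (Fin m × Finset (Fin q))).filter
      (fun p => 2 ≤ p.2.card)).card : ℕ) : ℝ) ≤ m * 2 ^ q := by exact_mod_cast h
    push_cast
    linarith
  · rw [labelsOn, if_neg hj, Finset.card_singleton]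
    have : (0 : ℝ) ≤ m * 2 ^ q := by positivity
    push_cast
    linarith

/-- In mean, the expanded product hardly changes when the terms with ties are removed. -/
theorem avg_abs_tieFree_sub_le {y c e : ℕ} {lam τ X : ℝ} (hf : IsHaarFamily f)
    (hgood : ∀ (j₀ : Fin d) (σ : Fin d → Label m q), j₀ ≠ v → σ j₀ = none → σ v = none →
      Owp lam c (LabelGood n f y e lam v j₀ I σ)) (hm : 1 ≤ m) (hlam : 1 ≤ lam)
    (hy : 1 ≤ y) (hτ0 : 0 ≤ τ) (hτ1 : τ ≤ 1)
    (hX : 1 ≤ X) (hτX : τ * lam ^ d * √m ^ (d - 1) ≤ X) (hq : 1 ≤ q)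
    (hLm : y ^ 2 ^ (d + 1) ≤ m) (hz : q * ((y : ℝ) ^ 2 ^ (d + 1) * (X / √m)) ≤ 1)
    (hR : ∀ (J : Fin q → Fin d → Finset (Fin m)) (V : Finset (Fin q)), (∀ t, J t v = I t) →
      avg (fun ω => |∏ t ∈ V, (1 + τ * hyp n f (J t) ω)|) ≤ 2)
    (S : Finset (Fin d)) (hvS : v ∉ S) :
    avg (fun ω => |tieFree n f τ v I ∅ ω - tieFree n f τ v I S ω|)
      ≤ S.card * ((1 + 3 * X ^ 2 * q ^ 2) ^ d *
          (18 * X ^ 3 * q ^ 3 * (y : ℝ) ^ 2 ^ (d + 1) / √m + 4 * q ^ 2 * lam ^ e * X ^ 2 / y)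
        + (1 + m * 2 ^ q) ^ d * (m * 2 ^ q * (1 + (m : ℝ) ^ d) ^ q *
          ((m : ℝ) ^ c * (2 * Real.exp (-lam ^ 2 / 2))))) := by
  have hm0 : (0 : ℝ) < m := by exact_mod_cast hm
  have hs : 0 < √(m : ℝ) := Real.sqrt_pos.2 hm0
  have hs2 : √(m : ℝ) ^ 2 = m := Real.sq_sqrt (by positivity)
  have hy1 : (1 : ℝ) ≤ (y : ℝ) ^ 2 ^ (d + 1) := one_le_pow₀ (by exact_mod_cast hy)
  have hx0 : 0 ≤ X / √m := by positivity
  have hqx : q * (X / √m) ≤ 1 := by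
    refine le_trans ?_ hz
    gcongr
    exact le_mul_of_one_le_left hx0 hy1
  have hmx : m * (X / √m) ^ 2 = X ^ 2 := by
    rw [div_pow, hs2]; field_simp
  induction S using Finset.induction_on with
  | empty => simp [avg_const]
  | insert j₀ S hj ih =>
    have hvS' : v ∉ S := fun h => hvS (Finset.mem_insert_of_mem h)
    have hjv : j₀ ≠ v := by rintro rfl; exact hvS (Finset.mem_insert_self _ _)
    have ih := ih hvS'
    set E := 18 * X ^ 3 * q ^ 3 * (y : ℝ) ^ 2 ^ (d + 1) / √m + 4 * q ^ 2 * lam ^ e * X ^ 2 / y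
      with hE
    set K := m * 2 ^ q * (1 + (m : ℝ) ^ d) ^ q *
      ((m : ℝ) ^ c * (2 * Real.exp (-lam ^ 2 / 2))) with hK
    have hE0 : 0 ≤ E := by positivity
    have hK0 : 0 ≤ K := by positivity
    have hstep : avg (fun ω => |tieFree n f τ v I S ω - tieFree n f τ v I (insert j₀ S) ω|)
        ≤ (1 + 3 * X ^ 2 * q ^ 2) ^ d * E + (1 + m * 2 ^ q) ^ d * K := by
      calc _ ≤ avg (fun ω => ∑ σ ∈ Fintype.piFinset (labelsOn m q S), |∑ a : Fin m,
            ∑ P ∈ (Finset.univ : Finset (Finset (Fin q))).filter (fun P => 2 ≤ P.card),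
              labelRiesz n f τ v I (update σ j₀ (some (a, P))) ω|) := by
            refine avg_mono fun ω => ?_
            rw [tieFree_sub_tieFree_insert hj hvS' hjv]
            refine (Finset.abs_sum_le_sum_abs _ _).trans (Finset.sum_le_sum fun σ _ => ?_)
            rw [abs_mul, abs_prod_labelSign, one_mul]
        _ ≤ ∑ σ ∈ Fintype.piFinset (labelsOn m q S),
            ((∏ t, (X / √m) ^ labelDeg σ t) * E + K) := by
            rw [avg_sum]
            refine Finset.sum_le_sum fun σ hσ => ?_
            have h0 := eq_none_of_mem_labelsOn hσ hj
            have hv := eq_none_of_mem_labelsOn hσ hvS'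
            exact avg_abs_sum_labelRiesz_le hf (hgood j₀ σ hjv h0 hv) hm hlam hy h0 hv hjv hτ0 hτ1
              hX hτX hq hLm hz hR
        _ = (∑ σ ∈ Fintype.piFinset (labelsOn m q S), ∏ t, (X / √m) ^ labelDeg σ t) * E
            + (Fintype.piFinset (labelsOn m q S)).card * K := by
            rw [Finset.sum_add_distrib, Finset.sum_mul, Finset.sum_const, nsmul_eq_mul]
        _ ≤ _ := by
            have h1 := sum_prod_pow_labelDeg_le (m := m) hx0 hq hqx S
            rw [hmx] at h1
            exact add_le_add (mul_le_mul_of_nonneg_right h1 hE0)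
              (mul_le_mul_of_nonneg_right (card_piFinset_labelsOn_le S) hK0)
    have htri : avg (fun ω => |tieFree n f τ v I ∅ ω - tieFree n f τ v I (insert j₀ S) ω|)
        ≤ avg (fun ω => |tieFree n f τ v I ∅ ω - tieFree n f τ v I S ω|)
          + avg (fun ω => |tieFree n f τ v I S ω - tieFree n f τ v I (insert j₀ S) ω|) := by
      rw [← avg_add]
      exact avg_mono fun ω => abs_sub_le _ _ _
    rw [Finset.card_insert_of_notMem hj]
    push_cast
    linarith

end Ties

/-! ### Binary digits and the discrepancy function -/

section Digits

open Function

variable {d m : ℕ}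

/-- The number with binary digits `b`, shifted by `u`. -/
noncomputable def digVal (u : ℝ) (b : Fin m → Bool) : ℝ :=
  u + ∑ k, if b k then ((2 : ℝ)⁻¹) ^ ((k : ℕ) + 1) else 0

/-- Change one binary digit. -/
def flipBit (k : Fin m) (b : Fin m → Bool) : Fin m → Bool := update b k (!b k)

/-- Keep the binary digits before the position `r` and delete the others. -/
def truncBits (r : Fin m) (b : Fin m → Bool) : Fin m → Bool := fun k => if k < r then b k else false

/-- The dyadic interval given by the digits of `b` before the position `r` contains `p`; more
precisely, `p` separates two of the numbers having these first digits. -/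
def InCell (u : ℝ) (r : Fin m) (b : Fin m → Bool) (p : ℝ) : Prop :=
  ∃ b₁ b₂, truncBits r b₁ = truncBits r b ∧ truncBits r b₂ = truncBits r b ∧
    digVal u b₁ ≤ p ∧ p < digVal u b₂

lemma sum_Ioi_inv_pow_le (k : Fin m) :
    ∑ i ∈ Finset.Ioi k, ((2 : ℝ)⁻¹) ^ ((i : ℕ) + 1) ≤ ((2 : ℝ)⁻¹) ^ ((k : ℕ) + 1) := by
  have h1 : ∀ N a : ℕ, a ≤ N → ∑ i ∈ Finset.Ico a N, ((2 : ℝ)⁻¹) ^ (i + 1)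
      = ((2 : ℝ)⁻¹) ^ a - ((2 : ℝ)⁻¹) ^ N := by
    intro N a ha
    induction N, ha using Nat.le_induction with
    | base => simp
    | succ N hN ih => rw [Finset.sum_Ico_succ_top hN, ih, pow_succ]; ring
  have h2 : ∑ i ∈ Finset.Ioi k, ((2 : ℝ)⁻¹) ^ ((i : ℕ) + 1)
      = ∑ i ∈ Finset.Ico ((k : ℕ) + 1) m, ((2 : ℝ)⁻¹) ^ (i + 1) := by
    refine Finset.sum_bij (fun i _ => (i : ℕ)) (fun i hi => ?_) (fun _ _ _ _ h => Fin.ext h)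
      (fun i hi => ?_) fun _ _ => rfl
    · have := Fin.lt_def.1 (Finset.mem_Ioi.1 hi)
      exact Finset.mem_Ico.2 ⟨this, i.2⟩
    · have := Finset.mem_Ico.1 hi
      exact ⟨⟨i, this.2⟩, Finset.mem_Ioi.2 (Fin.lt_def.2 this.1), rfl⟩
  have h3 := h1 m ((k : ℕ) + 1) k.2
  rw [h2, h3]
  have : (0 : ℝ) ≤ ((2 : ℝ)⁻¹) ^ m := by positivity
  linarith

lemma digVal_le_of_lex (u : ℝ) {b b' : Fin m → Bool} {k : Fin m} (h : ∀ i < k, b i = b' i)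
    (hb : b k = false) (hb' : b' k = true) : digVal u b ≤ digVal u b' := by
  unfold digVal
  have h1 : ∀ i, (if b i then ((2 : ℝ)⁻¹) ^ ((i : ℕ) + 1) else 0)
      ≤ (if b' i then ((2 : ℝ)⁻¹) ^ ((i : ℕ) + 1) else 0)
        + ((if k < i then ((2 : ℝ)⁻¹) ^ ((i : ℕ) + 1) else 0)
        - if i = k then ((2 : ℝ)⁻¹) ^ ((i : ℕ) + 1) else 0) := by
    intro i
    have h0 : (0 : ℝ) ≤ ((2 : ℝ)⁻¹) ^ ((i : ℕ) + 1) := by positivity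
    rcases lt_trichotomy i k with hi | hi | hi
    · rw [h i hi]; simp [hi.ne, not_lt.2 hi.le]
    · subst hi; simp [hb, hb']
    · simp only [hi, if_true, hi.ne', if_false, sub_zero]
      split_ifs <;> linarith
  have h2 := Finset.sum_le_sum (s := Finset.univ) fun i _ => h1 i
  rw [Finset.sum_add_distrib, Finset.sum_sub_distrib, Finset.sum_ite_eq', if_pos (Finset.mem_univ _),
    ← Finset.sum_filter (fun i => k < i)] at h2
  have h3 : Finset.univ.filter (fun i => k < i) = Finset.Ioi k := by ext; simp
  rw [h3] at h2
  have := sum_Ioi_inv_pow_le k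
  linarith

lemma truncBits_apply_eq {r k : Fin m} {b b' : Fin m → Bool} (h : truncBits r b = truncBits r b')
    (hk : k < r) : b k = b' k := by
  have := congrFun h k
  simpa [truncBits, hk] using this

/-- All digit sequences whose dyadic interval contains `p` have the same first digits. -/
lemma truncBits_eq_of_inCell {u p : ℝ} {r : Fin m} {b b' : Fin m → Bool} (h : InCell u r b p)
    (h' : InCell u r b' p) : truncBits r b = truncBits r b' := by
  by_contra hne
  have hex : ∃ k, k < r ∧ b k ≠ b' k := by
    by_contra hcon
    push Not at hcon
    refine hne (funext fun k => ?_)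
    unfold truncBits
    split_ifs with hk
    · exact hcon k hk
    · rfl
  obtain ⟨k, ⟨hk, hbk⟩, hmin⟩ : ∃ k, (k < r ∧ b k ≠ b' k) ∧ ∀ i < k, b i = b' i := by
    have hne' : ((Finset.univ : Finset (Fin m)).filter fun k => k < r ∧ b k ≠ b' k).Nonempty := by
      obtain ⟨k, hk⟩ := hex
      exact ⟨k, by simpa using hk⟩
    refine ⟨_, (Finset.mem_filter.1 (Finset.min'_mem _ hne')).2, fun i hi => ?_⟩
    by_contra hi'
    have hir : i < r := hi.trans (Finset.mem_filter.1 (Finset.min'_mem _ hne')).2.1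
    exact absurd (Finset.min'_le _ i (Finset.mem_filter.2 ⟨Finset.mem_univ _, hir, hi'⟩))
      (not_le.2 hi)
  have key : ∀ b b' : Fin m → Bool, InCell u r b p → InCell u r b' p →
      (∀ i < k, b i = b' i) → b k = false → b' k = true → False := by
    rintro b b' ⟨b₁, b₂, e₁, e₂, _, h₂⟩ ⟨c₁, c₂, f₁, f₂, g₁, _⟩ hlt hb hb'
    have := digVal_le_of_lex u (b := b₂) (b' := c₁) (k := k)
      (fun i hi => by
        rw [truncBits_apply_eq e₂ (hi.trans hk), truncBits_apply_eq f₁ (hi.trans hk), hlt i hi])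
      (by rw [truncBits_apply_eq e₂ hk, hb]) (by rw [truncBits_apply_eq f₁ hk, hb'])
    linarith
  rcases hb : b k with _ | _ <;> rcases hb' : b' k with _ | _
  · exact hbk (hb.trans hb'.symm)
  · exact key b b' h h' hmin hb hb'
  · exact key b' b h' h (fun i hi => (hmin i hi).symm) hb' hb
  · exact hbk (hb.trans hb'.symm)

open scoped Classical in
lemma card_inCell_le (u p : ℝ) (r : Fin m) :
    ((Finset.univ : Finset (Fin m → Bool)).filter fun b => InCell u r b p).card ≤ 2 ^ (m - r) := by
  have h1 : ((Finset.univ : Finset (Fin m → Bool)).filter fun b => InCell u r b p).card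
      ≤ (Finset.univ : Finset (Set.Ici r → Bool)).card := by
    refine Finset.card_le_card_of_injOn (fun b k => b k) (fun _ _ => Finset.mem_coe.2
      (Finset.mem_univ _)) fun b hb b' hb' hbb => ?_
    have ht := truncBits_eq_of_inCell (Finset.mem_filter.1 hb).2 (Finset.mem_filter.1 hb').2
    funext k
    by_cases hk : k < r
    · exact truncBits_apply_eq ht hk
    · exact congrFun hbb ⟨k, not_lt.1 hk⟩
  refine h1.trans_eq ?_
  rw [Finset.card_univ, Fintype.card_fun, Fintype.card_bool]
  congr 1
  simp

lemma digVal_sub_flipBit (u : ℝ) (r : Fin m) (b : Fin m → Bool) :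
    (digVal u b - digVal u (flipBit r b)) / 2
      = -(if b r then -1 else 1) * ((2 : ℝ)⁻¹) ^ ((r : ℕ) + 2) := by
  have h1 : ∀ i, (if flipBit r b i then ((2 : ℝ)⁻¹) ^ ((i : ℕ) + 1) else 0)
      = (if b i then ((2 : ℝ)⁻¹) ^ ((i : ℕ) + 1) else 0) +
        if i = r then (if b i then -1 else 1) * ((2 : ℝ)⁻¹) ^ ((i : ℕ) + 1) else 0 := by
    intro i
    by_cases hi : i = r
    · subst hi
      cases hb : b i <;> simp [flipBit, hb]
    · simp [flipBit, hi]
  unfold digVal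
  simp only [h1]
  rw [Finset.sum_add_distrib, Finset.sum_ite_eq', if_pos (Finset.mem_univ _)]
  ring

lemma truncBits_flipBit {r k : Fin m} (h : r ≤ k) (b : Fin m → Bool) :
    truncBits r (flipBit k b) = truncBits r b := by
  funext i
  unfold truncBits
  split_ifs with hi
  · exact update_of_ne (hi.trans_le h).ne _ _
  · rfl

/-- The halved difference of the indicator of `p < x` under a flip of the digit `r` vanishes unless
the dyadic interval of order `r` contains `p`. -/
lemma abs_indicator_sub_flipBit_le (u p : ℝ) (r : Fin m) (b : Fin m → Bool) :
    |((if p < digVal u b then (1 : ℝ) else 0) - if p < digVal u (flipBit r b) then 1 else 0) / 2|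
      ≤ 1 ∧ (¬ InCell u r b p →
      ((if p < digVal u b then (1 : ℝ) else 0) - if p < digVal u (flipBit r b) then 1 else 0) / 2
        = 0) := by
  have hf := truncBits_flipBit le_rfl (r := r) b
  split_ifs with h1 h2 h2
  · norm_num
  · refine ⟨by norm_num, fun hn => absurd ⟨flipBit r b, b, hf, rfl, not_lt.1 h2, h1⟩ hn⟩
  · refine ⟨by norm_num, fun hn => absurd ⟨b, flipBit r b, rfl, hf, not_lt.1 h1, h2⟩ hn⟩
  · norm_num

lemma flipDigit_apply_self (j : Fin d) (k : Fin m) (ω : Dig d m) :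
    flipDigit j k ω j = flipBit k (ω j) := by
  funext i
  by_cases hi : i = k
  · subst hi; rw [flipDigit_apply_same, flipBit, update_self]
  · rw [flipDigit_apply_of_ne_digit hi, flipBit, update_of_ne hi]

lemma avg_prod_mul_eq_of_anti {r : Fin d → Fin m} {g : Dig d m → ℝ}
    (hg : ∀ j ω, g (flipDigit j (r j) ω) = -g ω) (a : Fin d → (Fin m → Bool) → ℝ) :
    avg (fun ω => (∏ j, a j (ω j)) * g ω)
      = avg (fun ω => (∏ j, (a j (ω j) - a j (flipBit (r j) (ω j))) / 2) * g ω) := by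
  have h : ∀ S : Finset (Fin d), avg (fun ω => (∏ j, a j (ω j)) * g ω)
      = avg (fun ω => ((∏ j ∈ S, (a j (ω j) - a j (flipBit (r j) (ω j))) / 2) *
          ∏ j ∈ Sᶜ, a j (ω j)) * g ω) := by
    intro S
    induction S using Finset.induction_on with
    | empty => simp
    | insert i S hi ih =>
      rw [ih]
      have hc : Sᶜ = insert i (insert i S)ᶜ := by
        ext j
        by_cases hj : j = i
        · subst hj; simp [hi]
        · simp [hj]
      have hi' : i ∉ (insert i S)ᶜ := by simp
      set H : Dig d m → ℝ := fun ω => (∏ j ∈ S, (a j (ω j) - a j (flipBit (r j) (ω j))) / 2) *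
          ∏ j ∈ (insert i S)ᶜ, a j (ω j) with hH
      have hHinv : ∀ ω, H (flipDigit i (r i) ω) = H ω := by
        intro ω
        simp only [hH]
        congr 1
        · refine Finset.prod_congr rfl fun j hj => ?_
          have : j ≠ i := by rintro rfl; exact hi hj
          rw [flipDigit_apply_of_ne this]
        · refine Finset.prod_congr rfl fun j hj => ?_
          have : j ≠ i := by rintro rfl; exact hi' hj
          rw [flipDigit_apply_of_ne this]
      have e1 : ∀ ω, ((∏ j ∈ S, (a j (ω j) - a j (flipBit (r j) (ω j))) / 2) *
          ∏ j ∈ Sᶜ, a j (ω j)) * g ω = H ω * a i (ω i) * g ω := by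
        intro ω
        rw [hc, Finset.prod_insert hi']
        simp only [hH]; ring
      have e2 : ∀ ω, ((∏ j ∈ insert i S, (a j (ω j) - a j (flipBit (r j) (ω j))) / 2) *
          ∏ j ∈ (insert i S)ᶜ, a j (ω j)) * g ω
          = 1 / 2 * (H ω * a i (ω i) * g ω)
            - 1 / 2 * (H ω * a i (flipBit (r i) (ω i)) * g ω) := by
        intro ω
        rw [Finset.prod_insert hi]
        simp only [hH]; ring
      have e3 : avg (fun ω => H ω * a i (flipBit (r i) (ω i)) * g ω)
          = -avg (fun ω => H ω * a i (ω i) * g ω) := by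
        rw [← avg_flipDigit i (r i) fun ω => H ω * a i (ω i) * g ω, ← neg_one_mul, ← avg_const_mul]
        congr 1
        funext ω
        rw [hHinv, hg, flipDigit_apply_self]
        ring
      simp only [e1, e2]
      rw [avg_sub, avg_const_mul, avg_const_mul, e3]
      ring
  rw [h Finset.univ]
  simp

/-- The points of the discretized cube at which the cell of `ω` contains `p` have proportion at most
the volume of a cell. -/
lemma prop_inCell_le (u p : Fin d → ℝ) (r : Fin d → Fin m) :
    prop (fun ω : Dig d m => ∀ j, InCell (u j) (r j) (ω j) (p j))
      ≤ ((2 : ℝ)⁻¹) ^ ∑ j, (r j : ℕ) := by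
  classical
  have h1 : (Finset.univ : Finset (Dig d m)).filter
      (fun ω => ∀ j, InCell (u j) (r j) (ω j) (p j)) = Fintype.piFinset fun j =>
      (Finset.univ : Finset (Fin m → Bool)).filter fun b => InCell (u j) (r j) b (p j) := by
    ext ω; simp [Fintype.mem_piFinset]
  have h2 : prop (fun ω : Dig d m => ∀ j, InCell (u j) (r j) (ω j) (p j))
      = (((Finset.univ : Finset (Dig d m)).filter
      (fun ω => ∀ j, InCell (u j) (r j) (ω j) (p j))).card : ℝ) / Fintype.card (Dig d m) := by
    unfold prop avg
    congr 1
    rw [Finset.card_filter]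
    push_cast
    exact Finset.sum_congr rfl fun ω _ => by congr
  have h3 : (Fintype.card (Dig d m) : ℝ) = ∏ _j : Fin d, (2 : ℝ) ^ m := by
    simp [Dig]
  rw [h2, h1, Fintype.card_piFinset, h3]
  push_cast
  rw [← Finset.prod_div_distrib, ← Finset.prod_pow_eq_pow_sum]
  refine Finset.prod_le_prod (fun _ _ => by positivity) fun j _ => ?_
  rw [div_le_iff₀ (by positivity)]
  have h4 : ((2 : ℝ)⁻¹) ^ (r j : ℕ) * 2 ^ m = 2 ^ (m - (r j : ℕ)) := by
    rw [pow_sub₀ _ (by norm_num) (r j).2.le, inv_pow, mul_comm]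
  rw [h4]
  exact_mod_cast card_inCell_le (u j) (p j) (r j)

/-- The discrepancy function, evaluated at the points with binary digits `ω`, shifted by `u`. -/
noncomputable def digDisc (A : Finset (Fin d → ℝ)) (u : Fin d → ℝ) (ω : Dig d m) : ℝ :=
  ∑ p ∈ A, ∏ j, (if p j < digVal (u j) (ω j) then 1 else 0) - A.card * ∏ j, digVal (u j) (ω j)

lemma avg_digDisc_mul (A : Finset (Fin d → ℝ)) (u : Fin d → ℝ) (g : Dig d m → ℝ) :
    avg (fun ω => digDisc A u ω * g ω)
      = ∑ p ∈ A, avg (fun ω => (∏ j, if p j < digVal (u j) (ω j) then 1 else 0) * g ω)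
        - A.card * avg (fun ω => (∏ j, digVal (u j) (ω j)) * g ω) := by
  unfold digDisc
  simp only [sub_mul, Finset.sum_mul, mul_assoc]
  rw [avg_sub, avg_sum, avg_const_mul]

lemma abs_avg_prod_indicator_mul_le (u p : Fin d → ℝ) {r : Fin d → Fin m}
    {g : Dig d m → ℝ} (hg : ∀ j ω, g (flipDigit j (r j) ω) = -g ω) (hg1 : ∀ ω, |g ω| ≤ 1) :
    |avg (fun ω => (∏ j, if p j < digVal (u j) (ω j) then 1 else 0) * g ω)|
      ≤ ((2 : ℝ)⁻¹) ^ ∑ j, (r j : ℕ) := by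
  rw [avg_prod_mul_eq_of_anti hg fun j b => if p j < digVal (u j) b then 1 else 0]
  refine (abs_avg_le _).trans (le_trans ?_ (prop_inCell_le u p r))
  unfold prop
  refine avg_mono fun ω => ?_
  rw [abs_mul, Finset.abs_prod]
  have hb := fun j => abs_indicator_sub_flipBit_le (u j) (p j) (r j) (ω j)
  split_ifs with h
  · exact mul_le_one₀ (Finset.prod_le_one (fun _ _ => abs_nonneg _) fun j _ => (hb j).1)
      (abs_nonneg _) (hg1 ω)
  · obtain ⟨j, hj⟩ := not_forall.1 h
    rw [Finset.prod_eq_zero (Finset.mem_univ j) (by rw [(hb j).2 hj, abs_zero]), zero_mul]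

lemma abs_avg_prod_digVal_mul_le (u : Fin d → ℝ) {r : Fin d → Fin m}
    {g : Dig d m → ℝ} (hg : ∀ j ω, g (flipDigit j (r j) ω) = -g ω) (hg1 : ∀ ω, |g ω| ≤ 1) :
    |avg (fun ω => (∏ j, digVal (u j) (ω j)) * g ω)| ≤ ((2 : ℝ)⁻¹) ^ ∑ j, (r j : ℕ) := by
  rw [avg_prod_mul_eq_of_anti hg fun j b => digVal (u j) b]
  refine (abs_avg_le _).trans ((avg_mono fun ω => ?_).trans_eq
    (avg_const (d := d) (m := m) (((2 : ℝ)⁻¹) ^ ∑ j, (r j : ℕ))))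
  rw [abs_mul, Finset.abs_prod, ← Finset.prod_pow_eq_pow_sum]
  refine (mul_le_of_le_one_right (Finset.prod_nonneg fun _ _ => abs_nonneg _) (hg1 ω)).trans ?_
  refine Finset.prod_le_prod (fun _ _ => abs_nonneg _) fun j _ => ?_
  have h1 : |(if ω j (r j) then (-1 : ℝ) else 1)| = 1 := by split_ifs <;> simp
  have h2 : (0 : ℝ) ≤ ((2 : ℝ)⁻¹) ^ ((r j : ℕ) + 2) := by positivity
  rw [digVal_sub_flipBit, abs_mul, abs_neg, h1, one_mul, abs_of_nonneg h2]
  exact pow_le_pow_of_le_one (by norm_num) (by norm_num) (by omega)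

/-- Functions oscillating in every coordinate are nearly orthogonal to the discrepancy function. -/
lemma abs_avg_digDisc_mul_le (A : Finset (Fin d → ℝ)) (u : Fin d → ℝ) {r : Fin d → Fin m}
    {g : Dig d m → ℝ} (hg : ∀ j ω, g (flipDigit j (r j) ω) = -g ω) (hg1 : ∀ ω, |g ω| ≤ 1) :
    |avg (fun ω => digDisc A u ω * g ω)| ≤ 2 * A.card * ((2 : ℝ)⁻¹) ^ ∑ j, (r j : ℕ) := by
  rw [avg_digDisc_mul]
  have h3 : |∑ p ∈ A, avg (fun ω => (∏ j, if p j < digVal (u j) (ω j) then 1 else 0) * g ω)|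
      ≤ A.card * ((2 : ℝ)⁻¹) ^ ∑ j, (r j : ℕ) := by
    refine (Finset.abs_sum_le_sum_abs _ _).trans ?_
    rw [← nsmul_eq_mul]
    exact Finset.sum_le_card_nsmul _ _ _ fun p _ => abs_avg_prod_indicator_mul_le u p hg hg1
  have h4 : |(A.card : ℝ) * avg (fun ω => (∏ j, digVal (u j) (ω j)) * g ω)|
      ≤ A.card * ((2 : ℝ)⁻¹) ^ ∑ j, (r j : ℕ) := by
    rw [abs_mul, Nat.abs_cast]
    exact mul_le_mul_of_nonneg_left (abs_avg_prod_digVal_mul_le u hg hg1) (Nat.cast_nonneg _)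
  rw [abs_le] at h3 h4 ⊢
  constructor <;> linarith [h3.1, h3.2, h4.1, h4.2]

/-- The product of the Rademacher functions of the digits `r`. -/
noncomputable def rademacher (r : Fin d → Fin m) (ω : Dig d m) : ℝ :=
  ∏ j, if ω j (r j) then -1 else 1

/-- Delete the digits from the positions `r` on. -/
def truncDig (r : Fin d → Fin m) (ω : Dig d m) : Dig d m := fun j => truncBits (r j) (ω j)

lemma truncDig_flipDigit {r : Fin d → Fin m} {j : Fin d} {k : Fin m} (h : r j ≤ k) (ω : Dig d m) :
    truncDig r (flipDigit j k ω) = truncDig r ω := by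
  funext i
  by_cases hi : i = j
  · subst hi
    rw [truncDig, flipDigit_apply_self, truncBits_flipBit h, truncDig]
  · rw [truncDig, flipDigit_apply_of_ne hi, truncDig]

lemma rademacher_flipDigit (r : Fin d → Fin m) (j : Fin d) (ω : Dig d m) :
    rademacher r (flipDigit j (r j) ω) = -rademacher r ω := by
  unfold rademacher
  rw [← Finset.mul_prod_erase _ _ (Finset.mem_univ j), ← Finset.mul_prod_erase _ (fun j =>
    if ω j (r j) = true then (-1 : ℝ) else 1) (Finset.mem_univ j), flipDigit_apply_same,
    ← neg_mul]
  congr 1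
  · cases ω j (r j) <;> simp
  · refine Finset.prod_congr rfl fun i hi => ?_
    rw [flipDigit_apply_of_ne (Finset.ne_of_mem_erase hi)]

lemma rademacher_flipDigit_of_ne {r : Fin d → Fin m} {j : Fin d} {k : Fin m} (h : k ≠ r j)
    (ω : Dig d m) : rademacher r (flipDigit j k ω) = rademacher r ω := by
  unfold rademacher
  refine Finset.prod_congr rfl fun i _ => ?_
  by_cases hi : i = j
  · subst hi; rw [flipDigit_apply_of_ne_digit h.symm]
  · rw [flipDigit_apply_of_ne hi]

lemma rademacher_sq (r : Fin d → Fin m) (ω : Dig d m) : rademacher r ω ^ 2 = 1 := by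
  unfold rademacher
  rw [← Finset.prod_pow]
  exact Finset.prod_eq_one fun j _ => by split_ifs <;> norm_num

/-- The unnormalized Haar coefficient of `D` on the dyadic box of order `r` containing `ω`. -/
noncomputable def haarCoeff (D : Dig d m → ℝ) (r : Fin d → Fin m) (ω : Dig d m) : ℝ :=
  ∑ ω' ∈ Finset.univ.filter (fun ω' => truncDig r ω' = truncDig r ω), D ω' * rademacher r ω'

/-- The Haar functions of order `r`, with the signs of the Haar coefficients of `D`. -/
noncomputable def signedHaar (D : Dig d m → ℝ) (r : Fin d → Fin m) (ω : Dig d m) : ℝ :=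
  (if 0 ≤ haarCoeff D r ω then 1 else -1) * rademacher r ω

lemma isHaarFamily_signedHaar (D : Dig d m → ℝ) : IsHaarFamily (signedHaar D) where
  anti r j ω := by
    unfold signedHaar haarCoeff
    rw [truncDig_flipDigit le_rfl, rademacher_flipDigit, mul_neg]
  inv r j k hk ω := by
    unfold signedHaar haarCoeff
    rw [truncDig_flipDigit hk.le, rademacher_flipDigit_of_ne hk.ne']
  sq r ω := by
    unfold signedHaar
    rw [mul_pow, rademacher_sq, mul_one]
    split_ifs <;> norm_num

lemma avg_mul_le_avg_mul_signedHaar (D : Dig d m → ℝ) (r : Fin d → Fin m) {s : Dig d m → ℝ}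
    (hs : ∀ ω, |s ω| ≤ 1) :
    avg (fun ω => D ω * (s (truncDig r ω) * rademacher r ω))
      ≤ avg (fun ω => D ω * signedHaar D r ω) := by
  unfold avg
  refine div_le_div_of_nonneg_right ?_ (by positivity)
  rw [← Finset.sum_fiberwise (s := Finset.univ) (g := truncDig r)
    (f := fun ω => D ω * (s (truncDig r ω) * rademacher r ω)),
    ← Finset.sum_fiberwise (s := Finset.univ) (g := truncDig r)
    (f := fun ω => D ω * signedHaar D r ω)]
  refine Finset.sum_le_sum fun κ _ => ?_
  set T : ℝ := ∑ ω' ∈ Finset.univ.filter (fun ω' => truncDig r ω' = κ), D ω' * rademacher r ω'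
    with hT
  have e1 : ∑ ω ∈ Finset.univ.filter (fun ω => truncDig r ω = κ),
      D ω * (s (truncDig r ω) * rademacher r ω) = s κ * T := by
    rw [hT, Finset.mul_sum]
    refine Finset.sum_congr rfl fun ω hω => ?_
    rw [(Finset.mem_filter.1 hω).2]; ring
  have e2 : ∑ ω ∈ Finset.univ.filter (fun ω => truncDig r ω = κ),
      D ω * signedHaar D r ω = (if 0 ≤ T then 1 else -1) * T := by
    conv_rhs => rw [hT, Finset.mul_sum]
    refine Finset.sum_congr rfl fun ω hω => ?_
    rw [signedHaar, haarCoeff, (Finset.mem_filter.1 hω).2]; ring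
  rw [e1, e2]
  have h1 : s κ * T ≤ |T| := (le_abs_self _).trans (by
    rw [abs_mul]; exact mul_le_of_le_one_left (abs_nonneg _) (hs κ))
  refine h1.trans (le_of_eq ?_)
  split_ifs with h
  · rw [abs_of_nonneg h, one_mul]
  · rw [abs_of_neg (not_le.1 h), neg_one_mul]

/-- The cells of side lengths `2 ^ (- r j)` containing none of the points have proportion at least
`1 - A.card * 2 ^ (-∑ r j)`. On these the Haar coefficient of the counting part vanishes, and that of
the coordinate product is explicit. -/
theorem le_avg_digDisc_mul_signedHaar (A : Finset (Fin d → ℝ)) (u : Fin d → ℝ)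
    (r : Fin d → Fin m) :
    A.card * ((2 : ℝ)⁻¹) ^ (∑ j, ((r j : ℕ) + 2)) * (1 - A.card * ((2 : ℝ)⁻¹) ^ ∑ j, (r j : ℕ))
      ≤ avg (fun ω => digDisc A u ω * signedHaar (digDisc A u) r ω) := by
  classical
  -- the indicator of the cells without points
  set E : Dig d m → Prop := fun ω => ∃ p ∈ A, ∀ j, InCell (u j) (r j) (ω j) (p j) with hE
  have htr : ∀ ω, E (truncDig r ω) ↔ E ω := by
    intro ω
    have ht : ∀ j, truncBits (r j) (truncDig r ω j) = truncBits (r j) (ω j) := by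
      intro j
      funext k
      simp only [truncDig, truncBits]
      split_ifs <;> rfl
    simp only [hE, InCell, ht]
  set s : Dig d m → ℝ := fun ω => (-1) ^ (d + 1) * if E ω then 0 else 1 with hs
  refine le_trans (le_of_le_of_eq (b := A.card * ((2 : ℝ)⁻¹) ^ (∑ j, ((r j : ℕ) + 2)) *
    avg (fun ω => if E ω then 0 else 1)) ?_ ?_)
    (avg_mul_le_avg_mul_signedHaar (digDisc A u) r (s := s) ?_)
  · refine mul_le_mul_of_nonneg_left ?_ (by positivity)
    have h1 : avg (fun ω => if E ω then (0 : ℝ) else 1) = 1 - prop E := by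
      unfold prop
      rw [← avg_const (d := d) (m := m) (1 : ℝ), ← avg_sub]
      congr 1
      funext ω
      by_cases h : E ω <;> simp [h, avg_const]
    rw [h1]
    have h2 := (prop_exists_le A fun p (ω : Dig d m) => ∀ j, InCell (u j) (r j) (ω j) (p j)).trans
      (Finset.sum_le_sum fun p _ => prop_inCell_le u p r)
    rw [Finset.sum_const, nsmul_eq_mul] at h2
    linarith
  · have hanti : ∀ j ω, s (truncDig r (flipDigit j (r j) ω)) * rademacher r (flipDigit j (r j) ω)
        = -(s (truncDig r ω) * rademacher r ω) := by
      intro j ω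
      rw [truncDig_flipDigit le_rfl, rademacher_flipDigit, mul_neg]
    rw [avg_digDisc_mul]
    have h1 : ∀ p ∈ A, avg (fun ω => (∏ j, if p j < digVal (u j) (ω j) then 1 else 0) *
        (s (truncDig r ω) * rademacher r ω)) = 0 := by
      intro p hp
      rw [avg_prod_mul_eq_of_anti hanti fun j b => if p j < digVal (u j) b then 1 else 0]
      refine (congrArg avg (funext fun ω => ?_)).trans (avg_const (d := d) (m := m) 0)
      by_cases h : ∀ j, InCell (u j) (r j) (ω j) (p j)
      · have : E (truncDig r ω) := (htr ω).2 ⟨p, hp, h⟩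
        simp [hs, this]
      · obtain ⟨j, hj⟩ := not_forall.1 h
        rw [Finset.prod_eq_zero (Finset.mem_univ j)
          ((abs_indicator_sub_flipBit_le (u j) (p j) (r j) (ω j)).2 hj), zero_mul]
    rw [Finset.sum_eq_zero h1, zero_sub,
      avg_prod_mul_eq_of_anti hanti fun j b => digVal (u j) b, mul_assoc, ← mul_neg]
    congr 1
    rw [← neg_one_mul, ← avg_const_mul, ← avg_const_mul]
    congr 1
    funext ω
    have h2 : ∏ j, (digVal (u j) (ω j) - digVal (u j) (flipBit (r j) (ω j))) / 2
        = (-1) ^ d * rademacher r ω * ((2 : ℝ)⁻¹) ^ (∑ j, ((r j : ℕ) + 2)) := by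
      simp only [digVal_sub_flipBit]
      rw [Finset.prod_mul_distrib, Finset.prod_pow_eq_pow_sum, Finset.prod_neg, rademacher]
      simp
    have h3 := rademacher_sq r ω
    have h4 : ((-1 : ℝ) ^ d) ^ 2 = 1 := by rw [← pow_mul, mul_comm, pow_mul]; norm_num
    rw [h2]
    simp only [hs, htr]
    split_ifs
    · ring
    · rw [pow_succ]
      linear_combination (-(2 : ℝ)⁻¹ ^ (∑ j, ((r j : ℕ) + 2))) * (h3 * ((-1 : ℝ) ^ d) ^ 2 + h4)
  · intro ω
    simp only [hs]
    rw [abs_mul, abs_pow, abs_neg, abs_one, one_pow, one_mul]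
    split_ifs <;> simp

end Digits

/-! ### Testing the discrepancy function against the tie-free product -/

section TieFree

open Function

variable {d m q n : ℕ} {f : (Fin d → Fin m) → Dig d m → ℝ} {v : Fin d}
  {I : Fin q → Finset (Fin m)}

/-- The factors from which a function `f r` is chosen. -/
def chosen (o : Fin q → Option (Fin d → Fin m)) : Finset (Fin q) :=
  Finset.univ.filter fun t => o t ≠ none

lemma mem_chosen {o : Fin q → Option (Fin d → Fin m)} {t : Fin q} :
    t ∈ chosen o ↔ ∃ r, o t = some r := by
  simp [chosen, Option.ne_none_iff_exists']

lemma mem_levels_of_mem_choices {o : Fin q → Option (Fin d → Fin m)} (ho : o ∈ choices n v I)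
    {t : Fin q} {r : Fin d → Fin m} (hr : o t = some r) :
    r ∈ levels n (labelBox v I (fun _ => none) t) := by
  have := Fintype.mem_piFinset.1 ho t
  rwa [hr, Finset.some_mem_insertNone] at this

lemma apply_mem_of_mem_choices {o : Fin q → Option (Fin d → Fin m)} (ho : o ∈ choices n v I)
    {t : Fin q} {r : Fin d → Fin m} (hr : o t = some r) : r v ∈ I t := by
  have := (mem_levels.1 (mem_levels_of_mem_choices ho hr)).1 v
  simpa [labelBox] using this

lemma two_le_card_chosen_of_tie {o : Fin q → Option (Fin d → Fin m)} {j : Fin d} (h : Tie o j) :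
    2 ≤ (chosen o).card := by
  obtain ⟨p, hp, hfit⟩ := h
  refine hp.trans (Finset.card_le_card fun t ht => ?_)
  obtain ⟨r, hr, _⟩ := (hfit t).exists_of_mem ht
  exact mem_chosen.2 ⟨r, hr⟩

lemma not_tie_of_sep (hsep : ∀ t t', t < t' → ∀ l ∈ I t, ∀ l' ∈ I t', l < l')
    {o : Fin q → Option (Fin d → Fin m)} (ho : o ∈ choices n v I) : ¬ Tie o v := by
  rintro ⟨p, hp, hfit⟩
  obtain ⟨t, ht, t', ht', hne⟩ := Finset.one_lt_card.1 (by omega : 1 < p.2.card)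
  obtain ⟨r, hr, hra⟩ := (hfit t).exists_of_mem ht
  obtain ⟨r', hr', hra'⟩ := (hfit t').exists_of_mem ht'
  have h1 := apply_mem_of_mem_choices ho hr
  have h2 := apply_mem_of_mem_choices ho hr'
  rw [hra] at h1
  rw [hra'] at h2
  rcases lt_or_gt_of_ne hne with h | h
  · exact lt_irrefl _ (hsep t t' h _ h1 _ h2)
  · exact lt_irrefl _ (hsep t' t h _ h2 _ h1)

/-- A summand without ties oscillates in every coordinate `j`, with frequency the largest level
occurring in this coordinate. -/
lemma exists_anti_of_not_tie (hf : IsHaarFamily f) {o : Fin q → Option (Fin d → Fin m)} {j : Fin d}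
    (hne : (chosen o).Nonempty) (h : ¬ Tie o j) (τ : ℝ) :
    ∃ k : Fin m, (∀ ω, choiceTerm f τ o (flipDigit j k ω) = -choiceTerm f τ o ω) ∧
      ∀ t r, o t = some r → r j ≤ k := by
  obtain ⟨t₁, ht₁⟩ := hne
  obtain ⟨r₁, hr₁⟩ := mem_chosen.1 ht₁
  obtain ⟨t₀, ht₀, hmax⟩ := Finset.exists_max_image (chosen o) (fun t => (o t).getD r₁ j) ⟨t₁, ht₁⟩
  obtain ⟨r₀, hr₀⟩ := mem_chosen.1 ht₀
  have hmax' : ∀ t r, o t = some r → r j ≤ r₀ j := by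
    intro t r hr
    have := hmax t (mem_chosen.2 ⟨r, hr⟩)
    simpa [hr, hr₀] using this
  have huniq : ∀ t r, o t = some r → t ≠ t₀ → r j < r₀ j := by
    intro t r hr htne
    refine lt_of_le_of_ne (hmax' t r hr) fun heq => h ?_
    refine ⟨(r₀ j, (chosen o).filter fun t => (o t).getD r₁ j = r₀ j), ?_, fun t' => ?_⟩
    · refine Finset.one_lt_card.2 ⟨t, ?_, t₀, ?_, htne⟩
      · exact Finset.mem_filter.2 ⟨mem_chosen.2 ⟨r, hr⟩, by simp [hr, heq]⟩
      · exact Finset.mem_filter.2 ⟨ht₀, by simp [hr₀]⟩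
    · rcases ho : o t' with _ | r'
      · simp [Fits, chosen, ho]
      · have h1 := hmax' t' r' ho
        by_cases h2 : r' j = r₀ j
        · simp [Fits, chosen, ho, slot, h2]
        · simp [Fits, chosen, ho, slot, h2, lt_of_le_of_ne h1 h2]
  refine ⟨r₀ j, fun ω => ?_, hmax'⟩
  unfold choiceTerm
  rw [← Finset.mul_prod_erase _ _ (Finset.mem_univ t₀), ← Finset.mul_prod_erase _ (fun t =>
    (o t).elim 1 fun r => τ * f r ω) (Finset.mem_univ t₀), hr₀, ← neg_mul]
  congr 1
  · simp only [Option.elim_some]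
    rw [hf.anti, mul_neg]
  · refine Finset.prod_congr rfl fun t ht => ?_
    rcases ho : o t with _ | r
    · rfl
    · simp only [Option.elim_some]
      rw [hf.inv r j _ (huniq t r ho (Finset.ne_of_mem_erase ht))]

lemma abs_choiceTerm_le (hf : IsHaarFamily f) {τ : ℝ} (hτ0 : 0 ≤ τ) (hτ1 : τ ≤ 1)
    (o : Fin q → Option (Fin d → Fin m)) (ω : Dig d m) : |choiceTerm f τ o ω| ≤ 1 := by
  unfold choiceTerm
  rw [Finset.abs_prod]
  refine Finset.prod_le_one (fun _ _ => abs_nonneg _) fun t _ => ?_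
  rcases o t with _ | r
  · simp
  · simp [abs_mul, hf.abs_eq, abs_of_nonneg hτ0, hτ1]

lemma choices_filter_card_le_one :
    (choices n v I).filter (fun o => (chosen o).card ≤ 1)
      = insert (fun _ => none) (((Finset.univ : Finset (Fin q)).sigma fun t =>
        levels n (labelBox v I (fun _ => none) t)).image fun x => update (fun _ => none) x.1
          (some x.2)) := by
  ext o
  simp only [Finset.mem_filter, Finset.mem_insert, Finset.mem_image, Finset.mem_sigma,
    Finset.mem_univ, true_and, Sigma.exists]
  constructor
  · rintro ⟨ho, hc⟩
    rcases Finset.eq_empty_or_nonempty (chosen o) with h | ⟨t, ht⟩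
    · left
      funext t
      by_contra hne
      have : t ∈ chosen o := by simpa [chosen] using hne
      rw [h] at this
      exact absurd this (Finset.notMem_empty t)
    · right
      obtain ⟨r, hr⟩ := mem_chosen.1 ht
      refine ⟨t, r, mem_levels_of_mem_choices ho hr, funext fun t' => ?_⟩
      by_cases htt : t' = t
      · subst htt; rw [update_self, hr]
      · rw [update_of_ne htt]
        by_contra hne
        have : t' ∈ chosen o := by simpa [chosen, eq_comm] using hne
        exact htt (Finset.card_le_one.1 hc _ this _ ht)
  · rintro (rfl | ⟨t, r, hr, rfl⟩)
    · refine ⟨Fintype.mem_piFinset.2 fun t => by simp, ?_⟩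
      simp [chosen]
    · refine ⟨Fintype.mem_piFinset.2 fun t' => ?_, ?_⟩
      · by_cases htt : t' = t
        · subst htt; rw [update_self]; exact Finset.some_mem_insertNone.2 hr
        · rw [update_of_ne htt]; simp
      · refine (Finset.card_le_card (t := {t}) fun t' ht' => ?_).trans (by simp)
        by_contra hne
        rw [Finset.mem_singleton] at hne
        simp [chosen, hne] at ht'

lemma prod_noTie_eq_one {o : Fin q → Option (Fin d → Fin m)} (h : (chosen o).card ≤ 1)
    (S : Finset (Fin d)) : ∏ j ∈ S, noTie o j = 1 :=
  Finset.prod_eq_one fun j _ => if_neg fun ht => by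
    have := two_le_card_chosen_of_tie ht
    omega

lemma choiceTerm_none (τ : ℝ) (ω : Dig d m) :
    choiceTerm f τ (fun _ : Fin q => none) ω = 1 := by simp [choiceTerm]

lemma choiceTerm_update (τ : ℝ) (t : Fin q) (r : Fin d → Fin m) (ω : Dig d m) :
    choiceTerm f τ (update (fun _ => none) t (some r)) ω = τ * f r ω := by
  unfold choiceTerm
  rw [Finset.prod_eq_single t]
  · simp
  · intro t' _ h; simp [h]
  · simp

lemma card_choices_le : ((choices n v I).card : ℝ) ≤ (1 + (m : ℝ) ^ d) ^ q := by
  unfold choices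
  rw [Fintype.card_piFinset]
  push_cast
  refine (Finset.prod_le_prod (g := fun _ => 1 + (m : ℝ) ^ d) (fun _ _ => by positivity)
    fun t _ => ?_).trans_eq (by simp)
  rw [Finset.card_insertNone]
  have : ((levels n (labelBox v I (fun _ => none) t)).card : ℝ) ≤ (m : ℝ) ^ d := by
    exact_mod_cast card_levels_le _
  push_cast
  linarith

lemma abs_mul_prod_noTie_le {x : ℝ} (o : Fin q → Option (Fin d → Fin m)) (S : Finset (Fin d)) :
    |x * ∏ j ∈ S, noTie o j| ≤ |x| := by
  rw [abs_mul, Finset.abs_prod]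
  refine mul_le_of_le_one_right (abs_nonneg _) (Finset.prod_le_one (fun _ _ => abs_nonneg _)
    fun j _ => ?_)
  unfold noTie
  split_ifs <;> simp

/-- The products of at least two functions without ties are nearly orthogonal to `D`. -/
lemma abs_avg_mul_choiceTerm_le (hf : IsHaarFamily f) {D : Dig d m → ℝ} {τ ε : ℝ} {gap : ℕ}
    (hτ0 : 0 ≤ τ) (hτ1 : τ ≤ 1) (hgap : 1 ≤ gap) (hε : 0 ≤ ε)
    (hsep : ∀ t t', t < t' → ∀ l ∈ I t, ∀ l' ∈ I t', (l : ℕ) + gap ≤ l')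
    (hup : ∀ (r : Fin d → Fin m) (g : Dig d m → ℝ), (∀ j ω, g (flipDigit j (r j) ω) = -g ω) →
      (∀ ω, |g ω| ≤ 1) → n + gap ≤ ∑ j, (r j : ℕ) → |avg fun ω => D ω * g ω| ≤ ε)
    {o : Fin q → Option (Fin d → Fin m)} (ho : o ∈ choices n v I) (hc : 2 ≤ (chosen o).card) :
    |avg (fun ω => D ω * choiceTerm f τ o ω) * ∏ j ∈ Finset.univ.erase v, noTie o j| ≤ ε := by
  have hsep' : ∀ t t', t < t' → ∀ l ∈ I t, ∀ l' ∈ I t', l < l' := fun t t' h l hl l' hl' =>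
    Fin.lt_def.2 (by have := hsep t t' h l hl l' hl'; omega)
  by_cases hT : ∃ j ∈ Finset.univ.erase v, Tie o j
  · obtain ⟨j, hj, ht⟩ := hT
    rw [Finset.prod_eq_zero (f := fun j => noTie o j) hj (if_pos ht), mul_zero, abs_zero]
    exact hε
  · refine (abs_mul_prod_noTie_le o _).trans ?_
    have hT' : ∀ j, ¬ Tie o j := by
      intro j hj
      by_cases hjv : j = v
      · subst hjv; exact not_tie_of_sep hsep' ho hj
      · exact hT ⟨j, Finset.mem_erase.2 ⟨hjv, Finset.mem_univ _⟩, hj⟩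
    choose k hk hk' using fun j => exists_anti_of_not_tie hf
      (Finset.card_pos.1 (by omega : 0 < (chosen o).card)) (hT' j) τ
    refine hup k _ hk (abs_choiceTerm_le hf hτ0 hτ1 o) ?_
    obtain ⟨t, t', ht, ht', hlt⟩ : ∃ t t', t ∈ chosen o ∧ t' ∈ chosen o ∧ t < t' := by
      obtain ⟨t, ht, t', ht', hne⟩ := Finset.one_lt_card.1 (by omega : 1 < (chosen o).card)
      rcases lt_or_gt_of_ne hne with h | h
      · exact ⟨t, t', ht, ht', h⟩
      · exact ⟨t', t, ht', ht, h⟩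
    obtain ⟨r, hr⟩ := mem_chosen.1 ht
    obtain ⟨r', hr'⟩ := mem_chosen.1 ht'
    have h1 := hsep t t' hlt _ (apply_mem_of_mem_choices ho hr) _ (apply_mem_of_mem_choices ho hr')
    have h2 := Fin.le_def.1 (hk' v t' r' hr')
    have h3 := (mem_levels.1 (mem_levels_of_mem_choices ho hr)).2
    have h4 : ∑ j ∈ Finset.univ.erase v, (r j : ℕ) ≤ ∑ j ∈ Finset.univ.erase v, (k j : ℕ) :=
      Finset.sum_le_sum fun j _ => Fin.le_def.1 (hk' j t r hr)
    rw [← Finset.add_sum_erase _ _ (Finset.mem_univ v)] at h3 ⊢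
    omega

/-- The linear part of the tie-free product dominates its inner product with `D`. The terms of higher
order are oscillating functions of total frequency at least `n + gap`: their largest levels in the
coordinate `v` belong to different blocks, and their largest levels in the other coordinates are
attained once. -/
theorem le_avg_mul_tieFree_sub_one (hf : IsHaarFamily f) {D : Dig d m → ℝ} {τ c₀ ε : ℝ} {gap : ℕ}
    (hτ0 : 0 ≤ τ) (hτ1 : τ ≤ 1) (hgap : 1 ≤ gap) (hε : 0 ≤ ε)
    (hsep : ∀ t t', t < t' → ∀ l ∈ I t, ∀ l' ∈ I t', (l : ℕ) + gap ≤ l')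
    (hlow : ∀ r : Fin d → Fin m, ∑ j, (r j : ℕ) = n → c₀ ≤ avg fun ω => D ω * f r ω)
    (hup : ∀ (r : Fin d → Fin m) (g : Dig d m → ℝ), (∀ j ω, g (flipDigit j (r j) ω) = -g ω) →
      (∀ ω, |g ω| ≤ 1) → n + gap ≤ ∑ j, (r j : ℕ) → |avg fun ω => D ω * g ω| ≤ ε) :
    τ * c₀ * ∑ t, ((levels n (labelBox v I (fun _ => none) t)).card : ℝ)
        - (1 + (m : ℝ) ^ d) ^ q * ε
      ≤ avg fun ω => D ω * (tieFree n f τ v I (Finset.univ.erase v) ω - 1) := by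
  set F : (Fin q → Option (Fin d → Fin m)) → ℝ := fun o =>
    avg (fun ω => D ω * choiceTerm f τ o ω) * ∏ j ∈ Finset.univ.erase v, noTie o j with hF
  have e1 : (avg fun ω => D ω * (tieFree n f τ v I (Finset.univ.erase v) ω - 1))
      = ∑ o ∈ choices n v I, F o - avg D := by
    have : ∀ ω, D ω * (tieFree n f τ v I (Finset.univ.erase v) ω - 1)
        = ∑ o ∈ choices n v I, (∏ j ∈ Finset.univ.erase v, noTie o j) *
          (D ω * choiceTerm f τ o ω) - D ω := by
      intro ω
      unfold tieFree
      rw [mul_sub, Finset.mul_sum, mul_one]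
      congr 1
      exact Finset.sum_congr rfl fun o _ => by ring
    simp only [this]
    rw [avg_sub, avg_sum]
    congr 1
    exact Finset.sum_congr rfl fun o _ => by rw [avg_const_mul, mul_comm]
  have hnotmem : (fun _ : Fin q => (none : Option (Fin d → Fin m))) ∉
      (((Finset.univ : Finset (Fin q)).sigma fun t =>
        levels n (labelBox v I (fun _ => none) t)).image fun x => update (fun _ => none) x.1
          (some x.2)) := by
    intro h
    obtain ⟨x, _, hx⟩ := Finset.mem_image.1 h
    have := congrFun hx x.1
    simp at this
  have hinj : Set.InjOn (fun x : (_ : Fin q) × (Fin d → Fin m) =>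
      update (fun _ : Fin q => (none : Option (Fin d → Fin m))) x.1 (some x.2))
      ((Finset.univ : Finset (Fin q)).sigma fun t => levels n (labelBox v I (fun _ => none) t)) := by
    rintro ⟨t, r⟩ _ ⟨t', r'⟩ _ h
    have h1 := congrFun h t
    by_cases htt : t = t'
    · subst htt
      simp only [update_self, Option.some_inj] at h1
      rw [h1]
    · simp [htt] at h1
  have e2 : ∑ o ∈ (choices n v I).filter (fun o => (chosen o).card ≤ 1), F o
      = avg D + ∑ t, ∑ r ∈ levels n (labelBox v I (fun _ => none) t),
        τ * avg fun ω => D ω * f r ω := by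
    have hone : ∀ o ∈ (choices n v I).filter (fun o => (chosen o).card ≤ 1),
        F o = avg (fun ω => D ω * choiceTerm f τ o ω) := by
      intro o ho
      simp only [hF]
      rw [prod_noTie_eq_one (Finset.mem_filter.1 ho).2, mul_one]
    rw [Finset.sum_congr rfl hone, choices_filter_card_le_one, Finset.sum_insert hnotmem,
      Finset.sum_image hinj, Finset.sum_sigma]
    simp only [choiceTerm_none, mul_one, choiceTerm_update]
    congr 1
    refine Finset.sum_congr rfl fun t _ => Finset.sum_congr rfl fun r _ => ?_
    rw [← avg_const_mul]
    congr 1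
    funext ω
    ring
  have e3 : |∑ o ∈ (choices n v I).filter (fun o => ¬ (chosen o).card ≤ 1), F o|
      ≤ (1 + (m : ℝ) ^ d) ^ q * ε := by
    refine (Finset.abs_sum_le_sum_abs _ _).trans ((Finset.sum_le_sum fun o ho => ?_).trans
      (b := ∑ o ∈ (choices n v I).filter (fun o => ¬ (chosen o).card ≤ 1), ε) ?_)
    · have h := Finset.mem_filter.1 ho
      exact abs_avg_mul_choiceTerm_le hf hτ0 hτ1 hgap hε hsep hup h.1 (by omega)
    · rw [Finset.sum_const, nsmul_eq_mul]
      refine mul_le_mul_of_nonneg_right (le_trans ?_ (card_choices_le (n := n) (v := v) (I := I))) hε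
      exact_mod_cast Finset.card_filter_le _ _
  have e4 : τ * c₀ * ∑ t, ((levels n (labelBox v I (fun _ => none) t)).card : ℝ)
      ≤ ∑ t, ∑ r ∈ levels n (labelBox v I (fun _ => none) t), τ * avg fun ω => D ω * f r ω := by
    rw [Finset.mul_sum]
    refine Finset.sum_le_sum fun t _ => ?_
    rw [mul_comm, ← nsmul_eq_mul]
    refine Finset.card_nsmul_le_sum _ _ _ fun r hr => ?_
    exact mul_le_mul_of_nonneg_left (hlow r (mem_levels.1 hr).2) hτ0
  rw [e1, ← Finset.sum_filter_add_sum_filter_not _ (fun o => (chosen o).card ≤ 1), e2]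
  have := (abs_le.1 e3).1
  linarith

end TieFree

/-! ### Counting levels and choosing a shift -/

section Shift

open Function

variable {d : ℕ}

/-- The levels in the coordinates other than `v` and `w` may be chosen freely below `K`; the level in
`w` is then determined by the coordinate sum. -/
lemma le_card_levels {n K : ℕ} {v w : Fin d} (hvw : v ≠ w) {J : Fin d → Finset (Fin (n + 1))}
    (hJ : ∀ j, j ≠ v → J j = Finset.univ) (hK : K ≤ n + 1)
    (hE : ∀ l ∈ J v, (l : ℕ) + (d - 2) * K ≤ n) :
    (J v).card * K ^ (d - 2) ≤ (levels n J).card := by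
  have hwv : w ∈ Finset.univ.erase v := Finset.mem_erase.2 ⟨hvw.symm, Finset.mem_univ _⟩
  have hcard : ((Finset.univ.erase v).erase w).card = d - 2 := by
    rw [Finset.card_erase_of_mem hwv, Finset.card_erase_of_mem (Finset.mem_univ _),
      Finset.card_univ, Fintype.card_fin]
    omega
  set B : Fin d → Finset (Fin (n + 1)) := fun j => if j = v then J v else if j = w then {0} else
    Finset.univ.image (Fin.castLE hK) with hB
  have hBv : B v = J v := by simp [hB]
  have hBw : B w = {0} := by simp [hB, hvw.symm]
  have hBj : ∀ j ∈ (Finset.univ.erase v).erase w, B j = Finset.univ.image (Fin.castLE hK) := by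
    intro j hj
    simp only [Finset.mem_erase] at hj
    simp [hB, hj.1, hj.2.1]
  have h1 : (Fintype.piFinset B).card = (J v).card * K ^ (d - 2) := by
    rw [Fintype.card_piFinset, ← Finset.mul_prod_erase _ _ (Finset.mem_univ v),
      ← Finset.mul_prod_erase _ _ hwv, hBv, hBw, Finset.card_singleton, one_mul,
      Finset.prod_congr rfl fun j hj => by
        rw [hBj j hj, Finset.card_image_of_injective _ (Fin.castLE_injective hK), Finset.card_univ,
          Fintype.card_fin], Finset.prod_const, hcard]
  rw [← h1]
  have hsum : ∀ r ∈ Fintype.piFinset B, ∑ j ∈ Finset.univ.erase w, (r j : ℕ) ≤ n := by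
    intro r hr
    have hr' := Fintype.mem_piFinset.1 hr
    have hvw' : v ∈ Finset.univ.erase w := Finset.mem_erase.2 ⟨hvw, Finset.mem_univ _⟩
    rw [← Finset.add_sum_erase _ _ hvw', Finset.erase_right_comm]
    refine le_trans (Nat.add_le_add_left ?_ _) (hE (r v) (by rw [← hBv]; exact hr' v))
    rw [← hcard, ← smul_eq_mul]
    refine Finset.sum_le_card_nsmul _ _ _ fun j hj => ?_
    have := hr' j
    rw [hBj j hj] at this
    obtain ⟨i, _, hi⟩ := Finset.mem_image.1 this
    rw [← hi]
    exact i.2.le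
  refine Finset.card_le_card_of_injOn (fun r => update r w
    (⟨n - ∑ j ∈ Finset.univ.erase w, (r j : ℕ), by omega⟩ : Fin (n + 1))) (fun r hr => ?_) ?_
  · have hr0 : r ∈ Fintype.piFinset B := hr
    beta_reduce
    refine Finset.mem_coe.2 (mem_levels.2 ⟨fun j => ?_, ?_⟩)
    · by_cases hj : j = v
      · subst hj
        rw [update_of_ne hvw, ← hBv]
        exact Fintype.mem_piFinset.1 hr0 j
      · rw [hJ j hj]; exact Finset.mem_univ _
    · rw [← Finset.add_sum_erase _ _ (Finset.mem_univ w), update_self]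
      have : ∑ j ∈ Finset.univ.erase w, ((update r w
          (⟨n - ∑ j ∈ Finset.univ.erase w, (r j : ℕ), by omega⟩ : Fin (n + 1)) j : Fin (n + 1)) : ℕ)
          = ∑ j ∈ Finset.univ.erase w, (r j : ℕ) :=
        Finset.sum_congr rfl fun j hj => by rw [update_of_ne (Finset.ne_of_mem_erase hj)]
      rw [this]
      have := hsum r hr0
      simp only
      omega
  · intro r hr r' hr' h
    have h1 := Fintype.mem_piFinset.1 hr w
    have h2 := Fintype.mem_piFinset.1 hr' w
    rw [hBw, Finset.mem_singleton] at h1 h2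
    funext j
    by_cases hj : j = w
    · subst hj; rw [h1, h2]
    · have := congrFun h j
      simpa [hj] using this

lemma digVal_mem {m : ℕ} {u : ℝ} (hu0 : 0 ≤ u) (hu : u ≤ ((2 : ℝ)⁻¹) ^ m) (b : Fin m → Bool) :
    0 ≤ digVal u b ∧ digVal u b ≤ 1 := by
  have h1 : ∀ N : ℕ, ∑ i ∈ Finset.range N, ((2 : ℝ)⁻¹) ^ (i + 1) = 1 - ((2 : ℝ)⁻¹) ^ N := by
    intro N
    induction N with
    | zero => simp
    | succ N ih => rw [Finset.sum_range_succ, ih, pow_succ]; ring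
  have h2 : ∑ k : Fin m, (if b k then ((2 : ℝ)⁻¹) ^ ((k : ℕ) + 1) else 0)
      ≤ ∑ k : Fin m, ((2 : ℝ)⁻¹) ^ ((k : ℕ) + 1) := by
    refine Finset.sum_le_sum fun k _ => ?_
    split_ifs
    · exact le_rfl
    · positivity
  rw [Fin.sum_univ_eq_sum_range (fun k => ((2 : ℝ)⁻¹) ^ (k + 1)), h1] at h2
  have h3 : 0 ≤ ∑ k : Fin m, (if b k then ((2 : ℝ)⁻¹) ^ ((k : ℕ) + 1) else 0) :=
    Finset.sum_nonneg fun k _ => by positivity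
  unfold digVal
  constructor <;> linarith

lemma discrepancyFunction_eq {m : ℕ} {A : Finset (Fin d → ℝ)}
    (hA : (A : Set (Fin d → ℝ)) ⊆ unitCube d) {u : Fin d → ℝ} {ω : Dig d m}
    (h0 : ∀ j, 0 ≤ digVal (u j) (ω j)) :
    discrepancyFunction A (fun j => digVal (u j) (ω j)) = digDisc A u ω := by
  classical
  unfold discrepancyFunction digDisc
  congr 1
  · have h1 : (A : Set (Fin d → ℝ)) ∩ anchoredBox (fun j => digVal (u j) (ω j))
        = ((A.filter fun p => ∀ j, p j < digVal (u j) (ω j) : Finset (Fin d → ℝ)) :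
          Set (Fin d → ℝ)) := by
      ext p
      simp only [Set.mem_inter_iff, Finset.mem_coe, anchoredBox, Set.mem_pi, Set.mem_univ,
        true_implies, Set.mem_Ico, Finset.mem_filter]
      refine and_congr_right fun hp => forall_congr' fun j => and_iff_right ?_
      exact (hA hp).1 j
    rw [h1, Set.ncard_coe_finset, Finset.card_filter]
    push_cast
    refine Finset.sum_congr rfl fun p _ => ?_
    rw [Finset.prod_ite_zero]
    simp
  · congr 1
    unfold anchoredBox Measure.real
    rw [Real.volume_pi_Ico_toReal (a := fun _ => (0 : ℝ)) (Pi.le_def.2 h0)]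
    simp

/-- Almost every translate of the dyadic grid avoids the exceptional null set of the `L^∞`-norm. -/
lemma exists_shift {A : Finset (Fin d → ℝ)} (hA : (A : Set (Fin d → ℝ)) ⊆ unitCube d) {B : ℝ}
    (hB0 : 0 ≤ B)
    (hB : eLpNorm (discrepancyFunction A) ⊤ (volume.restrict (unitCube d)) ≤ ENNReal.ofReal B)
    (m : ℕ) : ∃ u : Fin d → ℝ, ∀ ω : Dig d m, |digDisc A u ω| ≤ B := by
  have h1 : ∀ᵐ x ∂(volume.restrict (unitCube d)), |discrepancyFunction A x| ≤ B := by
    rw [eLpNorm_exponent_top] at hB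
    filter_upwards [ae_le_eLpNormEssSup (f := discrepancyFunction A)
      (μ := volume.restrict (unitCube d))] with x hx
    have h := hx.trans hB
    rw [← ofReal_norm, ENNReal.ofReal_le_ofReal_iff hB0] at h
    exact h
  have h2 : ∀ᵐ x : Fin d → ℝ, x ∈ unitCube d → |discrepancyFunction A x| ≤ B :=
    (ae_restrict_iff' measurableSet_Icc).1 h1
  have h3 : ∀ᵐ u : Fin d → ℝ, ∀ ω : Dig d m, (fun j => digVal (u j) (ω j)) ∈ unitCube d →
      |discrepancyFunction A (fun j => digVal (u j) (ω j))| ≤ B := by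
    rw [ae_all_iff]
    intro ω
    have h4 := (measurePreserving_add_right (volume : Measure (Fin d → ℝ))
      (fun j => digVal 0 (ω j))).quasiMeasurePreserving.ae h2
    filter_upwards [h4] with u hu
    have : (fun j => digVal (u j) (ω j)) = u + fun j => digVal 0 (ω j) := by
      funext j; simp [digVal]
    rwa [this]
  have hopen : IsOpen (Set.univ.pi fun _ : Fin d => Set.Ioo (0 : ℝ) (((2 : ℝ)⁻¹) ^ m)) :=
    isOpen_set_pi Set.finite_univ fun _ _ => isOpen_Ioo
  have hne : (Set.univ.pi fun _ : Fin d => Set.Ioo (0 : ℝ) (((2 : ℝ)⁻¹) ^ m)).Nonempty :=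
    Set.univ_pi_nonempty_iff.2 fun _ => Set.nonempty_Ioo.2 (by positivity)
  obtain ⟨u, hu, hgood⟩ := (Measure.dense_of_ae h3).inter_open_nonempty _ hopen hne
  refine ⟨u, fun ω => ?_⟩
  have hmem : ∀ j, 0 ≤ digVal (u j) (ω j) ∧ digVal (u j) (ω j) ≤ 1 := fun j =>
    digVal_mem (hu j (Set.mem_univ _)).1.le (hu j (Set.mem_univ _)).2.le _
  rw [← discrepancyFunction_eq hA fun j => (hmem j).1]
  exact hgood ω ⟨fun j => (hmem j).1, fun j => (hmem j).2⟩

end Shift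

/-! ### The lower bound in terms of the parameters -/

section Core

open Function

variable {d m q n : ℕ}

/-- Intervals of length `L₀`, separated by intervals of the same length. -/
def levelBlock (m L₀ : ℕ) {q : ℕ} (t : Fin q) : Finset (Fin m) :=
  Finset.univ.filter fun l => 2 * t * L₀ ≤ (l : ℕ) ∧ (l : ℕ) < 2 * t * L₀ + L₀

lemma block_end_le {L₀ : ℕ} (t : Fin q) : 2 * t * L₀ + 2 * L₀ ≤ 2 * q * L₀ := by
  have : (t : ℕ) + 1 ≤ q := t.2
  nlinarith [Nat.mul_le_mul_right (2 * L₀) this]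

lemma card_levelBlock {L₀ : ℕ} (h : 2 * q * L₀ ≤ m) (t : Fin q) :
    (levelBlock m L₀ t).card = L₀ := by
  have h1 := block_end_le (L₀ := L₀) t
  have h2 : (levelBlock m L₀ t).image (fun l : Fin m => (l : ℕ))
      = Finset.Ico (2 * t * L₀) (2 * t * L₀ + L₀) := by
    ext l
    simp only [levelBlock, Finset.mem_image, Finset.mem_filter, Finset.mem_univ, true_and,
      Finset.mem_Ico]
    constructor
    · rintro ⟨l, hl, rfl⟩; exact hl
    · intro hl; exact ⟨⟨l, by omega⟩, hl, rfl⟩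
  rw [← Finset.card_image_of_injective _ Fin.val_injective, h2, Nat.card_Ico]
  omega

lemma levelBlock_sep {L₀ : ℕ} (t t' : Fin q) (h : t < t') (l : Fin m) (hl : l ∈ levelBlock m L₀ t)
    (l' : Fin m) (hl' : l' ∈ levelBlock m L₀ t') : (l : ℕ) + L₀ ≤ l' := by
  have h1 := (Finset.mem_filter.1 hl).2
  have h2 := (Finset.mem_filter.1 hl').2
  have h3 : (t : ℕ) + 1 ≤ t' := Fin.lt_def.1 h
  have h4 := Nat.mul_le_mul_right (2 * L₀) h3
  have h5 : 2 * (t : ℕ) * L₀ + 2 * L₀ = ((t : ℕ) + 1) * (2 * L₀) := by ring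
  have h6 : 2 * (t' : ℕ) * L₀ = t' * (2 * L₀) := by ring
  omega

/-- With `2 ^ n` comparable to the number of points, a Haar coefficient of total level `n` is bounded
below by a constant depending on the dimension only. -/
lemma le_avg_haar {A : Finset (Fin d → ℝ)} (h1 : 2 * A.card ≤ 2 ^ n) (h2 : 2 ^ n ≤ 4 * A.card)
    (u : Fin d → ℝ) (r : Fin d → Fin m) (hr : ∑ j, (r j : ℕ) = n) :
    ((4 : ℝ)⁻¹) ^ d / 8 ≤ avg fun ω => digDisc A u ω * signedHaar (digDisc A u) r ω := by
  refine le_trans ?_ (le_avg_digDisc_mul_signedHaar A u r)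
  have e1 : ∑ j, ((r j : ℕ) + 2) = n + 2 * d := by
    rw [Finset.sum_add_distrib, hr]; simp [mul_comm]
  have e2 : ((2 : ℝ)⁻¹) ^ (2 * d) = ((4 : ℝ)⁻¹) ^ d := by rw [pow_mul]; norm_num
  rw [e1, hr, pow_add, e2]
  set a : ℝ := A.card * ((2 : ℝ)⁻¹) ^ n with ha
  have h2n : (0 : ℝ) < 2 ^ n := by positivity
  have ha' : a = A.card / 2 ^ n := by rw [ha, inv_pow]; rfl
  have b1 : a ≤ 1 / 2 := by
    rw [ha', div_le_iff₀ h2n]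
    have : (2 : ℝ) * A.card ≤ 2 ^ n := by exact_mod_cast h1
    linarith
  have b2 : 1 / 4 ≤ a := by
    rw [ha', le_div_iff₀ h2n]
    have : (2 : ℝ) ^ n ≤ 4 * A.card := by exact_mod_cast h2
    linarith
  have e3 : A.card * (((2 : ℝ)⁻¹) ^ n * ((4 : ℝ)⁻¹) ^ d) * (1 - a)
      = ((4 : ℝ)⁻¹) ^ d * (a * (1 - a)) := by rw [ha]; ring
  rw [e3, div_eq_mul_one_div]
  exact mul_le_mul_of_nonneg_left (by nlinarith) (by positivity)

/-- The duality argument: the tie-free product has bounded mean, and its inner product with the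
discrepancy function is large. -/
theorem exists_core_bound (d : ℕ) (hd : 3 ≤ d) :
    ∃ c e : ℕ, ∀ (n m q y L₀ K : ℕ) (lam κ τ X B : ℝ) (A : Finset (Fin d → ℝ)) (u : Fin d → ℝ),
    m = n + 1 → 2 * A.card ≤ 2 ^ n → 2 ^ n ≤ 4 * A.card →
    (∀ ω : Dig d m, |digDisc A u ω| ≤ B) →
    2 ≤ m → 2 ≤ lam → 1 ≤ y → (y ^ 2 ^ (d + 1)) ^ 4 ≤ m → 1 ≤ q → q ≤ m →
    y ^ 2 ^ (d + 1) ≤ L₀ → 2 * q * L₀ + (d - 2) * K ≤ n → K ≤ n + 1 →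
    τ ^ 2 * (L₀ * (m : ℝ) ^ (d - 2)) = κ ^ 2 → 0 < τ → τ ≤ 1 → 0 < κ → d * lam ^ e ≤ y →
    q * ((1 + (m : ℝ) ^ d) ^ (2 * q) * ((m : ℝ) ^ c * (2 * Real.exp (-lam ^ 2 / 2)))) ≤ 1 →
    q * ((m : ℝ) ^ c * (2 * Real.exp (-lam ^ 2 / 2)) + 2 * Real.exp (-1 / (4 * κ ^ 2)))
      * (2 * Real.exp (2 * κ ^ 2 * q)) ≤ 1 / 4 →
    1 ≤ X → τ * lam ^ d * √m ^ (d - 1) ≤ X → q * ((y : ℝ) ^ 2 ^ (d + 1) * (X / √m)) ≤ 1 →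
    d * ((1 + 3 * X ^ 2 * q ^ 2) ^ d *
          (18 * X ^ 3 * q ^ 3 * (y : ℝ) ^ 2 ^ (d + 1) / √m + 4 * q ^ 2 * lam ^ e * X ^ 2 / y)
        + (1 + m * 2 ^ q) ^ d * (m * 2 ^ q * (1 + (m : ℝ) ^ d) ^ q *
          ((m : ℝ) ^ c * (2 * Real.exp (-lam ^ 2 / 2))))) ≤ 1 →
    (1 + (m : ℝ) ^ d) ^ q * ((2 : ℝ)⁻¹) ^ L₀ ≤ 1 →
    τ * (((4 : ℝ)⁻¹) ^ d / 8) * (q * (L₀ * (K : ℝ) ^ (d - 2))) - 1 ≤ 4 * B := by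
  obtain ⟨c₁, e₁, hlabel⟩ := exists_owp_labelGood d
  obtain ⟨c₂, e₂, hsq⟩ := exists_owp_sum_sq_hyp_le d (d - 2) (by omega)
  refine ⟨c₁ + c₂, e₁ + e₂, ?_⟩
  intro n m q y L₀ K lam κ τ X B A u hmn hA1 hA2 hB hm hlam hy hym hq hqm hyL hK hKn hτκ hτ0 hτ1
    hκ hlamy hnum1 hnum2 hX hτX hz hE hgap
  have hm1 : 1 ≤ m := by omega
  have hlam1 : 1 ≤ lam := by linarith
  have hy0 : (0 : ℝ) < y := by exact_mod_cast hy
  have hm0 : (0 : ℝ) < m := by exact_mod_cast hm1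
  have hL0 : 1 ≤ L₀ := le_trans (Nat.one_le_pow _ _ hy) hyL
  set v : Fin d := ⟨0, by omega⟩ with hv
  set w : Fin d := ⟨1, by omega⟩ with hw
  have hvw : v ≠ w := by simp [hv, hw]
  set f := signedHaar (m := m) (digDisc A u) with hf'
  have hf : IsHaarFamily f := isHaarFamily_signedHaar _
  have h2q : 2 * q * L₀ ≤ m := by
    have := Nat.zero_le ((d - 2) * K)
    omega
  set I : Fin q → Finset (Fin m) := fun t => levelBlock m L₀ t with hI
  have hsepgap : ∀ t t', t < t' → ∀ l ∈ I t, ∀ l' ∈ I t', (l : ℕ) + L₀ ≤ l' := levelBlock_sep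
  have hsep : ∀ t t', t < t' → ∀ l ∈ I t, ∀ l' ∈ I t', l < l' := fun t t' h l hl l' hl' =>
    Fin.lt_def.2 (by have := hsepgap t t' h l hl l' hl'; omega)
  have hR : ∀ (J : Fin q → Fin d → Finset (Fin m)) (V : Finset (Fin q)), (∀ t, J t v = I t) →
      avg (fun ω => |∏ t ∈ V, (1 + τ * hyp n f (J t) ω)|) ≤ 2 := by
    intro J V hJ
    refine avg_abs_riesz_le_two (v := v) (κ := κ) (M := L₀ * (m : ℝ) ^ (d - 2)) (c := c₁ + c₂)
      (lam := lam) hf (fun t t' h l hl l' hl' => ?_) hτκ hτ0 hτ1 hκ (fun t _ => ?_) hnum1 hnum2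
    · rw [hJ] at hl hl'
      exact hsep t t' h l hl l' hl'
    · refine ((hsq m n y lam f hm hlam hy hym hf (Finset.univ.erase v) (J t) v (J t v) L₀ ?_
        (by simp) (fun j hj hjv => absurd (Finset.mem_erase.2 ⟨hjv, Finset.mem_univ _⟩) hj) hyL
        ?_).mono hm1 (by omega)).imp fun ω hω => hω.trans ?_
      · rw [Finset.card_erase_of_mem (Finset.mem_univ _), Finset.card_univ, Fintype.card_fin]
        omega
      · rw [hJ, hI, card_levelBlock h2q]
      · have h1 : ((d - 2 : ℕ) : ℝ) * lam ^ e₂ / y ≤ 1 := by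
          rw [div_le_one hy0]
          refine le_trans ?_ hlamy
          have h2 : ((d - 2 : ℕ) : ℝ) ≤ d := by exact_mod_cast Nat.sub_le d 2
          have h3 : lam ^ e₂ ≤ lam ^ (e₁ + e₂) := pow_le_pow_right₀ hlam1 (by omega)
          gcongr
        have h4 : (0 : ℝ) ≤ (m : ℝ) ^ (d - 2) * L₀ := by positivity
        nlinarith
  have hmain := avg_abs_tieFree_sub_le (n := n) (v := v) (I := I) (y := y) (c := c₁ + c₂)
    (e := e₁ + e₂) (lam := lam) (τ := τ) (X := X) hf
    (fun j₀ σ hjv h0 hv0 => ((hlabel m n y q lam f v j₀ I σ hm hlam hy hym hf hqm hsep hjv h0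
      hv0).mono hm1 (by omega)).imp fun ω hω => ⟨hω.1, hω.2.1, fun t t' htt β =>
        (hω.2.2 t t' htt β).trans (by
          have : lam ^ e₁ ≤ lam ^ (e₁ + e₂) := pow_le_pow_right₀ hlam1 (by omega)
          gcongr)⟩)
    hm1 hlam1 hy hτ0.le hτ1 hX hτX hq (hyL.trans (le_trans (by nlinarith) h2q)) hz hR
    (Finset.univ.erase v) (by simp)
  have hcard : ((Finset.univ.erase v).card : ℝ) ≤ d := by
    exact_mod_cast (Finset.card_erase_le).trans_eq (by simp)
  have hmain' := hmain.trans ((mul_le_mul_of_nonneg_right hcard (by positivity)).trans hE)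
  -- the mean of the tie-free product
  set Φ := tieFree n f τ v I (Finset.univ.erase v) with hΦ
  have hΨ : avg (fun ω => |tieFree n f τ v I ∅ ω|) ≤ 2 := by
    simp only [tieFree_empty]
    exact hR (labelBox v I fun _ => none) Finset.univ fun t => by simp [labelBox]
  have hΦ1 : avg (fun ω => |Φ ω - 1|) ≤ 4 := by
    have h1 : ∀ ω, |Φ ω - 1| ≤ |tieFree n f τ v I ∅ ω - Φ ω| + (|tieFree n f τ v I ∅ ω| + 1) := by
      intro ω
      have e : Φ ω - 1 = -(tieFree n f τ v I ∅ ω - Φ ω) + (tieFree n f τ v I ∅ ω - 1) := by ring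
      have h2 := abs_add_le (-(tieFree n f τ v I ∅ ω - Φ ω)) (tieFree n f τ v I ∅ ω - 1)
      rw [← e, abs_neg] at h2
      have h3 : |tieFree n f τ v I ∅ ω - 1| ≤ |tieFree n f τ v I ∅ ω| + 1 := by
        simpa using abs_sub_le (tieFree n f τ v I ∅ ω) 0 1
      linarith
    refine (avg_mono h1).trans ?_
    rw [avg_add, avg_add, avg_const]
    linarith
  have hB0 : 0 ≤ B := (abs_nonneg _).trans (hB fun _ _ => false)
  have hupper : avg (fun ω => digDisc A u ω * (Φ ω - 1)) ≤ 4 * B := by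
    calc _ ≤ avg (fun ω => B * |Φ ω - 1|) := avg_mono fun ω => (le_abs_self _).trans (by
          rw [abs_mul]; exact mul_le_mul_of_nonneg_right (hB ω) (abs_nonneg _))
      _ = B * avg (fun ω => |Φ ω - 1|) := avg_const_mul _ _
      _ ≤ B * 4 := mul_le_mul_of_nonneg_left hΦ1 hB0
      _ = 4 * B := mul_comm _ _
  have hlower := le_avg_mul_tieFree_sub_one (n := n) (v := v) (I := I) (D := digDisc A u)
    (c₀ := ((4 : ℝ)⁻¹) ^ d / 8) (ε := ((2 : ℝ)⁻¹) ^ L₀) (gap := L₀) hf hτ0.le hτ1 hL0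
    (by positivity) hsepgap (fun r hr => le_avg_haar hA1 hA2 u r hr) (fun r g hg hg1 hr => by
      refine (abs_avg_digDisc_mul_le A u hg hg1).trans ?_
      have h1 : ((2 : ℝ)⁻¹) ^ ∑ j, (r j : ℕ) ≤ ((2 : ℝ)⁻¹) ^ (n + L₀) :=
        pow_le_pow_of_le_one (by norm_num) (by norm_num) hr
      have h2 : (2 : ℝ) * A.card ≤ 2 ^ n := by exact_mod_cast hA1
      calc (2 : ℝ) * A.card * ((2 : ℝ)⁻¹) ^ ∑ j, (r j : ℕ)
          ≤ 2 ^ n * ((2 : ℝ)⁻¹) ^ (n + L₀) := by gcongr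
        _ = ((2 : ℝ)⁻¹) ^ L₀ := by
          rw [pow_add, ← mul_assoc, ← mul_pow]; norm_num)
  have hlev : ∀ t, (L₀ : ℝ) * (K : ℝ) ^ (d - 2)
      ≤ (levels n (labelBox v I (fun _ => none) t)).card := by
    intro t
    subst hmn
    have hJv : labelBox v I (fun _ => none) t v = levelBlock (n + 1) L₀ t := by
      simp [labelBox, hI]
    have h1 := le_card_levels (n := n) (K := K) hvw (J := labelBox v I (fun _ => none) t)
      (fun j hj => by simp [labelBox, hj, slot]) hKn (fun l hl => by
        rw [hJv] at hl
        have h2 := (Finset.mem_filter.1 hl).2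
        have h3 := block_end_le (L₀ := L₀) t
        omega)
    rw [hJv, card_levelBlock h2q] at h1
    exact_mod_cast h1
  have hsum : (q : ℝ) * (L₀ * (K : ℝ) ^ (d - 2))
      ≤ ∑ t, ((levels n (labelBox v I (fun _ => none) t)).card : ℝ) := by
    have := Finset.card_nsmul_le_sum (Finset.univ : Finset (Fin q)) _ _ fun t _ => hlev t
    rwa [Finset.card_univ, Fintype.card_fin, nsmul_eq_mul] at this
  have hfin := mul_le_mul_of_nonneg_left hsum (by positivity : 0 ≤ τ * (((4 : ℝ)⁻¹) ^ d / 8))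
  linarith

/-- A single Haar function already shows that the discrepancy is bounded below. -/
lemma const_le_of_abs_digDisc_le (hd : 1 ≤ d) {A : Finset (Fin d → ℝ)} {B : ℝ}
    (h1 : 2 * A.card ≤ 2 ^ n) (h2 : 2 ^ n ≤ 4 * A.card) (u : Fin d → ℝ)
    (hB : ∀ ω : Dig d (n + 1), |digDisc A u ω| ≤ B) : ((4 : ℝ)⁻¹) ^ d / 8 ≤ B := by
  set r : Fin d → Fin (n + 1) := update (fun _ => 0) ⟨0, hd⟩ (Fin.last n) with hr
  have hsum : ∑ j, (r j : ℕ) = n := by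
    rw [Finset.sum_eq_single (⟨0, hd⟩ : Fin d)]
    · simp [hr]
    · intro j _ hj; simp [hr, hj]
    · simp
  refine (le_avg_haar h1 h2 u r hsum).trans ?_
  rw [← avg_const (d := d) (m := n + 1) B]
  refine avg_mono fun ω => (le_abs_self _).trans ?_
  rw [abs_mul, (isHaarFamily_signedHaar (digDisc A u)).abs_eq, mul_one]
  exact hB ω

end Core

/-! ### Choice of the parameters -/

section Parameters

lemma exp_pow_mul_exp_le {a k w : ℝ} (hw : 1 ≤ w) (ha : 0 ≤ a) (hk : 2 * (a * k + 1) ≤ w)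
    {t : ℕ} (ht : (t : ℝ) ≤ k * w ^ 3) :
    Real.exp (a * w) ^ t * Real.exp (-(w ^ 3) ^ 2 / 2) ≤ Real.exp (-w) := by
  rw [← Real.exp_nat_mul, ← Real.exp_add]
  refine Real.exp_le_exp.2 ?_
  have h1 : (t : ℝ) * (a * w) ≤ k * w ^ 3 * (a * w) :=
    mul_le_mul_of_nonneg_right ht (by positivity)
  have h2 : 2 * (a * k + 1) * w ^ 4 ≤ w ^ 6 := by
    have h3 : w ≤ w ^ 2 := by nlinarith
    calc 2 * (a * k + 1) * w ^ 4 ≤ w ^ 2 * w ^ 4 := by gcongr; linarith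
      _ = w ^ 6 := by ring
  have h4 : w ≤ w ^ 4 := le_self_pow₀ hw (by norm_num)
  nlinarith

lemma natCast_le_exp {m A w : ℕ} (hm : m ≤ (2 * w) ^ A) :
    (1 : ℝ) + m ≤ Real.exp ((2 * A + 1) * w + 1) := by
  have h1 : (m : ℝ) ≤ Real.exp (2 * A * w) := by
    calc (m : ℝ) ≤ (2 * w) ^ A := by exact_mod_cast hm
      _ ≤ Real.exp (2 * w) ^ A := by
          refine pow_le_pow_left₀ (by positivity) ?_ _
          linarith [Real.add_one_le_exp (2 * (w : ℝ))]
      _ = Real.exp (2 * A * w) := by rw [← Real.exp_nat_mul]; ring_nf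
  have h2 : (1 : ℝ) ≤ Real.exp (2 * A * w) := Real.one_le_exp (by positivity)
  have h3 : (2 : ℝ) ≤ Real.exp 1 := by linarith [Real.add_one_le_exp (1 : ℝ)]
  calc (1 : ℝ) + m ≤ 2 * Real.exp (2 * A * w) := by linarith
    _ ≤ Real.exp 1 * Real.exp (2 * A * w) := by gcongr
    _ = Real.exp (2 * A * w + 1) := by rw [← Real.exp_add]; ring_nf
    _ ≤ _ := Real.exp_le_exp.2 (by nlinarith [Nat.cast_nonneg (α := ℝ) w])

set_option maxHeartbeats 1000000 in
/-- The quantities that are at most exponential in `w ^ 4`, against the Gaussian tail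
`exp (-w ^ 6 / 2)`. -/
lemma exists_tail_bounds (d c A : ℕ) : ∃ w₀ : ℕ, ∀ w m : ℕ, w₀ ≤ w → m ≤ (2 * w) ^ A →
    1 ≤ m → w ^ 3 ≤ m →
    (((w ^ 3 : ℕ) : ℝ) * ((1 + (m : ℝ) ^ d) ^ (2 * w ^ 3) *
      ((m : ℝ) ^ c * (2 * Real.exp (-((w : ℝ) ^ 3) ^ 2 / 2)))) ≤ 1) ∧
    (((w ^ 3 : ℕ) : ℝ) * ((m : ℝ) ^ c * (2 * Real.exp (-((w : ℝ) ^ 3) ^ 2 / 2))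
      + 2 * Real.exp (-1 / (4 * ((w : ℝ)⁻¹) ^ 2))) *
      (2 * Real.exp (2 * ((w : ℝ)⁻¹) ^ 2 * ((w ^ 3 : ℕ) : ℝ))) ≤ 1 / 4) ∧
    (d * ((1 + (m : ℝ) * 2 ^ (w ^ 3)) ^ d * (m * 2 ^ (w ^ 3) * (1 + (m : ℝ) ^ d) ^ (w ^ 3) *
      ((m : ℝ) ^ c * (2 * Real.exp (-((w : ℝ) ^ 3) ^ 2 / 2))))) ≤ 1 / 2) ∧
    ∀ L₀ : ℕ, w ^ 5 ≤ L₀ → (1 + (m : ℝ) ^ d) ^ (w ^ 3) * ((2 : ℝ)⁻¹) ^ L₀ ≤ 1 := by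
  set a : ℕ := 2 * A + 2 with ha
  set k : ℕ := 3 * d + c + 6 with hk
  refine ⟨2 * (a * k + 1) + 64 + 2 * d, ?_⟩
  intro w m hw hm hm1 hqm
  have hw64 : 64 ≤ w := by omega
  have hwd : 2 * d ≤ w := by omega
  have hwak : 2 * (a * k + 1) ≤ w := by omega
  have hw1 : (1 : ℝ) ≤ w := by exact_mod_cast (by omega : 1 ≤ w)
  have hwpos : (0 : ℝ) < w := by linarith
  have hw3 : 1 ≤ w ^ 3 := Nat.one_le_pow _ _ (by omega)
  set q : ℕ := w ^ 3 with hq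
  have hq3 : (q : ℝ) = (w : ℝ) ^ 3 := by rw [hq]; push_cast; rfl
  set E : ℝ := Real.exp (a * w) with hE
  have hE1 : 1 ≤ E := Real.one_le_exp (by positivity)
  have hE0 : 0 < E := Real.exp_pos _
  have hmE : 1 + (m : ℝ) ≤ E := (natCast_le_exp hm).trans (Real.exp_le_exp.2 (by
    rw [ha]; push_cast; linarith))
  have hm0 : (1 : ℝ) ≤ m := by exact_mod_cast hm1
  have hm' : (m : ℝ) ≤ E := by linarith
  have h2E : (2 : ℝ) ≤ E := by linarith
  have hqE : (q : ℝ) ≤ E := by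
    have : (q : ℝ) ≤ m := by exact_mod_cast hqm
    linarith
  have hmd : 1 + (m : ℝ) ^ d ≤ E ^ (d + 1) := by
    have : (m : ℝ) ^ d ≤ E ^ d := pow_le_pow_left₀ (by linarith) hm' _
    have h1 : (1 : ℝ) ≤ E ^ d := one_le_pow₀ hE1
    rw [pow_succ]
    nlinarith
  have hT : ∀ t : ℕ, (t : ℝ) ≤ k * (w : ℝ) ^ 3 →
      E ^ t * Real.exp (-((w : ℝ) ^ 3) ^ 2 / 2) ≤ Real.exp (-w) := fun t ht =>
    exp_pow_mul_exp_le hw1 (by positivity) (by exact_mod_cast hwak) ht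
  have hsmall : Real.exp (-(w : ℝ)) ≤ 1 / w := by
    rw [Real.exp_neg, ← one_div]
    exact one_div_le_one_div_of_le hwpos (by linarith [Real.add_one_le_exp (w : ℝ)])
  have hsmall64 : Real.exp (-(w : ℝ)) ≤ 1 / 64 := hsmall.trans
    (one_div_le_one_div_of_le (by norm_num) (by exact_mod_cast hw64))
  have hkq : ∀ i j : ℕ, i + j ≤ k → ((i * q + j : ℕ) : ℝ) ≤ k * (w : ℝ) ^ 3 := by
    intro i j hij
    rw [← hq3]
    have : i * q + j ≤ k * q := by nlinarith
    exact_mod_cast this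
  set G := Real.exp (-((w : ℝ) ^ 3) ^ 2 / 2) with hG
  have hG0 : 0 < G := Real.exp_pos _
  refine ⟨?_, ?_, ?_, ?_⟩
  · have h1 : (1 + (m : ℝ) ^ d) ^ (2 * q) ≤ (E ^ (d + 1)) ^ (2 * q) :=
      pow_le_pow_left₀ (by positivity) hmd _
    have h2 : (m : ℝ) ^ c ≤ E ^ c := pow_le_pow_left₀ (by linarith) hm' _
    calc (q : ℝ) * ((1 + (m : ℝ) ^ d) ^ (2 * q) * ((m : ℝ) ^ c * (2 * G)))
        ≤ E * ((E ^ (d + 1)) ^ (2 * q) * (E ^ c * (E * G))) := by gcongr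
      _ = E ^ ((2 * d + 2) * q + (c + 2)) * G := by
          rw [← pow_mul]; ring
      _ ≤ Real.exp (-w) := hT _ (hkq _ _ (by omega))
      _ ≤ 1 := by linarith
  · have h2 : (m : ℝ) ^ c ≤ E ^ c := pow_le_pow_left₀ (by linarith) hm' _
    have e1 : 2 * ((w : ℝ)⁻¹) ^ 2 * (q : ℝ) = 2 * w := by
      rw [hq3]; field_simp
    have e2 : -1 / (4 * ((w : ℝ)⁻¹) ^ 2) = -(w : ℝ) ^ 2 / 4 := by
      field_simp
    have h3 : Real.exp (2 * (w : ℝ)) ≤ E := Real.exp_le_exp.2 (by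
      rw [ha]; push_cast; nlinarith [Nat.cast_nonneg (α := ℝ) A])
    rw [e1, e2]
    have p1 : (q : ℝ) * ((m : ℝ) ^ c * (2 * G)) * (2 * Real.exp (2 * (w : ℝ))) ≤ 1 / 64 := by
      calc (q : ℝ) * ((m : ℝ) ^ c * (2 * G)) * (2 * Real.exp (2 * (w : ℝ)))
          ≤ E * (E ^ c * (E * G)) * (E * E) := by gcongr
        _ = E ^ (0 * q + (c + 4)) * G := by ring
        _ ≤ Real.exp (-w) := hT _ (hkq _ _ (by omega))
        _ ≤ _ := hsmall64
    have p2 : (q : ℝ) * (2 * Real.exp (-(w : ℝ) ^ 2 / 4)) * (2 * Real.exp (2 * (w : ℝ)))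
        ≤ 4 / 64 := by
      have h4 : (q : ℝ) ≤ Real.exp (w : ℝ) ^ 3 := by
        rw [hq3]
        exact pow_le_pow_left₀ hwpos.le (by linarith [Real.add_one_le_exp (w : ℝ)]) _
      have hw64' : (64 : ℝ) ≤ w := by exact_mod_cast hw64
      calc (q : ℝ) * (2 * Real.exp (-(w : ℝ) ^ 2 / 4)) * (2 * Real.exp (2 * (w : ℝ)))
          ≤ Real.exp (w : ℝ) ^ 3 * (2 * Real.exp (-(w : ℝ) ^ 2 / 4)) *
            (2 * Real.exp (2 * (w : ℝ))) := by gcongr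
        _ = 4 * Real.exp (5 * w - w ^ 2 / 4) := by
            rw [← Real.exp_nat_mul]
            have : (5 * w - w ^ 2 / 4 : ℝ) = ((3 : ℕ) : ℝ) * w + (-(w : ℝ) ^ 2 / 4) + 2 * w := by
              push_cast; ring
            rw [this, Real.exp_add, Real.exp_add]; ring
        _ ≤ 4 * Real.exp (-w) := by
            gcongr
            nlinarith
        _ ≤ 4 / 64 := by linarith
    rw [mul_add, add_mul]
    linarith
  · have h1 : (1 + (m : ℝ) ^ d) ^ q ≤ (E ^ (d + 1)) ^ q :=
      pow_le_pow_left₀ (by positivity) hmd _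
    have h2 : (m : ℝ) ^ c ≤ E ^ c := pow_le_pow_left₀ (by linarith) hm' _
    have h3 : (2 : ℝ) ^ q ≤ E ^ q := pow_le_pow_left₀ (by norm_num) h2E _
    have h4 : (1 : ℝ) ≤ 2 ^ q := one_le_pow₀ (by norm_num)
    have h5 : 1 + (m : ℝ) * 2 ^ q ≤ E * E ^ q := by
      calc 1 + (m : ℝ) * 2 ^ q ≤ (1 + m) * 2 ^ q := by nlinarith
        _ ≤ E * E ^ q := by gcongr
    have h6 : (1 + (m : ℝ) * 2 ^ q) ^ d ≤ (E * E ^ q) ^ d := pow_le_pow_left₀ (by positivity) h5 _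
    have hw0 : (d : ℝ) * (1 / w) ≤ 1 / 2 := by
      rw [mul_one_div, div_le_div_iff₀ hwpos (by norm_num)]
      have : (2 * d : ℝ) ≤ w := by exact_mod_cast hwd
      linarith
    refine le_trans (mul_le_mul_of_nonneg_left ?_ (Nat.cast_nonneg d)) hw0
    calc (1 + (m : ℝ) * 2 ^ q) ^ d * (m * 2 ^ q * (1 + (m : ℝ) ^ d) ^ q * ((m : ℝ) ^ c * (2 * G)))
        ≤ (E * E ^ q) ^ d * (E * E ^ q * (E ^ (d + 1)) ^ q * (E ^ c * (E * G))) := by gcongr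
      _ = E ^ ((2 * d + 2) * q + (d + c + 2)) * G := by
          rw [mul_pow, ← pow_mul, ← pow_mul]; ring
      _ ≤ Real.exp (-w) := hT _ (hkq _ _ (by omega))
      _ ≤ _ := hsmall
  · intro L₀ hL₀
    have h1 : (1 + (m : ℝ) ^ d) ^ q ≤ (E ^ (d + 1)) ^ q :=
      pow_le_pow_left₀ (by positivity) hmd _
    have h2 : (2 : ℝ)⁻¹ ≤ Real.exp (-(1 / 2)) := by
      linarith [Real.add_one_le_exp (-(1 / 2) : ℝ)]
    have h3 : ((2 : ℝ)⁻¹) ^ L₀ ≤ Real.exp (-(1 / 2)) ^ L₀ := pow_le_pow_left₀ (by norm_num) h2 _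
    have h4 : 2 * (a * (d + 1)) * w ^ 4 ≤ L₀ := by
      refine le_trans ?_ hL₀
      have : 2 * (a * (d + 1)) ≤ w := le_trans (by nlinarith [Nat.zero_le (a * c)]) hwak
      calc 2 * (a * (d + 1)) * w ^ 4 ≤ w * w ^ 4 := Nat.mul_le_mul_right _ this
        _ = w ^ 5 := by ring
    have h4' : 2 * ((a : ℝ) * (d + 1)) * (w : ℝ) ^ 4 ≤ L₀ := by exact_mod_cast h4
    calc (1 + (m : ℝ) ^ d) ^ q * ((2 : ℝ)⁻¹) ^ L₀
        ≤ (E ^ (d + 1)) ^ q * Real.exp (-(1 / 2)) ^ L₀ := by gcongr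
      _ = Real.exp (((d + 1) * q : ℕ) * (a * w) + L₀ * (-(1 / 2))) := by
          rw [← pow_mul, hE, ← Real.exp_nat_mul, ← Real.exp_nat_mul, ← Real.exp_add]
      _ ≤ Real.exp 0 := Real.exp_le_exp.2 (by push_cast; rw [hq3]; nlinarith)
      _ = 1 := Real.exp_zero

end Parameters

section Growth

set_option maxHeartbeats 1000000 in
/-- The bound from the duality argument with `w ^ 3` factors, where `w` is a small power of the
number `n + 1` of binary digits. -/
theorem exists_growth_bound (d : ℕ) (hd : 3 ≤ d) :
    ∃ (N w₀ : ℕ) (c₁ : ℝ), 1 ≤ N ∧ 0 < c₁ ∧ ∀ (n w : ℕ) (A : Finset (Fin d → ℝ)) (u : Fin d → ℝ)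
      (B : ℝ), w₀ ≤ w → w ^ N ≤ n + 1 → n + 1 ≤ (2 * w) ^ N → 2 * A.card ≤ 2 ^ n →
      2 ^ n ≤ 4 * A.card → (∀ ω : Dig d (n + 1), |digDisc A u ω| ≤ B) →
      c₁ * (√w * √(n + 1 : ℕ) ^ (d - 1)) - 1 ≤ 4 * B := by
  obtain ⟨c, e, hcore⟩ := exists_core_bound d hd
  -- `w ^ b` is the gain from coincidences of levels. It has to absorb a polynomial in `w` coming from
  -- the number of factors, the logarithmic losses `lam` and the bound `X` for a single factor.
  set b : ℕ := (6 * d + 8) * d + (9 * d + 12 + 3 * e) + 1 with hb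
  set N : ℕ := b * 2 ^ (d + 3) with hN
  obtain ⟨w₁, htail⟩ := exists_tail_bounds d c N
  refine ⟨N, w₁ + 2 * d * (49 ^ d * 1216) + 64, ((4 : ℝ)⁻¹) ^ d / 8 / 4 / (4 * d) ^ (d - 2),
    Nat.mul_pos (by omega) (by positivity), by positivity, ?_⟩
  intro n w A u B hw hwm hmw hA1 hA2 hB
  have hw64 : 64 ≤ w := by omega
  have hww : 2 * d * (49 ^ d * 1216) ≤ w := by omega
  have hw1 : w₁ ≤ w := by omega
  have hwpos : 0 < w := by omega
  obtain ⟨m, hm⟩ : ∃ m, m = n + 1 := ⟨_, rfl⟩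
  rw [← hm] at hwm hmw ⊢
  -- The `q` blocks of length `L₀` and the gaps between them occupy at most a quarter of the levels of one
  -- coordinate; `K` bounds the levels of the remaining ones. The exponent `N` is such that the block
  -- length `L` for the coincidences satisfies `L ^ 4 = w ^ N ≤ m`.
  set q := w ^ 3 with hq
  set y := w ^ b with hy
  set L := y ^ 2 ^ (d + 1) with hL
  set L₀ := m / (8 * q) with hL₀
  set K := n / (2 * d) with hK
  have hbig : 9 * d + 13 ≤ b := by
    have := Nat.zero_le ((6 * d + 8) * d)
    omega
  have hL4 : L ^ 4 ≤ m := by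
    refine le_trans (le_of_eq ?_) hwm
    rw [hL, hy, hN, ← pow_mul, ← pow_mul]
    congr 2
    rw [pow_add 2 d 3, pow_add 2 d 1]; ring
  have hy1 : 1 ≤ y := Nat.one_le_pow _ _ hwpos
  have hyL : y ≤ L := Nat.le_self_pow (by positivity) y
  have hwy : w ^ 5 ≤ y := Nat.pow_le_pow_right hwpos (by omega)
  have hL1 : 1 ≤ L := hy1.trans hyL
  have hLL : L * L ≤ m := by
    refine le_trans ?_ hL4
    rw [← sq]
    exact Nat.pow_le_pow_right hL1 (by norm_num)
  have h8q : 8 * q ≤ L := by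
    refine le_trans ?_ (hwy.trans hyL)
    calc 8 * w ^ 3 ≤ w ^ 2 * w ^ 3 := Nat.mul_le_mul_right _ (by nlinarith)
      _ = w ^ 5 := by ring
  have hq1 : 1 ≤ q := Nat.one_le_pow _ _ hwpos
  have hLm : L ≤ m := le_trans (Nat.le_mul_of_pos_left _ hL1) hLL
  have hqm : q ≤ m := by omega
  have hLL₀ : L ≤ L₀ := by
    rw [hL₀, Nat.le_div_iff_mul_le (by omega)]
    exact (Nat.mul_le_mul_left _ h8q).trans hLL
  have hL₀1 : 1 ≤ L₀ := hL1.trans hLL₀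
  have h8 : 8 * q * L₀ ≤ m := Nat.mul_div_le _ _
  have h16 : m ≤ 16 * q * L₀ := by
    have h1 : m < 8 * q * (L₀ + 1) := by
      have := Nat.lt_mul_div_succ m (show 0 < 8 * q by omega)
      exact this
    have h2 : 8 * q ≤ 8 * q * L₀ := Nat.le_mul_of_pos_right _ hL₀1
    nlinarith
  have hm2 : 8 * d ≤ m := by
    have h1 : 1 ≤ 49 ^ d := Nat.one_le_pow _ _ (by norm_num)
    have h2 : d * 1 ≤ d * 49 ^ d := Nat.mul_le_mul_left _ h1
    have h3 : 2 * d * (49 ^ d * 1216) = 2432 * (d * 49 ^ d) := by ring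
    have h4 : w ≤ w ^ 5 := Nat.le_self_pow (by norm_num) w
    omega
  have hKn : 2 * d * K ≤ n := Nat.mul_div_le _ _
  have h4K : m ≤ 4 * d * K := by
    have h1 : n < 2 * d * (K + 1) := by
      have := Nat.lt_mul_div_succ n (show 0 < 2 * d by omega)
      exact this
    have h2 : 1 ≤ K := by
      rw [hK, Nat.le_div_iff_mul_le (by omega)]
      omega
    have h3 : 2 * d ≤ 2 * d * K := Nat.le_mul_of_pos_right _ h2
    nlinarith
  have hfit : 2 * q * L₀ + (d - 2) * K ≤ n := by
    have h1 : (d - 2) * K ≤ d * K := Nat.mul_le_mul_right _ (Nat.sub_le _ _)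
    have h2 : 2 * d * K = 2 * (d * K) := by ring
    have h3 : 8 * q * L₀ = 4 * (2 * q * L₀) := by ring
    omega
  have hKn' : K ≤ n + 1 := (Nat.div_le_self _ _).trans (Nat.le_succ n)
  obtain ⟨hnum1, hnum2, hnum3, hnum4⟩ := htail w m hw1 hmw (by omega) hqm
  -- The square function of a factor is of order `κ ^ 2` with `κ = 1 / w`, so that the second moment of
  -- the Riesz product is only of order `exp (2 * κ ^ 2 * q) = exp (2 * w)`, while a factor is negative
  -- with probability about `exp (- w ^ 2 / 4)`. With `lam = w ^ 3` the Gaussian tails beat all trivial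
  -- bounds, which are exponential in `w ^ 4`.
  set W : ℝ := (w : ℝ) with hW
  have hW64 : (64 : ℝ) ≤ W := by rw [hW]; exact_mod_cast hw64
  have hW1 : (1 : ℝ) ≤ W := by linarith
  have hW0 : (0 : ℝ) < W := by linarith
  have hqW : (q : ℝ) = W ^ 3 := by rw [hq]; push_cast; rfl
  have hyW : (y : ℝ) = W ^ b := by rw [hy]; push_cast; rfl
  have hLc : (y : ℝ) ^ 2 ^ (d + 1) = L := by rw [hL]; push_cast; rfl
  have hy0 : (0 : ℝ) < y := by exact_mod_cast hy1
  have hL0' : (0 : ℝ) < L := by exact_mod_cast hL1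
  have hm0 : (0 : ℝ) < m := by exact_mod_cast (by omega : 0 < m)
  set s := √(m : ℝ) with hs
  have hs0 : 0 < s := Real.sqrt_pos.2 hm0
  have hs2 : s ^ 2 = m := Real.sq_sqrt hm0.le
  have hL₀0 : (0 : ℝ) < L₀ := by exact_mod_cast hL₀1
  set z := √(L₀ : ℝ) with hz
  have hz0 : 0 < z := Real.sqrt_pos.2 hL₀0
  have hz2 : z ^ 2 = L₀ := Real.sq_sqrt hL₀0.le
  have hz1 : 1 ≤ z := Real.one_le_sqrt.2 (by exact_mod_cast hL₀1)
  have hs1 : 1 ≤ s := Real.one_le_sqrt.2 (by exact_mod_cast (by omega : 1 ≤ m))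
  have h16r : (m : ℝ) ≤ 16 * W ^ 3 * L₀ := by rw [← hqW]; exact_mod_cast h16
  have hsz : s ≤ 4 * W ^ 2 * z := by
    refine Real.sqrt_le_iff.2 ⟨by positivity, ?_⟩
    rw [mul_pow, mul_pow, hz2]
    refine h16r.trans (mul_le_mul_of_nonneg_right ?_ hL₀0.le)
    have : W ^ 3 ≤ (W ^ 2) ^ 2 := by
      rw [← pow_mul]; exact pow_le_pow_right₀ hW1 (by norm_num)
    linarith
  have hyLs : (L : ℝ) / s ≤ 1 / y := by
    rw [div_le_div_iff₀ hs0 hy0, one_mul]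
    refine le_trans (b := (L : ℝ) * L) ?_ ?_
    · exact mul_le_mul_of_nonneg_left (by exact_mod_cast hyL) hL0'.le
    · refine Real.le_sqrt_of_sq_le ?_
      have : ((L : ℝ) * L) ^ 2 = ((L ^ 4 : ℕ) : ℝ) := by push_cast; ring
      rw [this]; exact_mod_cast hL4
  set τ : ℝ := W⁻¹ / (z * s ^ (d - 2)) with hτ
  have hτ0 : 0 < τ := by positivity
  set X : ℝ := 4 * W ^ (3 * d + 1) with hX
  have hds : s ^ (d - 1) = s * s ^ (d - 2) := by
    rw [← pow_succ']; congr 1; omega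
  have hτX : τ * (W ^ 3) ^ d * s ^ (d - 1) ≤ X := by
    have h1 : τ * (W ^ 3) ^ d * s ^ (d - 1) = W⁻¹ * W ^ (3 * d) * (s / z) := by
      rw [hτ, hds, ← pow_mul]; field_simp
    have h2 : s / z ≤ 4 * W ^ 2 := by rw [div_le_iff₀ hz0]; exact hsz
    rw [h1]
    calc W⁻¹ * W ^ (3 * d) * (s / z) ≤ W⁻¹ * W ^ (3 * d) * (4 * W ^ 2) := by gcongr
      _ = X := by rw [hX, pow_succ]; field_simp; ring
  have hX1 : 1 ≤ X := by
    have : (1 : ℝ) ≤ W ^ (3 * d + 1) := one_le_pow₀ hW1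
    rw [hX]; linarith
  have hzz : (q : ℝ) * ((y : ℝ) ^ 2 ^ (d + 1) * (X / s)) ≤ 1 := by
    rw [hLc]
    calc (q : ℝ) * (L * (X / s)) = q * X * (L / s) := by ring
      _ ≤ q * X * (1 / y) := by gcongr
      _ = 4 * W ^ (3 * d + 4) / y := by rw [hqW, hX]; ring
      _ ≤ 1 := by
        rw [div_le_one hy0, hyW]
        calc 4 * W ^ (3 * d + 4) ≤ W * W ^ (3 * d + 4) := by gcongr; linarith
          _ = W ^ (3 * d + 5) := by ring
          _ ≤ W ^ b := pow_le_pow_right₀ hW1 (by omega)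
  have hmainE : d * ((1 + 3 * X ^ 2 * q ^ 2) ^ d *
      (18 * X ^ 3 * q ^ 3 * (y : ℝ) ^ 2 ^ (d + 1) / s + 4 * q ^ 2 * (W ^ 3) ^ e * X ^ 2 / y))
      ≤ 1 / 2 := by
    rw [hLc]
    have h1 : 1 + 3 * X ^ 2 * (q : ℝ) ^ 2 ≤ 49 * W ^ (6 * d + 8) := by
      have e1 : 3 * X ^ 2 * (q : ℝ) ^ 2 = 48 * W ^ (6 * d + 8) := by rw [hqW, hX]; ring
      have e2 : (1 : ℝ) ≤ W ^ (6 * d + 8) := one_le_pow₀ hW1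
      rw [e1]; linarith
    have h2 : 18 * X ^ 3 * (q : ℝ) ^ 3 * L / s ≤ 1152 * W ^ (9 * d + 12 + 3 * e) / y := by
      calc 18 * X ^ 3 * (q : ℝ) ^ 3 * L / s = 18 * X ^ 3 * (q : ℝ) ^ 3 * (L / s) := by ring
        _ ≤ 18 * X ^ 3 * (q : ℝ) ^ 3 * (1 / y) := by gcongr
        _ = 1152 * W ^ (9 * d + 12) / y := by rw [hqW, hX]; ring
        _ ≤ _ := by
          have e1 : W ^ (9 * d + 12) ≤ W ^ (9 * d + 12 + 3 * e) :=
            pow_le_pow_right₀ hW1 (Nat.le_add_right _ _)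
          gcongr
    have h3 : 4 * (q : ℝ) ^ 2 * (W ^ 3) ^ e * X ^ 2 / y
        ≤ 64 * W ^ (9 * d + 12 + 3 * e) / y := by
      calc 4 * (q : ℝ) ^ 2 * (W ^ 3) ^ e * X ^ 2 / y = 64 * W ^ (6 * d + 8 + 3 * e) / y := by
            rw [hqW, hX, ← pow_mul]; ring
        _ ≤ _ := by
          have e1 : W ^ (6 * d + 8 + 3 * e) ≤ W ^ (9 * d + 12 + 3 * e) :=
            pow_le_pow_right₀ hW1 (by omega)
          gcongr
    have h4 : (1 + 3 * X ^ 2 * (q : ℝ) ^ 2) ^ d ≤ (49 * W ^ (6 * d + 8)) ^ d :=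
      pow_le_pow_left₀ (by positivity) h1 _
    have h5 : 18 * X ^ 3 * (q : ℝ) ^ 3 * L / s + 4 * (q : ℝ) ^ 2 * (W ^ 3) ^ e * X ^ 2 / y
        ≤ 1216 * W ^ (9 * d + 12 + 3 * e) / y := by
      refine (add_le_add h2 h3).trans_eq ?_
      rw [← add_div]; ring
    calc (d : ℝ) * ((1 + 3 * X ^ 2 * q ^ 2) ^ d * (18 * X ^ 3 * (q : ℝ) ^ 3 * L / s
          + 4 * (q : ℝ) ^ 2 * (W ^ 3) ^ e * X ^ 2 / y))
        ≤ d * ((49 * W ^ (6 * d + 8)) ^ d * (1216 * W ^ (9 * d + 12 + 3 * e) / y)) := by gcongr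
      _ = d * (49 ^ d * 1216) / W := by
          have e1 : W ^ b = (W ^ (6 * d + 8)) ^ d * W ^ (9 * d + 12 + 3 * e) * W := by
            rw [hb, pow_succ, pow_add, pow_mul]
          rw [hyW, e1, mul_pow]
          field_simp
      _ ≤ 1 / 2 := by
          rw [div_le_div_iff₀ hW0 (by norm_num)]
          have : (2 * d * (49 ^ d * 1216) : ℝ) ≤ W := by rw [hW]; exact_mod_cast hww
          linarith
  have hRsq : (z * s ^ (d - 2)) ^ 2 = L₀ * (m : ℝ) ^ (d - 2) := by
    rw [mul_pow, hz2, ← pow_mul, mul_comm (d - 2), pow_mul, hs2]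
  have hfin := hcore n m q y L₀ K (W ^ 3) W⁻¹ τ X B A u hm hA1 hA2 (by subst hm; exact hB)
    (by omega) (by
      calc (2 : ℝ) ≤ W := by linarith
        _ ≤ W ^ 3 := le_self_pow₀ hW1 (by norm_num)) hy1 hL4 hq1 hqm hLL₀ hfit hKn'
    (by rw [← hRsq, hτ, div_pow]; field_simp) hτ0
    (by
      rw [hτ, div_le_one (by positivity)]
      refine (inv_le_one_of_one_le₀ hW1).trans ?_
      exact one_le_mul_of_one_le_of_one_le hz1 (one_le_pow₀ hs1)) (by positivity)
    (by
      rw [hyW, ← pow_mul]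
      have h1 : (d : ℝ) ≤ W := by
        have h2 : d ≤ w := by
          refine le_trans ?_ hww
          have h1 : 1 ≤ 49 ^ d := Nat.one_le_pow _ _ (by norm_num)
          nlinarith
        rw [hW]; exact_mod_cast h2
      calc (d : ℝ) * W ^ (3 * e) ≤ W * W ^ (3 * e) := by gcongr
        _ = W ^ (3 * e + 1) := by ring
        _ ≤ W ^ b := pow_le_pow_right₀ hW1 (by
          have := Nat.zero_le ((6 * d + 8) * d)
          omega))
    hnum1 hnum2 hX1 hτX hzz
    (by rw [mul_add]; linarith) (hnum4 L₀ (hwy.trans (hyL.trans hLL₀)))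
  refine le_trans (sub_le_sub_right ?_ 1) hfin
  -- the size of the linear part
  have hKs : s ^ 2 / (4 * d) ≤ K := by
    rw [hs2, div_le_iff₀ (by positivity)]
    have : (m : ℝ) ≤ 4 * d * K := by exact_mod_cast h4K
    linarith
  have hsq : √W * s ≤ 4 * W ^ 2 * z := by
    rw [← Real.sqrt_mul hW0.le]
    refine Real.sqrt_le_iff.2 ⟨by positivity, ?_⟩
    rw [mul_pow, mul_pow, hz2]
    calc W * m ≤ W * (16 * W ^ 3 * L₀) := by gcongr
      _ = 4 ^ 2 * (W ^ 2) ^ 2 * L₀ := by ring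
  have h1 : τ * (((4 : ℝ)⁻¹) ^ d / 8) * (q * (L₀ * (s ^ 2 / (4 * d)) ^ (d - 2)))
      = ((4 : ℝ)⁻¹) ^ d / 8 / (4 * d) ^ (d - 2) * (W ^ 2 * z * s ^ (d - 2)) := by
    rw [hτ, hqW, ← hz2, div_pow, ← pow_mul, mul_comm 2, pow_mul]
    field_simp
  calc ((4 : ℝ)⁻¹) ^ d / 8 / 4 / (4 * d) ^ (d - 2) * (√W * s ^ (d - 1))
      = ((4 : ℝ)⁻¹) ^ d / 8 / (4 * d) ^ (d - 2) * (√W * s / 4 * s ^ (d - 2)) := by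
        rw [hds]; ring
    _ ≤ ((4 : ℝ)⁻¹) ^ d / 8 / (4 * d) ^ (d - 2) * (W ^ 2 * z * s ^ (d - 2)) := by
        gcongr
        linarith
    _ = τ * (((4 : ℝ)⁻¹) ^ d / 8) * (q * (L₀ * (s ^ 2 / (4 * d)) ^ (d - 2))) := h1.symm
    _ ≤ _ := by gcongr

/-- The power gained over the exponent `(d - 1) / 2`, in terms of the number of binary digits. -/
theorem exists_rpow_le (d : ℕ) (hd : 3 ≤ d) :
    ∃ η : ℝ, 0 < η ∧ ∃ c : ℝ, 0 < c ∧ ∀ (n : ℕ) (A : Finset (Fin d → ℝ)) (u : Fin d → ℝ) (B : ℝ),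
      2 * A.card ≤ 2 ^ n → 2 ^ n ≤ 4 * A.card → (∀ ω : Dig d (n + 1), |digDisc A u ω| ≤ B) →
      c * ((n + 1 : ℕ) : ℝ) ^ (((d : ℝ) - 1) / 2 + η) ≤ B := by
  obtain ⟨N, w₀, c₁, hN, hc₁, hgrow⟩ := exists_growth_bound d hd
  set c₀ : ℝ := ((4 : ℝ)⁻¹) ^ d / 8 with hc₀
  have hc₀0 : 0 < c₀ := by positivity
  have hN0 : (0 : ℝ) < N := by exact_mod_cast hN
  set η : ℝ := 1 / (2 * N) with hη
  have hη0 : 0 < η := by positivity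
  set p : ℝ := ((d : ℝ) - 1) / 2 + η with hp
  have hd3 : (3 : ℝ) ≤ d := by exact_mod_cast hd
  have hp0 : 0 < p := by rw [hp]; linarith
  set M : ℝ := ((w₀ : ℝ) + 1) ^ N with hM
  have hM0 : 0 < M := by positivity
  refine ⟨η, hη0, min (c₁ / 2 / (4 + 1 / c₀)) (c₀ / M ^ p), lt_min (by positivity)
    (by positivity), ?_⟩
  intro n A u B h1 h2 hB
  have hBc : c₀ ≤ B := const_le_of_abs_digDisc_le (by omega) h1 h2 u hB
  have hm0 : (0 : ℝ) < ((n + 1 : ℕ) : ℝ) := by positivity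
  set x : ℝ := ((n + 1 : ℕ) : ℝ) with hx
  have hx1 : 1 ≤ x := by rw [hx]; push_cast; linarith [Nat.cast_nonneg (α := ℝ) n]
  have hxp : 0 < x ^ p := Real.rpow_pos_of_pos hm0 _
  set ξ : ℝ := x ^ (1 / (N : ℝ)) with hξ
  have hξN : ξ ^ N = x := by
    rw [hξ, ← Real.rpow_natCast, ← Real.rpow_mul hm0.le, one_div_mul_cancel hN0.ne', Real.rpow_one]
  have hξ1 : 1 ≤ ξ := Real.one_le_rpow hx1 (by positivity)
  set w := ⌊ξ⌋₊ with hw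
  have hwξ : (w : ℝ) ≤ ξ := Nat.floor_le (by linarith)
  have hξw : ξ < w + 1 := Nat.lt_floor_add_one _
  have hw1 : 1 ≤ w := Nat.le_floor (by simpa using hξ1)
  have hw1r : (1 : ℝ) ≤ w := by exact_mod_cast hw1
  by_cases hww : w₀ ≤ w
  · have hg := hgrow n w A u B hww
      (by
        have : (w : ℝ) ^ N ≤ x := hξN ▸ pow_le_pow_left₀ (by positivity) hwξ _
        rw [hx] at this
        exact_mod_cast this)
      (by
        have : x ≤ (2 * (w : ℝ)) ^ N := by
          rw [← hξN]
          exact pow_le_pow_left₀ (by linarith) (by linarith) _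
        rw [hx] at this
        exact_mod_cast this) h1 h2 hB
    have e1 : √x ^ (d - 1) = x ^ (((d : ℝ) - 1) / 2) := by
      rw [Real.sqrt_eq_rpow, ← Real.rpow_natCast, ← Real.rpow_mul hm0.le]
      congr 1
      rw [Nat.cast_sub (by omega)]
      push_cast; ring
    have e2 : x ^ η / 2 ≤ √w := by
      refine Real.le_sqrt_of_sq_le ?_
      have : (x ^ η) ^ 2 = ξ := by
        rw [← Real.rpow_natCast, ← Real.rpow_mul hm0.le, hξ, hη]
        congr 1
        push_cast; field_simp
      rw [div_pow, this]
      linarith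
    have e3 : c₁ / 2 * x ^ p ≤ 4 * B + 1 := by
      have : x ^ p = x ^ (((d : ℝ) - 1) / 2) * x ^ η := by rw [hp, Real.rpow_add hm0]
      calc c₁ / 2 * x ^ p = c₁ * (x ^ η / 2 * √x ^ (d - 1)) := by rw [this, e1]; ring
        _ ≤ c₁ * (√w * √x ^ (d - 1)) := by gcongr
        _ ≤ 4 * B + 1 := by linarith
    have e4 : 4 * B + 1 ≤ (4 + 1 / c₀) * B := by
      have : 1 ≤ 1 / c₀ * B := by rw [one_div_mul_eq_div, le_div_iff₀ hc₀0]; linarith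
      linarith
    calc _ ≤ c₁ / 2 / (4 + 1 / c₀) * x ^ p := mul_le_mul_of_nonneg_right (min_le_left _ _) hxp.le
      _ = c₁ / 2 * x ^ p / (4 + 1 / c₀) := by ring
      _ ≤ B := by
        rw [div_le_iff₀ (by positivity)]
        linarith
  · have hxM : x ≤ M := by
      rw [← hξN, hM]
      refine pow_le_pow_left₀ (by linarith) ?_ _
      have : (w : ℝ) ≤ w₀ := by exact_mod_cast (not_le.1 hww).le
      linarith
    calc _ ≤ c₀ / M ^ p * x ^ p := mul_le_mul_of_nonneg_right (min_le_right _ _) hxp.le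
      _ ≤ c₀ / M ^ p * M ^ p := by
        refine mul_le_mul_of_nonneg_left ?_ (by positivity)
        exact Real.rpow_le_rpow hm0.le hxM hp0.le
      _ = c₀ := div_mul_cancel₀ _ (Real.rpow_pos_of_pos hM0 _).ne'
      _ ≤ B := hBc

end Growth

theorem mainTheorem2 (d : ℕ) (hd : 3 ≤ d) :
    ∃ η : ℝ, 0 < η ∧ ∃ c : ℝ, 0 < c ∧
      ∀ (N : ℕ), 1 ≤ N → ∀ (A : Finset (Fin d → ℝ)), A.card = N →
        (A : Set (Fin d → ℝ)) ⊆ unitCube d →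
          ENNReal.ofReal (c * Real.log (N : ℝ) ^ (((d : ℝ) - 1) / 2 + η))
            ≤ eLpNorm (discrepancyFunction A) ⊤ (volume.restrict (unitCube d)) := by
  obtain ⟨η, hη, c, hc, hmain⟩ := exists_rpow_le d hd
  refine ⟨η, hη, c, hc, fun N hN A hAN hA => ?_⟩
  by_cases htop : eLpNorm (discrepancyFunction A) ⊤ (volume.restrict (unitCube d)) = ⊤
  · rw [htop]; exact le_top
  set B := (eLpNorm (discrepancyFunction A) ⊤ (volume.restrict (unitCube d))).toReal with hB
  rw [← ENNReal.ofReal_toReal htop]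
  refine ENNReal.ofReal_le_ofReal ?_
  set n := Nat.log 2 N + 2 with hn
  have h1 : 2 * N ≤ 2 ^ n := by
    have := Nat.lt_pow_succ_log_self (b := 2) (by norm_num) N
    rw [hn, pow_succ 2 (Nat.log 2 N + 1)]
    omega
  have h2 : 2 ^ n ≤ 4 * N := by
    have := Nat.pow_log_le_self 2 (x := N) (by omega)
    rw [hn, pow_add]
    omega
  obtain ⟨u, hu⟩ := exists_shift hA (B := B) ENNReal.toReal_nonneg
    (ENNReal.ofReal_toReal htop).ge (n + 1)
  rw [← hAN] at h1 h2
  refine le_trans ?_ (hmain n A u B h1 h2 hu)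
  have hN1 : (1 : ℝ) ≤ N := by exact_mod_cast hN
  have hd3 : (3 : ℝ) ≤ d := by exact_mod_cast hd
  have hlog : Real.log N ≤ ((n + 1 : ℕ) : ℝ) := by
    have h3 : (N : ℝ) ≤ 2 ^ n := by
      have : N ≤ 2 ^ n := by omega
      exact_mod_cast this
    have h4 := Real.log_le_log (by linarith) h3
    rw [Real.log_pow] at h4
    have h5 : (n : ℝ) * Real.log 2 ≤ n * 1 := by
      refine mul_le_mul_of_nonneg_left ?_ (Nat.cast_nonneg n)
      linarith [Real.log_two_lt_d9]
    push_cast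
    linarith
  refine mul_le_mul_of_nonneg_left ?_ hc.le
  exact Real.rpow_le_rpow (Real.log_nonneg hN1) hlog (by linarith)
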